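/- For $z\in\mathbb{C}$ write $y=\operatorname{Im} z$ and let $dm$ be Lebesgue measure on $\mathbb{C}$. Let $S$ be the Beurling transform $Sf(z)=-\frac1\pi\,\mathrm{p.v.}\!\int_{\mathbb{C}}\frac{f(w)}{(w-z)^2}\,dm(w)$, and let $L^2(dm/|y|)$ be the space of functions with $\int_{\mathbb{C}}|f|^2\frac{dm}{|y|}<\infty$ (its compactly supported elements lie in $L^2(\mathbb{C})$). For a quasiconformal homeomorphism $\rho:\mathbb{C}\to\mathbb{C}$ let $\mu_\rho=\overline\partial\rho/\partial\rho$ be its complex dilatation. A positive measure $\sigma$ on $\mathbb{C}$ is a Carleson measure if there is $C$ with $\sigma(\{w:|w-x|\le R\})\le CR$ for all $x\in\mathbb{R}$, $R>0$. The operator $I-\mu S$ is called invertible in $L^2(dm/|y|)$ if there is a constant $c$ such that $\|(I-\mu S)f\|_{L^2(dm/|y|)}\le c\,\|f\|_{L^2(dm/|y|)}$ for every compactly supported $f\in L^2(dm/|y|)$, and such that for every compactly supported $\Phi\in L^2(dm/|y|)$ the equation $(I-\mu S)h=\Phi$ has exactly one solution $h\in L^2(\mathbb{C})$, and $\|h\|_{L^2(dm/|y|)}\le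 c\,\|\Phi\|_{L^2(dm/|y|)}$. There exists a quasiconformal map $\rho:\mathbb{C}\to\mathbb{C}$ which is not bilipschitz, such that for $\mu=\mu_\rho$ the measure $\frac{|\mu|^2}{|y|}\,dm$ is a Carleson measure and the operator $I-\mu S$ is invertible in $L^2(dm/|y|)$. More precisely, for every $1<K<2$ the following map has all these properties: $\rho(re^{i\theta})=r^{1/K}e^{i\alpha(\theta)}$ for $r\ge0$, $-\pi<\theta\le\pi$, where $\alpha:[-\pi,\pi]\to[-\pi,\pi]$ is the odd continuous piecewise linear function with slope $1/K$ on $|\theta|\le\pi/4$ and on $|\theta|\ge3\pi/4$, slope $2-1/K$ on $\pi/4\le|\theta|\le3\pi/4$, and $\alpha(\pi)=\pi$. It extends the map $x\mapsto\operatorname{sgn}(x)|x|^{1/K}$ of the real line. -/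

import Mathlib

open MeasureTheory Filter Topology
open scoped ENNReal NNReal ContDiff

namespace QCBeurling

noncomputable section

/-! ### Quasiconformal maps of the plane -/

/-- `f` has the weak (distributional) Wirtinger derivatives `∂f = a` and `∂̄f = b`, both in
`L²_loc(ℂ)`. The two identities are the weak forms of `f_x = a + b` and `f_y = i (a - b)`, tested
against smooth compactly supported real functions. -/
structure HasWeakWirtinger (f a b : ℂ → ℂ) : Prop where
  memLp_left : ∀ s : Set ℂ, IsCompact s → MemLp a 2 (volume.restrict s)
  memLp_right : ∀ s : Set ℂ, IsCompact s → MemLp b 2 (volume.restrict s)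
  weak_x : ∀ φ : ℂ → ℝ, ContDiff ℝ ∞ φ → HasCompactSupport φ →
    ∫ z, (fderiv ℝ φ z 1) • f z = -∫ z, φ z • (a z + b z)
  weak_y : ∀ φ : ℂ → ℝ, ContDiff ℝ ∞ φ → HasCompactSupport φ →
    ∫ z, (fderiv ℝ φ z Complex.I) • f z = -∫ z, φ z • (Complex.I * (a z - b z))

/-- Quasiconformal map of the plane (analytic definition): a homeomorphism of `ℂ` in
`W^{1,2}_loc` with `|∂̄ρ| ≤ k |∂ρ|` almost everywhere for some constant `k < 1`. -/
def IsQuasiconformal (ρ : ℂ → ℂ) : Prop :=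
  IsHomeomorph ρ ∧ ∃ a b : ℂ → ℂ, HasWeakWirtinger ρ a b ∧
    ∃ k : ℝ, 0 ≤ k ∧ k < 1 ∧ ∀ᵐ z, ‖b z‖ ≤ k * ‖a z‖

/-- `μ` is (a representative of) the complex dilatation `∂̄ρ / ∂ρ` of `ρ`. -/
def IsComplexDilatation (ρ μ : ℂ → ℂ) : Prop :=
  ∃ a b : ℂ → ℂ, HasWeakWirtinger ρ a b ∧ ∀ᵐ z, μ z = b z / a z

/-- `C⁻¹ |z - w| ≤ |ρ(z) - ρ(w)| ≤ C |z - w|` for all `z, w`, with some constant `C > 0`. -/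
def IsBilipschitz (ρ : ℂ → ℂ) : Prop :=
  ∃ C : ℝ, 0 < C ∧ ∀ z w : ℂ, C⁻¹ * ‖z - w‖ ≤ ‖ρ z - ρ w‖ ∧ ‖ρ z - ρ w‖ ≤ C * ‖z - w‖

/-! ### The weight `1 / |y|` and Carleson measures -/

/-- The measure `dm / |y|` on `ℂ`, where `y = Im z`. -/
def weightMeasure : Measure ℂ :=
  (volume : Measure ℂ).withDensity fun z => (ENNReal.ofReal |z.im|)⁻¹

/-- The measure `(|μ|² / |y|) dm`. -/
def dilatationMeasure (μ : ℂ → ℂ) : Measure ℂ :=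
  weightMeasure.withDensity fun z => ‖μ z‖ₑ ^ 2

/-- Carleson measures relative to the real line. -/
def IsCarleson (σ : Measure ℂ) : Prop :=
  ∃ C : ℝ≥0, ∀ (x R : ℝ), 0 < R → σ (Metric.closedBall (x : ℂ) R) ≤ C * ENNReal.ofReal R

/-! ### The Beurling transform and invertibility of `I - μ S` -/

/-- Truncated Beurling transform `-(1/π) ∫_{|w-z|>ε} f(w) / (w-z)² dm(w)`. -/
def beurlingTrunc (f : ℂ → ℂ) (ε : ℝ) (z : ℂ) : ℂ :=
  -(1 / (Real.pi : ℂ)) * ∫ w in {w : ℂ | ε < ‖w - z‖}, f w / (w - z) ^ 2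

/-- `g = S f`: the principal value integral `-(1/π) p.v. ∫ f(w) / (w-z)² dm(w)` exists and equals
`g z` for almost every `z`. -/
def IsBeurlingTransform (f g : ℂ → ℂ) : Prop :=
  ∀ᵐ z, Tendsto (fun ε : ℝ => beurlingTrunc f ε z) (𝓝[>] 0) (𝓝 (g z))

/-- `(I - μ S) h = Φ` almost everywhere. -/
def BeurlingEq (μ h Φ : ℂ → ℂ) : Prop :=
  ∃ g : ℂ → ℂ, IsBeurlingTransform h g ∧ ∀ᵐ z, h z - μ z * g z = Φ z

/-- `I - μ S` is bounded on `L²(dm/|y|)`: it is defined on the compactly supported elements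
(a dense subspace, contained in `L²(ℂ)`) and satisfies a norm estimate there. -/
def BoundedOnWeighted (μ : ℂ → ℂ) : Prop :=
  ∃ c : ℝ≥0, ∀ f : ℂ → ℂ, MemLp f 2 weightMeasure → HasCompactSupport f →
    ∃ Φ : ℂ → ℂ, BeurlingEq μ f Φ ∧ AEStronglyMeasurable Φ weightMeasure ∧
      eLpNorm Φ 2 weightMeasure ≤ c * eLpNorm f 2 weightMeasure

/-- `(I - μ S)⁻¹` is bounded on `L²(dm/|y|)`: for each compactly supported `Φ ∈ L²(dm/|y|)` the
equation `(I - μ S) h = Φ` has one and only one solution `h ∈ L²(ℂ)`, and it satisfies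
`‖h‖ ≤ c ‖Φ‖` in `L²(dm/|y|)` with `c` independent of `Φ`. -/
def InverseBoundedOnWeighted (μ : ℂ → ℂ) : Prop :=
  ∃ c : ℝ≥0, ∀ Φ : ℂ → ℂ, MemLp Φ 2 weightMeasure → HasCompactSupport Φ →
    ∃ h : ℂ → ℂ, MemLp h 2 volume ∧ BeurlingEq μ h Φ ∧
      (∀ h' : ℂ → ℂ, MemLp h' 2 volume → BeurlingEq μ h' Φ → h' =ᵐ[volume] h) ∧
      eLpNorm h 2 weightMeasure ≤ c * eLpNorm Φ 2 weightMeasure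

/-- `I - μ S` is a bounded and boundedly invertible operator on `L²(dm/|y|)`. -/
def InvertibleOnWeighted (μ : ℂ → ℂ) : Prop :=
  BoundedOnWeighted μ ∧ InverseBoundedOnWeighted μ

/-! ### The map of the example -/

/-- The odd, continuous, piecewise linear function on `[-π, π]` with slope `1/K` for `|θ| ≤ π/4`
and for `|θ| ≥ 3π/4`, slope `2 - 1/K` in between, and value `±π` at `±π`. -/
def stretchAngle (K θ : ℝ) : ℝ :=
  if |θ| ≤ Real.pi / 4 then θ / K
  else if |θ| ≤ 3 * Real.pi / 4 then
    Real.sign θ * (Real.pi / (4 * K) + (2 - 1 / K) * (|θ| - Real.pi / 4))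
  else Real.sign θ * (Real.pi - (Real.pi - |θ|) / K)

/-- The map `r e^{iθ} ↦ r^{1/K} e^{i α(θ)}`, `-π < θ ≤ π`, with `α` the function above. -/
def stretchMap (K : ℝ) (z : ℂ) : ℂ :=
  ((‖z‖ ^ (1 / K) : ℝ) : ℂ) * Complex.exp ((stretchAngle K z.arg : ℝ) * Complex.I)

end

end QCBeurling

open MeasureTheory Filter Topology
open scoped ENNReal NNReal ContDiff

namespace QCBeurling

noncomputable section

/-! ### Wirtinger derivatives -/

/-! Write `c = 1/K`. In the sectors `|y| < |x|` the map `ρ` is `z^c` up to the symmetry `ρ(-z) =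
-ρ(z)`, hence holomorphic. For `|x| < y` it is `z (i z̄)^(c-1)`, so that `|μ| = 1 - c` there. Thus
`ρ` is quasiconformal, and `μ` lives where `|y|` is comparable to `|z|`, which gives the Carleson
condition at once (`isCarleson_dilatationMeasure`). Since `|ρ(z)| = |z|^c` with `c < 1`, the map is
not Lipschitz at the origin.

On the support of `μ` the weight `1/|y|` may be replaced by `1/|z|`, and `1/|z| ≤ 1/|y|` everywhere.
Boundedness of `I - μS` therefore reduces to that of `S` on `L²(dm/|z|)`. More generally
`exists_weighted_bound` treats `|z|^(-2t)` with `|t| < 1`: the difference between `S` and its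
conjugate by `|z|^t` has a kernel homogeneous of degree `-2`, to which Schur's test applies with the
test function `1/|z|`.

For the inverse, the equation is solved by a change of variables. If `Ψ = ∂̄v`, then `h = ∂̄(v ∘ ρ)`
satisfies `Sh = ∂(v ∘ ρ)`, and the chain rule gives `h - μ Sh = (Ψ ∘ ρ) conj(∂ρ) (1 - |μ|²)`.
Equating this to `Φ` determines `Ψ` explicitly (`exists_beurlingEq`). The part of `h` containing
`SΨ` carries the factor `∂̄ρ`, so only the weight `1/|z| = |ρ(z)|^(-K)` matters for it. Changing
variables turns this into the weight `|w|^(-K)`, that is `t = K/2`, and the condition `K < 2` is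
exactly `t < 1`. Uniqueness follows from `‖μ‖_∞ < 1` and the `L²` isometry of `S`.

Two bridges connect this with the definitions. First, `S` is constructed on `L²` as the Fourier
multiplier `ξ̄/ξ`, and `CurlFree.beurlingL2_eq` shows that it sends `b` to `a` whenever `∂̄a = ∂b`
weakly. Secondly, a suitable function attached to a disc shows that averages of `Sf` over discs are
exactly the truncated integrals (`average_beurlingL2`), so the principal value exists almost
everywhere by Lebesgue differentiation. -/

/-- The Wirtinger derivative `∂f = (f_x - i f_y) / 2`. -/
def dz (f : ℂ → ℂ) (z : ℂ) : ℂ := (fderiv ℝ f z 1 - Complex.I * fderiv ℝ f z Complex.I) / 2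

/-- The Wirtinger derivative `∂̄f = (f_x + i f_y) / 2`. -/
def dzbar (f : ℂ → ℂ) (z : ℂ) : ℂ := (fderiv ℝ f z 1 + Complex.I * fderiv ℝ f z Complex.I) / 2

lemma dz_add_dzbar (f : ℂ → ℂ) (z : ℂ) : dz f z + dzbar f z = fderiv ℝ f z 1 := by
  simp only [dz, dzbar]; ring

lemma I_mul_dz_sub_dzbar (f : ℂ → ℂ) (z : ℂ) :
    Complex.I * (dz f z - dzbar f z) = fderiv ℝ f z Complex.I := by
  simp only [dz, dzbar]
  ring_nf
  simp

lemma fderiv_apply_eq (f : ℂ → ℂ) (z v : ℂ) :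
    fderiv ℝ f z v = dz f z * v + dzbar f z * (starRingEnd ℂ) v := by
  have hv : v = v.re • (1 : ℂ) + v.im • Complex.I := by
    apply Complex.ext <;> simp
  have h1 := dz_add_dzbar f z
  have h2 := I_mul_dz_sub_dzbar f z
  have h3 : fderiv ℝ f z v = v.re • fderiv ℝ f z 1 + v.im • fderiv ℝ f z Complex.I := by
    conv_lhs => rw [hv]
    rw [map_add, map_smul, map_smul]
  rw [h3, ← h1, ← h2]
  conv_rhs => rw [← Complex.re_add_im v]
  simp only [Complex.real_smul, map_add, map_mul, Complex.conj_ofReal, Complex.conj_I]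
  ring

lemma measurable_dz (f : ℂ → ℂ) : Measurable (dz f) :=
  ((measurable_fderiv_apply_const ℝ f 1).sub
    ((measurable_fderiv_apply_const ℝ f Complex.I).const_mul Complex.I)).div_const 2

lemma measurable_dzbar (f : ℂ → ℂ) : Measurable (dzbar f) :=
  ((measurable_fderiv_apply_const ℝ f 1).add
    ((measurable_fderiv_apply_const ℝ f Complex.I).const_mul Complex.I)).div_const 2

/-- The real linear map `v ↦ a v + b v̄`. -/
def wirtingerCLM (a b : ℂ) : ℂ →L[ℝ] ℂ :=
  a • ContinuousLinearMap.id ℝ ℂ + b • (Complex.conjCLE : ℂ →L[ℝ] ℂ)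

@[simp] lemma wirtingerCLM_apply (a b v : ℂ) :
    wirtingerCLM a b v = a * v + b * (starRingEnd ℂ) v := by
  simp [wirtingerCLM]

lemma hasFDerivAt_wirtinger {f : ℂ → ℂ} {z : ℂ} (hf : DifferentiableAt ℝ f z) :
    HasFDerivAt f (wirtingerCLM (dz f z) (dzbar f z)) z := by
  have : wirtingerCLM (dz f z) (dzbar f z) = fderiv ℝ f z := by
    ext v; simp [fderiv_apply_eq]
  rw [this]
  exact hf.hasFDerivAt

lemma _root_.HasFDerivAt.dz_eq {f : ℂ → ℂ} {z a b : ℂ} (hf : HasFDerivAt f (wirtingerCLM a b) z) :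
    dz f z = a := by
  rw [dz, hf.fderiv]
  simp only [wirtingerCLM_apply, map_one, Complex.conj_I]
  linear_combination (-(a - b) / 2) * Complex.I_mul_I

lemma _root_.HasFDerivAt.dzbar_eq {f : ℂ → ℂ} {z a b : ℂ}
    (hf : HasFDerivAt f (wirtingerCLM a b) z) : dzbar f z = b := by
  rw [dzbar, hf.fderiv]
  simp only [wirtingerCLM_apply, map_one, Complex.conj_I]
  linear_combination ((a - b) / 2) * Complex.I_mul_I

lemma wirtingerCLM_comp (a b c d : ℂ) : (wirtingerCLM a b).comp (wirtingerCLM c d) =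
    wirtingerCLM (a * c + b * (starRingEnd ℂ) d) (a * d + b * (starRingEnd ℂ) c) := by
  ext v
  · simp only [ContinuousLinearMap.comp_apply, wirtingerCLM_apply, map_add, map_mul,
      Complex.conj_conj]
    ring_nf

lemma det_wirtingerCLM (a b : ℂ) : (wirtingerCLM a b).det = ‖a‖ ^ 2 - ‖b‖ ^ 2 := by
  rw [ContinuousLinearMap.det, ← LinearMap.det_toMatrix Complex.basisOneI, Matrix.det_fin_two,
    ← Complex.normSq_eq_norm_sq, ← Complex.normSq_eq_norm_sq]
  simp only [LinearMap.toMatrix_apply, Complex.coe_basisOneI, Complex.coe_basisOneI_repr,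
    ContinuousLinearMap.coe_coe, wirtingerCLM_apply]
  simp [Complex.normSq_apply]
  ring

/-! ### Weak derivatives of functions that are differentiable off a small set -/

/-- The fundamental theorem of calculus tolerates a countable exceptional set; it is applied on
`[-n, n]` with `n` beyond the support. -/
lemma integral_eq_zero_of_hasDerivAt_off_countable {F g : ℝ → ℂ} {s : Set ℝ} (hs : s.Countable)
    (hF : Continuous F) (hc : HasCompactSupport F) (hd : ∀ x, x ∉ s → HasDerivAt F (g x) x)
    (hg : Integrable g) : ∫ x, g x = 0 := by
  obtain ⟨R, hR⟩ := hc.isCompact.isBounded.subset_closedBall 0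
  have h1 : Tendsto (fun n : ℝ => ∫ x in (-n)..n, g x) atTop (𝓝 (∫ x, g x)) :=
    intervalIntegral_tendsto_integral hg tendsto_neg_atTop_atBot tendsto_id
  have hz : ∀ x, R < |x| → F x = 0 := by
    intro x hx
    by_contra h
    have := hR (subset_tsupport F h)
    simp at this
    linarith
  have h2 : (fun n : ℝ => ∫ x in (-n)..n, g x) =ᶠ[atTop] fun _ => 0 := by
    filter_upwards [eventually_gt_atTop (max R 0)] with n hn
    have hn0 : 0 < n := lt_of_le_of_lt (le_max_right _ _) hn
    have hnR : R < n := lt_of_le_of_lt (le_max_left _ _) hn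
    rw [MeasureTheory.integral_eq_of_hasDerivAt_off_countable F g hs hF.continuousOn
      (fun x hx => hd x hx.2) hg.intervalIntegrable, hz n (by rwa [abs_of_pos hn0]),
      hz (-n) (by rwa [abs_neg, abs_of_pos hn0]), sub_zero]
  exact tendsto_nhds_unique (h1.congr' h2) tendsto_const_nhds |>.trans rfl

lemma integral_complex_eq (g : ℂ → ℂ) :
    ∫ z, g z = ∫ p : ℝ × ℝ, g (p.1 + p.2 * Complex.I) := by
  rw [← (Complex.volume_preserving_equiv_real_prod.symm).integral_comp
    Complex.measurableEquivRealProd.symm.measurableEmbedding]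
  congr 1
  ext p
  congr 1
  apply Complex.ext <;> simp

lemma integrable_complex_iff (g : ℂ → ℂ) :
    Integrable g ↔ Integrable (fun p : ℝ × ℝ => g (p.1 + p.2 * Complex.I)) := by
  rw [← (Complex.volume_preserving_equiv_real_prod.symm).integrable_comp_emb
    Complex.measurableEquivRealProd.symm.measurableEmbedding]
  have : g ∘ Complex.measurableEquivRealProd.symm =
      fun p : ℝ × ℝ => g (p.1 + p.2 * Complex.I) := by
    ext p
    simp only [Function.comp]
    congr 1
    apply Complex.ext <;> simp
  rw [this]

lemma isClosedEmbedding_horizontal (y : ℝ) :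
    IsClosedEmbedding (fun x : ℝ => (x : ℂ) + y * Complex.I) :=
  (Homeomorph.addRight ((y : ℂ) * Complex.I)).isClosedEmbedding.comp
    Complex.isometry_ofReal.isClosedEmbedding

lemma isClosedEmbedding_vertical (x : ℝ) :
    IsClosedEmbedding (fun y : ℝ => (x : ℂ) + y * Complex.I) :=
  ((Homeomorph.addLeft (x : ℂ)).isClosedEmbedding.comp
    (Homeomorph.mulRight₀ Complex.I Complex.I_ne_zero).isClosedEmbedding).comp
    Complex.isometry_ofReal.isClosedEmbedding

/-- A set that almost every horizontal and almost every vertical line meets in countably many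
points. -/
structure MeetsLinesCountably (N : Set ℂ) : Prop where
  horizontal : ∀ᵐ y : ℝ, {x : ℝ | (x : ℂ) + y * Complex.I ∈ N}.Countable
  vertical : ∀ᵐ x : ℝ, {y : ℝ | (x : ℂ) + y * Complex.I ∈ N}.Countable

lemma MeetsLinesCountably.empty : MeetsLinesCountably ∅ := ⟨by simp, by simp⟩

/-- Fubini reduces this to almost every horizontal line, where the one-dimensional statement
applies. -/
lemma integral_fderiv_one_eq_zero {F g : ℂ → ℂ} {N : Set ℂ} (hN : MeetsLinesCountably N)
    (hF : Continuous F) (hc : HasCompactSupport F)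
    (hd : ∀ z, z ∉ N → ∃ L : ℂ →L[ℝ] ℂ, HasFDerivAt F L z ∧ L 1 = g z) (hg : Integrable g) :
    ∫ z, g z = 0 := by
  rw [integral_complex_eq]
  rw [integrable_complex_iff] at hg
  rw [Measure.volume_eq_prod] at hg ⊢
  rw [integral_prod_symm _ hg]
  apply integral_eq_zero_of_ae
  filter_upwards [hN.horizontal, hg.prod_left_ae] with y hy hgy
  refine integral_eq_zero_of_hasDerivAt_off_countable hy
    (F := fun x : ℝ => F (x + y * Complex.I)) (by fun_prop)
    (hc.comp_isClosedEmbedding (isClosedEmbedding_horizontal y)) (fun x hx => ?_) hgy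
  obtain ⟨L, hL, hL1⟩ := hd _ hx
  have h1 : HasDerivAt (fun x : ℝ => (x : ℂ) + y * Complex.I) 1 x :=
    (Complex.ofRealCLM.hasDerivAt (x := x)).add_const _ |>.congr_deriv (by simp)
  rw [← hL1]
  exact hL.comp_hasDerivAt x h1

lemma integral_fderiv_I_eq_zero {F g : ℂ → ℂ} {N : Set ℂ} (hN : MeetsLinesCountably N)
    (hF : Continuous F) (hc : HasCompactSupport F)
    (hd : ∀ z, z ∉ N → ∃ L : ℂ →L[ℝ] ℂ, HasFDerivAt F L z ∧ L Complex.I = g z)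
    (hg : Integrable g) :
    ∫ z, g z = 0 := by
  rw [integral_complex_eq]
  rw [integrable_complex_iff] at hg
  rw [Measure.volume_eq_prod] at hg ⊢
  rw [integral_prod _ hg]
  apply integral_eq_zero_of_ae
  filter_upwards [hN.vertical, hg.prod_right_ae] with x hx hgx
  refine integral_eq_zero_of_hasDerivAt_off_countable hx
    (F := fun y : ℝ => F (x + y * Complex.I)) (by fun_prop)
    (hc.comp_isClosedEmbedding (isClosedEmbedding_vertical x)) (fun y hy => ?_) hgx
  obtain ⟨L, hL, hL1⟩ := hd _ hy
  have h1 : HasDerivAt (fun y : ℝ => (x : ℂ) + y * Complex.I) Complex.I y :=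
    ((Complex.ofRealCLM.hasDerivAt (x := y)).mul_const Complex.I).const_add _ |>.congr_deriv
      (by simp)
  rw [← hL1]
  exact hL.comp_hasDerivAt y h1

/-- The product `φ f` is continuous with compact support and differentiable off `N`, so its partial
derivatives integrate to zero; this is integration by parts. Every weak derivative in the proof
comes from here. -/
lemma hasWeakWirtinger_of_differentiableAt {f : ℂ → ℂ} {N : Set ℂ} (hN : MeetsLinesCountably N)
    (hf : Continuous f) (hd : ∀ z, z ∉ N → DifferentiableAt ℝ f z)
    (h1 : ∀ s : Set ℂ, IsCompact s → MemLp (dz f) 2 (volume.restrict s))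
    (h2 : ∀ s : Set ℂ, IsCompact s → MemLp (dzbar f) 2 (volume.restrict s)) :
    HasWeakWirtinger f (dz f) (dzbar f) := by
  have hloc : ∀ {a : ℂ → ℂ}, (∀ s : Set ℂ, IsCompact s → MemLp a 2 (volume.restrict s)) →
      LocallyIntegrable a := by
    intro a ha
    rw [locallyIntegrable_iff]
    intro s hs
    have : IsFiniteMeasure ((volume : Measure ℂ).restrict s) :=
      ⟨by simpa using hs.measure_lt_top⟩
    exact (ha s hs).integrable (by norm_num)
  have hφ : ∀ (φ : ℂ → ℝ), ContDiff ℝ ∞ φ → HasCompactSupport φ → ∀ {a : ℂ → ℂ},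
      LocallyIntegrable a → Integrable (fun z => φ z • a z) := fun φ h hc a ha =>
    ha.integrable_smul_left_of_hasCompactSupport h.continuous hc
  have hcs : ∀ (φ : ℂ → ℝ), ContDiff ℝ ∞ φ → HasCompactSupport φ → ∀ v : ℂ,
      Integrable (fun z => (fderiv ℝ φ z v) • f z) := by
    intro φ h hc v
    refine hf.locallyIntegrable.integrable_smul_left_of_hasCompactSupport ?_ (hc.fderiv_apply ℝ v)
    exact (h.continuous_fderiv (by simp)).clm_apply continuous_const
  have hL : ∀ (φ : ℂ → ℝ), ContDiff ℝ ∞ φ → ∀ z, z ∉ N →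
      HasFDerivAt (fun z => φ z • f z) (φ z • fderiv ℝ f z + (fderiv ℝ φ z).smulRight (f z)) z :=
    fun φ h z hz => ((h.differentiable (by simp)) z).hasFDerivAt.smul (hd z hz).hasFDerivAt
  refine ⟨h1, h2, fun φ h hc => ?_, fun φ h hc => ?_⟩
  · simp only [dz_add_dzbar]
    have ha : Integrable (fun z => φ z • fderiv ℝ f z 1) := by
      simp only [← dz_add_dzbar, smul_add]
      exact (hφ φ h hc (hloc h1)).add (hφ φ h hc (hloc h2))
    have := integral_fderiv_one_eq_zero hN (h.continuous.smul hf) hc.smul_right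
      (g := fun z => fderiv ℝ φ z 1 • f z + φ z • fderiv ℝ f z 1)
      (fun z hz => ⟨_, hL φ h z hz, by simp [add_comm]⟩) ((hcs φ h hc 1).add ha)
    rw [integral_add (hcs φ h hc 1) ha] at this
    exact eq_neg_of_add_eq_zero_left this
  · simp only [I_mul_dz_sub_dzbar]
    have ha : Integrable (fun z => φ z • fderiv ℝ f z Complex.I) := by
      simp only [← I_mul_dz_sub_dzbar, mul_sub, smul_sub, ← mul_smul_comm]
      exact ((hφ φ h hc (hloc h1)).const_mul _).sub ((hφ φ h hc (hloc h2)).const_mul _)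
    have := integral_fderiv_I_eq_zero hN (h.continuous.smul hf) hc.smul_right
      (g := fun z => fderiv ℝ φ z Complex.I • f z + φ z • fderiv ℝ f z Complex.I)
      (fun z hz => ⟨_, hL φ h z hz, by simp [add_comm]⟩) ((hcs φ h hc Complex.I).add ha)
    rw [integral_add (hcs φ h hc Complex.I) ha] at this
    exact eq_neg_of_add_eq_zero_left this

/-! ### Operators on `L²` given by pointwise formulas -/

/-- The bounded operator on `L²(ℂ)` induced by a linear operator on functions. -/
def lpOp (T : (ℂ → ℂ) →ₗ[ℂ] (ℂ → ℂ)) (C : ℝ≥0) (hae : ∀ f g, f =ᵐ[volume] g → T f =ᵐ[volume] T g)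
    (hm : ∀ f, MemLp f 2 → MemLp (T f) 2)
    (hb : ∀ f, MemLp f 2 → eLpNorm (T f) 2 volume ≤ C * eLpNorm f 2 volume) :
    Lp ℂ 2 (volume : Measure ℂ) →L[ℂ] Lp ℂ 2 (volume : Measure ℂ) :=
  LinearMap.mkContinuous
    { toFun := fun f => (hm f (Lp.memLp f)).toLp
      map_add' := fun f g => by
        rw [← MemLp.toLp_add]
        apply MemLp.toLp_congr
        rw [← map_add]
        exact hae _ _ (Lp.coeFn_add f g)
      map_smul' := fun c f => by
        rw [RingHom.id_apply, ← MemLp.toLp_const_smul]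
        apply MemLp.toLp_congr
        rw [← map_smul]
        exact hae _ _ (Lp.coeFn_smul c f) } C (fun f => by
      simp only [LinearMap.coe_mk, AddHom.coe_mk]
      rw [Lp.norm_toLp, Lp.norm_def]
      have := ENNReal.toReal_mono (ENNReal.mul_ne_top ENNReal.coe_ne_top (Lp.eLpNorm_ne_top f))
        (hb f (Lp.memLp f))
      simpa using this)

lemma lpOp_coeFn (T : (ℂ → ℂ) →ₗ[ℂ] (ℂ → ℂ)) (C : ℝ≥0) (hae) (hm) (hb)
    (f : Lp ℂ 2 (volume : Measure ℂ)) : lpOp T C hae hm hb f =ᵐ[volume] T f :=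
  (hm f (Lp.memLp f)).coeFn_toLp

/-! ### The Beurling transform on `L²` as a Fourier multiplier -/

/-- Multiplication by the symbol `ξ̄ / ξ`. -/
def symbolMul : (ℂ → ℂ) →ₗ[ℂ] (ℂ → ℂ) where
  toFun f ξ := (starRingEnd ℂ) ξ / ξ * f ξ
  map_add' f g := by ext; simp [mul_add]
  map_smul' c f := by ext; simp; ring

lemma norm_symbolMul {ξ : ℂ} (f : ℂ → ℂ) (hξ : ξ ≠ 0) : ‖symbolMul f ξ‖ = ‖f ξ‖ := by
  simp [symbolMul, div_self (norm_ne_zero_iff.2 hξ)]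

lemma norm_symbolMul_ae (f : ℂ → ℂ) : ∀ᵐ ξ, ‖symbolMul f ξ‖ = ‖f ξ‖ := by
  filter_upwards [Measure.ae_ne volume (0 : ℂ)] with ξ hξ using norm_symbolMul f hξ

lemma memLp_symbolMul (f : ℂ → ℂ) (hf : MemLp f 2) : MemLp (symbolMul f) 2 := by
  refine hf.of_le ?_ ((norm_symbolMul_ae f).mono fun _ h => h.le)
  exact ((Complex.continuous_conj.measurable.div measurable_id).aestronglyMeasurable).mul
    hf.aestronglyMeasurable

/-- Multiplication by the symbol `ξ̄ / ξ` on `L²`. -/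
def symbolOp : Lp ℂ 2 (volume : Measure ℂ) →L[ℂ] Lp ℂ 2 (volume : Measure ℂ) :=
  lpOp symbolMul 1 (fun f g h => h.mono fun ξ hξ => by simp [symbolMul, hξ]) memLp_symbolMul
    (fun f _ => by
      rw [ENNReal.coe_one, one_mul]
      exact (eLpNorm_congr_norm_ae (norm_symbolMul_ae f)).le)

lemma norm_symbolOp (f : Lp ℂ 2 (volume : Measure ℂ)) : ‖symbolOp f‖ = ‖f‖ := by
  have h : symbolOp f =ᵐ[volume] symbolMul f := lpOp_coeFn _ _ _ _ _ f
  rw [Lp.norm_def, Lp.norm_def, eLpNorm_congr_ae h,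
    eLpNorm_congr_norm_ae (norm_symbolMul_ae f)]

/-- The Beurling transform on `L²(ℂ)`. -/
def beurlingL2 : Lp ℂ 2 (volume : Measure ℂ) →ₗᵢ[ℂ] Lp ℂ 2 (volume : Measure ℂ) where
  toLinearMap := ((Lp.fourierTransformₗᵢ ℂ ℂ).symm.toLinearEquiv.toLinearMap.comp
    symbolOp.toLinearMap).comp (Lp.fourierTransformₗᵢ ℂ ℂ).toLinearEquiv.toLinearMap
  norm_map' f := by simp [norm_symbolOp]

lemma beurlingL2_apply (f : Lp ℂ 2 (volume : Measure ℂ)) :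
    beurlingL2 f = (Lp.fourierTransformₗᵢ ℂ ℂ).symm (symbolOp (Lp.fourierTransformₗᵢ ℂ ℂ f)) := rfl

/-! ### Curl-free pairs `∂̄a = ∂b` and their relation `a = S b` -/

/-- The pair `(a, b)` satisfies `∂̄ a = ∂ b` in the weak sense, so that it can be the pair of weak
Wirtinger derivatives `(∂u, ∂̄u)`. -/
def CurlFree (a b : ℂ → ℂ) : Prop := ∀ φ : ℂ → ℝ, ContDiff ℝ ∞ φ → HasCompactSupport φ →
  ∫ z, (fderiv ℝ φ z 1 - Complex.I * fderiv ℝ φ z Complex.I) * b z =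
    ∫ z, (fderiv ℝ φ z 1 + Complex.I * fderiv ℝ φ z Complex.I) * a z

lemma integrable_mul_of_memLp {f g : ℂ → ℂ} (hf : MemLp f 2) (hg : MemLp g 2) :
    Integrable (fun z => f z * g z) := MemLp.integrable_mul hf hg

lemma integrable_testFunction_mul {φ : ℂ → ℝ} (h : Continuous φ) (hc : HasCompactSupport φ)
    {a : ℂ → ℂ} (ha : ∀ s : Set ℂ, IsCompact s → MemLp a 2 (volume.restrict s)) :
    Integrable (fun z => (φ z : ℂ) * a z) := by
  have : LocallyIntegrable a := by
    rw [locallyIntegrable_iff]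
    intro s hs
    have : IsFiniteMeasure ((volume : Measure ℂ).restrict s) :=
      ⟨by simpa using hs.measure_lt_top⟩
    exact (ha s hs).integrable (by norm_num)
  simpa [Complex.real_smul] using this.integrable_smul_left_of_hasCompactSupport h hc

/-- Testing the `x`-identity with `φ_y` and the `y`-identity with `φ_x` gives two expressions for
the same integral, because `φ_xy = φ_yx`. -/
lemma HasWeakWirtinger.curlFree {f a b : ℂ → ℂ} (h : HasWeakWirtinger f a b) : CurlFree a b := by
  intro φ hφ hc
  have hd : ∀ v : ℂ, ContDiff ℝ ∞ (fun z => fderiv ℝ φ z v) := fun v =>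
    (hφ.fderiv_right (m := ∞) (by simp)).clm_apply contDiff_const
  have hsymm : ∀ z, fderiv ℝ (fun z => fderiv ℝ φ z Complex.I) z 1 =
      fderiv ℝ (fun z => fderiv ℝ φ z 1) z Complex.I := by
    intro z
    have hdd : DifferentiableAt ℝ (fderiv ℝ φ) z :=
      (hφ.fderiv_right (m := ∞) (by simp)).differentiable (by simp) z
    rw [fderiv_clm_apply hdd (differentiableAt_const _),
      fderiv_clm_apply hdd (differentiableAt_const _)]
    simpa using (hφ.contDiffAt.isSymmSndFDerivAt
      (by simp; exact WithTop.coe_le_coe.2 le_top)) 1 Complex.I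
  have h1 := h.weak_x _ (hd Complex.I) (hc.fderiv_apply ℝ Complex.I)
  have h2 := h.weak_y _ (hd 1) (hc.fderiv_apply ℝ 1)
  simp only [hsymm] at h1
  have h3 := neg_injective (h1.symm.trans h2)
  simp only [Complex.real_smul] at h3
  have i1 : ∀ v, Integrable (fun z => (fderiv ℝ φ z v : ℂ) * a z) := fun v =>
    integrable_testFunction_mul (hd v).continuous (hc.fderiv_apply ℝ v) h.memLp_left
  have i2 : ∀ v, Integrable (fun z => (fderiv ℝ φ z v : ℂ) * b z) := fun v =>
    integrable_testFunction_mul (hd v).continuous (hc.fderiv_apply ℝ v) h.memLp_right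
  have e1 : ∫ z, (fderiv ℝ φ z Complex.I : ℂ) * (a z + b z) =
      (∫ z, (fderiv ℝ φ z Complex.I : ℂ) * a z) + ∫ z, (fderiv ℝ φ z Complex.I : ℂ) * b z := by
    rw [← integral_add (i1 _) (i2 _)]
    simp only [mul_add]
  have e2 : ∫ z, (fderiv ℝ φ z 1 : ℂ) * (Complex.I * (a z - b z)) =
      Complex.I * ((∫ z, (fderiv ℝ φ z 1 : ℂ) * a z) - ∫ z, (fderiv ℝ φ z 1 : ℂ) * b z) := by
    rw [← integral_sub (i1 _) (i2 _), ← integral_const_mul]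
    congr 1; ext z; ring
  have e3 : ∫ z, (fderiv ℝ φ z 1 - Complex.I * fderiv ℝ φ z Complex.I) * b z =
      (∫ z, (fderiv ℝ φ z 1 : ℂ) * b z) -
        Complex.I * ∫ z, (fderiv ℝ φ z Complex.I : ℂ) * b z := by
    rw [← integral_const_mul, ← integral_sub (i2 _) ((i2 _).const_mul _)]
    congr 1; ext z; ring
  have e4 : ∫ z, (fderiv ℝ φ z 1 + Complex.I * fderiv ℝ φ z Complex.I) * a z =
      (∫ z, (fderiv ℝ φ z 1 : ℂ) * a z) +
        Complex.I * ∫ z, (fderiv ℝ φ z Complex.I : ℂ) * a z := by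
    rw [← integral_const_mul, ← integral_add (i1 _) ((i1 _).const_mul _)]
    congr 1; ext z; ring
  rw [e1, e2] at h3
  rw [e3, e4]
  linear_combination (-Complex.I) * h3 + ((∫ z, (fderiv ℝ φ z 1 : ℂ) * b z) -
    ∫ z, (fderiv ℝ φ z 1 : ℂ) * a z) * Complex.I_mul_I

/-- Smooth cutoff functions. -/
lemma exists_cutoff : ∃ (χ : ℕ → ℂ → ℝ) (M : ℝ), (∀ n, ContDiff ℝ ∞ (χ n)) ∧
    (∀ n, HasCompactSupport (χ n)) ∧ (∀ n z, |χ n z| ≤ 1) ∧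
    (∀ z, Tendsto (fun n => χ n z) atTop (𝓝 1)) ∧
    (∀ n z v, |fderiv ℝ (χ n) z v| ≤ M / (n + 1) * ‖v‖) := by
  let χ : ContDiffBump (0 : ℂ) := ⟨1, 2, one_pos, one_lt_two⟩
  have hχ : ContDiff ℝ ∞ χ := χ.contDiff
  obtain ⟨M, hM⟩ := (hχ.continuous_fderiv (by simp)).bounded_above_of_compact_support
    (χ.hasCompactSupport.fderiv ℝ)
  have hpos : ∀ n : ℕ, (0 : ℝ) < n + 1 := fun n => by positivity
  refine ⟨fun n z => χ (((n : ℝ) + 1)⁻¹ • z), M, fun n => hχ.comp (contDiff_const_smul _),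
    fun n => χ.hasCompactSupport.comp_isClosedEmbedding
      (Homeomorph.smulOfNeZero (α := ℂ) (((n : ℝ) + 1)⁻¹)
        (inv_ne_zero (hpos n).ne')).isClosedEmbedding,
    fun n z => by rw [abs_of_nonneg χ.nonneg]; exact χ.le_one, fun z => ?_, fun n z v => ?_⟩
  · apply tendsto_const_nhds.congr'
    obtain ⟨N, hN⟩ := exists_nat_ge ‖z‖
    filter_upwards [eventually_ge_atTop N] with n hn
    symm
    apply χ.one_of_mem_closedBall
    rw [mem_closedBall_zero_iff, norm_smul, norm_inv, Real.norm_of_nonneg (hpos n).le,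
      inv_mul_le_iff₀ (hpos n)]
    have : (N : ℝ) ≤ n := by exact_mod_cast hn
    change ‖z‖ ≤ (n + 1) * 1
    linarith
  · have h1 : HasFDerivAt (fun z => χ (((n : ℝ) + 1)⁻¹ • z))
        ((fderiv ℝ χ (((n : ℝ) + 1)⁻¹ • z)).comp
          (((n : ℝ) + 1)⁻¹ • ContinuousLinearMap.id ℝ ℂ)) z :=
      ((hχ.differentiable (by simp)) _).hasFDerivAt.comp z
        (((n : ℝ) + 1)⁻¹ • ContinuousLinearMap.id ℝ ℂ).hasFDerivAt
    rw [h1.fderiv]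
    simp only [ContinuousLinearMap.comp_apply, _root_.smul_apply,
      ContinuousLinearMap.id_apply, map_smul, smul_eq_mul, abs_mul, abs_inv, abs_of_pos (hpos n)]
    have := (fderiv ℝ χ (((n : ℝ) + 1)⁻¹ • z)).le_of_opNorm_le (hM _) v
    rw [Real.norm_eq_abs] at this
    rw [div_mul_eq_mul_div, div_eq_inv_mul]
    gcongr

/-- Removes compact support: test with `χ_n φ` and let `n → ∞`. The extra term `φ ∇χ_n` tends to
zero and is dominated by a multiple of `|φ|`, which lies in `L²`. -/
lemma CurlFree.of_memLp {a b : ℂ → ℂ} (h : CurlFree a b) (ha : MemLp a 2) (hb : MemLp b 2)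
    {φ : ℂ → ℝ} (hφ : ContDiff ℝ ∞ φ) (h0 : MemLp (fun z => (φ z : ℂ)) 2)
    (h1 : ∀ v, MemLp (fun z => (fderiv ℝ φ z v : ℂ)) 2) :
    ∫ z, (fderiv ℝ φ z 1 - Complex.I * fderiv ℝ φ z Complex.I) * b z =
    ∫ z, (fderiv ℝ φ z 1 + Complex.I * fderiv ℝ φ z Complex.I) * a z := by
  obtain ⟨χ, M, hχ, hc, hχ1, hlim, hM⟩ := exists_cutoff
  have hM0 : 0 ≤ M := by simpa using (abs_nonneg _).trans (hM 0 0 1)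
  have hder : ∀ n z v, fderiv ℝ (fun z => χ n z * φ z) z v =
      χ n z * fderiv ℝ φ z v + φ z * fderiv ℝ (χ n) z v := by
    intro n z v
    rw [fderiv_fun_mul ((hχ n).differentiable (by simp) z) (hφ.differentiable (by simp) z)]
    simp
  have hlim' : ∀ z v, Tendsto (fun n => (fderiv ℝ (fun z => χ n z * φ z) z v : ℂ)) atTop
      (𝓝 (fderiv ℝ φ z v : ℂ)) := by
    intro z v
    refine (Complex.continuous_ofReal.tendsto _).comp ?_
    simp only [hder]
    have hz : Tendsto (fun n => fderiv ℝ (χ n) z v) atTop (𝓝 0) := by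
      refine squeeze_zero_norm (fun n => hM n z v) ?_
      have := (tendsto_one_div_add_atTop_nhds_zero_nat (𝕜 := ℝ)).const_mul (M * ‖v‖)
      rw [mul_zero] at this
      refine this.congr fun n => by ring
    simpa using ((hlim z).mul_const _).add (hz.const_mul (φ z))
  have hbd : ∀ n z v, ‖(fderiv ℝ (fun z => χ n z * φ z) z v : ℂ)‖ ≤
      ‖(fderiv ℝ φ z v : ℂ)‖ + M * ‖v‖ * ‖(φ z : ℂ)‖ := by
    intro n z v
    rw [hder, Complex.norm_real, Complex.norm_real, Complex.norm_real]
    refine (norm_add_le _ _).trans ?_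
    rw [norm_mul, norm_mul, mul_comm ‖φ z‖]
    gcongr
    · exact mul_le_of_le_one_left (norm_nonneg _) (hχ1 n z)
    · refine (hM n z v).trans ?_
      gcongr
      apply div_le_self hM0
      simp
  have key : ∀ (c : ℂ), ‖c‖ = 1 → ∀ g : ℂ → ℂ, MemLp g 2 → Tendsto (fun n =>
      ∫ z, (fderiv ℝ (fun z => χ n z * φ z) z 1 +
        c * fderiv ℝ (fun z => χ n z * φ z) z Complex.I) * g z) atTop
      (𝓝 (∫ z, (fderiv ℝ φ z 1 + c * fderiv ℝ φ z Complex.I) * g z)) := by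
    intro c hc1 g hg
    have hdom : MemLp (fun z => ‖(fderiv ℝ φ z 1 : ℂ)‖ + M * ‖(1 : ℂ)‖ * ‖(φ z : ℂ)‖ +
        (‖(fderiv ℝ φ z Complex.I : ℂ)‖ + M * ‖Complex.I‖ * ‖(φ z : ℂ)‖)) 2 :=
      ((h1 1).norm.add (h0.norm.const_mul _)).add ((h1 Complex.I).norm.add (h0.norm.const_mul _))
    refine tendsto_integral_of_dominated_convergence _ (fun n => ?_)
      (MemLp.integrable_mul hdom hg.norm) (fun n => ae_of_all _ fun z => ?_)
      (ae_of_all _ fun z => ?_)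
    · refine AEStronglyMeasurable.mul (Continuous.aestronglyMeasurable ?_) hg.1
      have : Continuous (fderiv ℝ (fun z => χ n z * φ z)) :=
        ((hχ n).mul hφ).continuous_fderiv (by simp)
      fun_prop
    · rw [norm_mul]
      simp only [Pi.mul_apply]
      gcongr
      refine (norm_add_le _ _).trans ?_
      rw [norm_mul, hc1, one_mul]
      exact add_le_add (hbd n z 1) (hbd n z Complex.I)
    · exact ((hlim' z 1).add ((hlim' z Complex.I).const_mul c)).mul_const _
  have t1 := key (-Complex.I) (by simp) b hb
  have t2 := key Complex.I (by simp) a ha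
  simp only [neg_mul, ← sub_eq_add_neg] at t1
  refine tendsto_nhds_unique t1 (t2.congr fun n => ?_)
  exact (h _ ((hχ n).mul hφ) (hc n).mul_right).symm

section

open SchwartzMap FourierTransform LineDeriv

/-- Real test functions give the real and imaginary parts of `ψ` separately. The conjugates are
there to make both sides `L²` inner products, ready for Plancherel. -/
lemma CurlFree.integral_schwartz {a b : ℂ → ℂ} (h : CurlFree a b) (ha : MemLp a 2)
    (hb : MemLp b 2) (ψ : 𝓢(ℂ, ℂ)) :
    ∫ z, (starRingEnd ℂ) (fderiv ℝ ψ z 1 + Complex.I * fderiv ℝ ψ z Complex.I) * b z =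
    ∫ z, (starRingEnd ℂ) (fderiv ℝ ψ z 1 - Complex.I * fderiv ℝ ψ z Complex.I) * a z := by
  have hψ : ∀ z, DifferentiableAt ℝ ψ z := fun z => ψ.differentiable z
  have hre : ContDiff ℝ ∞ (fun z => (ψ z).re) := Complex.reCLM.contDiff.comp (ψ.smooth ⊤)
  have him : ContDiff ℝ ∞ (fun z => (ψ z).im) := Complex.imCLM.contDiff.comp (ψ.smooth ⊤)
  have dre : ∀ z v, fderiv ℝ (fun z => (ψ z).re) z v = (fderiv ℝ ψ z v).re := fun z v => by
    change fderiv ℝ (Complex.reCLM ∘ ψ) z v = _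
    rw [(Complex.reCLM.hasFDerivAt.comp z (hψ z).hasFDerivAt).fderiv]; rfl
  have dim : ∀ z v, fderiv ℝ (fun z => (ψ z).im) z v = (fderiv ℝ ψ z v).im := fun z v => by
    change fderiv ℝ (Complex.imCLM ∘ ψ) z v = _
    rw [(Complex.imCLM.hasFDerivAt.comp z (hψ z).hasFDerivAt).fderiv]; rfl
  have m0 : MemLp ψ 2 := ψ.memLp 2
  have m1 : ∀ v, MemLp (fun z => fderiv ℝ ψ z v) 2 := fun v => by
    have : (fun z => fderiv ℝ ψ z v) = ⇑(∂_{v} ψ : 𝓢(ℂ, ℂ)) := by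
      ext z; exact (lineDerivOp_apply_eq_fderiv v ψ z).symm
    rw [this]
    exact SchwartzMap.memLp (∂_{v} ψ : 𝓢(ℂ, ℂ)) 2
  have hconj : ∀ x : ℂ, (starRingEnd ℂ) x = x.re - Complex.I * x.im := fun x => by
    apply Complex.ext <;> simp
  have mre : ∀ {f : ℂ → ℂ}, MemLp f 2 → MemLp (fun z => ((f z).re : ℂ)) 2 := fun hf =>
    hf.of_le (Complex.continuous_ofReal.comp_aestronglyMeasurable
      (Complex.continuous_re.comp_aestronglyMeasurable hf.1))
      (ae_of_all _ fun z => by simpa using Complex.abs_re_le_norm _)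
  have mim : ∀ {f : ℂ → ℂ}, MemLp f 2 → MemLp (fun z => ((f z).im : ℂ)) 2 := fun hf =>
    hf.of_le (Complex.continuous_ofReal.comp_aestronglyMeasurable
      (Complex.continuous_im.comp_aestronglyMeasurable hf.1))
      (ae_of_all _ fun z => by simpa using Complex.abs_im_le_norm _)
  have P := h.of_memLp ha hb hre (mre m0) (fun v => by simpa only [dre] using mre (m1 v))
  have Q := h.of_memLp ha hb him (mim m0) (fun v => by simpa only [dim] using mim (m1 v))
  simp only [dre] at P
  simp only [dim] at Q
  have I1 := integrable_mul_of_memLp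
    ((mre (m1 1)).sub ((mre (m1 Complex.I)).const_mul Complex.I)) hb
  have I2 := integrable_mul_of_memLp
    ((mim (m1 1)).sub ((mim (m1 Complex.I)).const_mul Complex.I)) hb
  have I3 := integrable_mul_of_memLp
    ((mre (m1 1)).add ((mre (m1 Complex.I)).const_mul Complex.I)) ha
  have I4 := integrable_mul_of_memLp
    ((mim (m1 1)).add ((mim (m1 Complex.I)).const_mul Complex.I)) ha
  simp only [Pi.sub_apply, Pi.add_apply] at I1 I2 I3 I4
  calc _ = ∫ z, ((((fderiv ℝ ψ z 1).re : ℂ) - Complex.I * (fderiv ℝ ψ z Complex.I).re) * b z -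
        Complex.I * ((((fderiv ℝ ψ z 1).im : ℂ) -
          Complex.I * (fderiv ℝ ψ z Complex.I).im) * b z)) := by
        congr 1; ext z
        simp only [map_add, map_mul, Complex.conj_I, hconj (fderiv ℝ ψ z _)]
        ring
    _ = ∫ z, ((((fderiv ℝ ψ z 1).re : ℂ) + Complex.I * (fderiv ℝ ψ z Complex.I).re) * a z -
        Complex.I * ((((fderiv ℝ ψ z 1).im : ℂ) +
          Complex.I * (fderiv ℝ ψ z Complex.I).im) * a z)) := by
        rw [integral_sub I1 (I2.const_mul _), integral_sub I3 (I4.const_mul _),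
          integral_const_mul, integral_const_mul, P, Q]
    _ = _ := by
        congr 1; ext z
        simp only [map_sub, map_mul, Complex.conj_I, hconj (fderiv ℝ ψ z _)]
        ring

lemma inner_toLp_eq (g : 𝓢(ℂ, ℂ)) (f : Lp ℂ 2 (volume : Measure ℂ)) :
    inner ℂ (g.toLp 2) f = ∫ z, (starRingEnd ℂ) (g z) * f z := by
  rw [L2.inner_def]
  apply integral_congr_ae
  filter_upwards [g.coeFn_toLp 2] with z hz
  rw [hz, RCLike.inner_apply, mul_comm]

/-- A weak solution of `∂̄ a = ∂ b` in `L²` satisfies `a = S b`. -/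
theorem CurlFree.beurlingL2_eq {a b : Lp ℂ 2 (volume : Measure ℂ)} (h : CurlFree a b) :
    beurlingL2 b = a := by
  set A := Lp.fourierTransformₗᵢ ℂ ℂ a with hA
  set B := Lp.fourierTransformₗᵢ ℂ ℂ b with hB
  have hzero : ∀ᵐ ξ : ℂ, (starRingEnd ℂ) ξ * B ξ - ξ * A ξ = 0 := by
    have hloc : ∀ (c : ℂ → ℂ) (f : Lp ℂ 2 (volume : Measure ℂ)), Continuous c →
        LocallyIntegrable (fun ξ => c ξ * f ξ) := fun c f hc =>
      ((Lp.memLp f).locallyIntegrable (by norm_num)).continuous_smul hc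
    refine ae_eq_zero_of_integral_contDiff_smul_eq_zero
      ((hloc _ B Complex.continuous_conj).sub (hloc (fun ξ => ξ) A continuous_id')) fun g hg hgc => ?_
    -- The test function is chosen on the Fourier side: `ψ` is the inverse transform of `g`, and its
    -- derivatives have transforms `2πi ⟨ξ, m⟩ g(ξ)`.
    let G : 𝓢(ℂ, ℂ) := HasCompactSupport.toSchwartzMap (f := fun z => (g z : ℂ))
      (hgc.comp_left Complex.ofReal_zero) (Complex.ofRealCLM.contDiff.comp hg)
    have hG : ∀ z, G z = g z := fun z => rfl
    let ψ : 𝓢(ℂ, ℂ) := 𝓕⁻ G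
    have hψ : 𝓕 ψ = G := FourierTransform.fourier_fourierInv_eq G
    have tg : ∀ m : ℂ, (fun ξ : ℂ => inner ℝ ξ m).HasTemperateGrowth := fun m =>
      ((innerSL ℝ).flip m).hasTemperateGrowth
    have hF : ∀ (m ξ : ℂ), 𝓕 (∂_{m} ψ) ξ = 2 * Real.pi * Complex.I * ((inner ℝ ξ m : ℝ) * g ξ) := by
      intro m ξ
      rw [SchwartzMap.fourier_lineDerivOp_eq, hψ]
      rw [_root_.smul_apply, SchwartzMap.smulLeftCLM_apply_apply (tg m), hG]
      simp
    have h1 := h.integral_schwartz (Lp.memLp a) (Lp.memLp b) ψ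
    -- Plancherel for `ψ_x + c ψ_y`. The symbol is `2πi (ξ.re + c ξ.im)`, which is proportional to
    -- `ξ` for `c = i` and to `ξ̄` for `c = -i`.
    have e1 : ∀ (c : ℂ) (f : Lp ℂ 2 (volume : Measure ℂ)),
        ∫ z, (starRingEnd ℂ) (fderiv ℝ ψ z 1 + c * fderiv ℝ ψ z Complex.I) * f z =
        ∫ ξ, (starRingEnd ℂ) (2 * Real.pi * Complex.I * ((ξ.re + c * ξ.im) * g ξ)) *
          Lp.fourierTransformₗᵢ ℂ ℂ f ξ := by
      intro c f
      have s1 := inner_toLp_eq (∂_{(1 : ℂ)} ψ + c • ∂_{Complex.I} ψ) f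
      have s2 := inner_toLp_eq (𝓕 (∂_{(1 : ℂ)} ψ + c • ∂_{Complex.I} ψ)) (Lp.fourierTransformₗᵢ ℂ ℂ f)
      have s3 := Lp.inner_fourier_eq ((∂_{(1 : ℂ)} ψ + c • ∂_{Complex.I} ψ).toLp 2) f
      rw [SchwartzMap.toLp_fourier_eq] at s3
      refine (s1.symm.trans (s3.symm.trans s2)).trans ?_
      congr 1; ext ξ
      congr 2
      rw [FourierTransform.fourier_add, FourierTransform.fourier_smul, _root_.add_apply,
        _root_.smul_apply, hF, hF]
      simp
      ring
    have e2 := e1 Complex.I b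
    have e3 := e1 (-Complex.I) a
    simp only [neg_mul, ← sub_eq_add_neg] at e3
    rw [e2, e3] at h1
    have i1 : ∀ (c : ℂ → ℂ) (f : Lp ℂ 2 (volume : Measure ℂ)), Continuous c →
        Integrable (fun ξ => g ξ • (c ξ * f ξ)) := fun c f hc =>
      (hloc c f hc).integrable_smul_left_of_hasCompactSupport hg.continuous hgc
    simp only [smul_sub]
    rw [integral_sub (i1 _ B Complex.continuous_conj) (i1 (fun ξ => ξ) A continuous_id')]
    have hpi : (starRingEnd ℂ) (2 * Real.pi * Complex.I) ≠ 0 := by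
      simp [Real.pi_ne_zero]
    have k1 : ∀ ξ : ℂ, (starRingEnd ℂ) (2 * Real.pi * Complex.I *
        ((ξ.re + Complex.I * ξ.im) * g ξ)) * B ξ =
        (starRingEnd ℂ) (2 * Real.pi * Complex.I) * (g ξ • ((starRingEnd ℂ) ξ * B ξ)) := by
      intro ξ
      have : (ξ.re + Complex.I * ξ.im : ℂ) = ξ := by rw [mul_comm]; exact Complex.re_add_im ξ
      rw [this]
      simp only [map_mul, Complex.conj_ofReal, Complex.real_smul]
      ring
    have k2 : ∀ ξ : ℂ, (starRingEnd ℂ) (2 * Real.pi * Complex.I *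
        ((ξ.re - Complex.I * ξ.im) * g ξ)) * A ξ =
        (starRingEnd ℂ) (2 * Real.pi * Complex.I) * (g ξ • (ξ * A ξ)) := by
      intro ξ
      have : (ξ.re - Complex.I * ξ.im : ℂ) = (starRingEnd ℂ) ξ := by
        apply Complex.ext <;> simp
      rw [this]
      simp only [map_mul, Complex.conj_ofReal, Complex.real_smul, Complex.conj_conj]
      ring
    simp only [← hA, ← hB, k1, k2, integral_const_mul] at h1
    exact sub_eq_zero.2 (mul_left_cancel₀ hpi h1)
  rw [beurlingL2_apply, LinearIsometryEquiv.symm_apply_eq]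
  apply Lp.ext
  have h2 : symbolOp B =ᵐ[volume] symbolMul B := lpOp_coeFn _ _ _ _ _ B
  filter_upwards [h2, hzero, Measure.ae_ne volume (0 : ℂ)] with ξ hξ hz h0
  rw [← hB, hξ]
  change (starRingEnd ℂ) ξ / ξ * B ξ = A ξ
  rw [div_mul_eq_mul_div, div_eq_iff h0]
  linear_combination hz

end

lemma CurlFree.congr {a b a' b' : ℂ → ℂ} (h : CurlFree a b) (ha : a =ᵐ[volume] a')
    (hb : b =ᵐ[volume] b') : CurlFree a' b' := by
  intro φ hφ hc
  refine (integral_congr_ae ?_).trans ((h φ hφ hc).trans (integral_congr_ae ?_))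
  · filter_upwards [hb] with z hz; rw [hz]
  · filter_upwards [ha] with z hz; rw [hz]

theorem CurlFree.beurlingL2_toLp {a b : ℂ → ℂ} (h : CurlFree a b) (ha : MemLp a 2)
    (hb : MemLp b 2) : beurlingL2 hb.toLp = ha.toLp :=
  (h.congr ha.coeFn_toLp.symm hb.coeFn_toLp.symm).beurlingL2_eq

/-! ### Density of the functions `∂̄φ` -/

section testFunctions

variable {φ : ℂ → ℝ} (hφ : ContDiff ℝ ∞ φ) (hc : HasCompactSupport φ)

include hφ

lemma fderiv_ofReal_comp (z v : ℂ) :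
    fderiv ℝ (fun z => (φ z : ℂ)) z v = fderiv ℝ φ z v := by
  change fderiv ℝ (Complex.ofRealCLM ∘ φ) z v = _
  rw [(Complex.ofRealCLM.hasFDerivAt.comp z (hφ.differentiable (by simp) z).hasFDerivAt).fderiv]
  rfl

lemma continuous_fderiv_ofReal_comp (v : ℂ) :
    Continuous (fun z => fderiv ℝ (fun z => (φ z : ℂ)) z v) :=
  ((Complex.ofRealCLM.contDiff.comp hφ).continuous_fderiv (by simp)).clm_apply continuous_const

lemma continuous_dz_ofReal : Continuous (dz fun z => (φ z : ℂ)) :=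
  ((continuous_fderiv_ofReal_comp hφ 1).sub
    (continuous_const.mul (continuous_fderiv_ofReal_comp hφ Complex.I))).div_const 2

lemma continuous_dzbar_ofReal : Continuous (dzbar fun z => (φ z : ℂ)) :=
  ((continuous_fderiv_ofReal_comp hφ 1).add
    (continuous_const.mul (continuous_fderiv_ofReal_comp hφ Complex.I))).div_const 2

include hc

lemma memLp_dz_ofReal : MemLp (dz fun z => (φ z : ℂ)) 2 := by
  refine (continuous_dz_ofReal hφ).memLp_of_hasCompactSupport ?_
  exact ((hc.comp_left (g := fun x : ℝ => (x : ℂ)) (by simp)).fderiv ℝ).comp_left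
    (g := fun L : ℂ →L[ℝ] ℂ => (L 1 - Complex.I * L Complex.I) / 2) (by simp)

lemma memLp_dzbar_ofReal : MemLp (dzbar fun z => (φ z : ℂ)) 2 := by
  refine (continuous_dzbar_ofReal hφ).memLp_of_hasCompactSupport ?_
  exact ((hc.comp_left (g := fun x : ℝ => (x : ℂ)) (by simp)).fderiv ℝ).comp_left
    (g := fun L : ℂ →L[ℝ] ℂ => (L 1 + Complex.I * L Complex.I) / 2) (by simp)

lemma beurlingL2_dzbar_ofReal :
    beurlingL2 (memLp_dzbar_ofReal hφ hc).toLp = (memLp_dz_ofReal hφ hc).toLp := by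
  refine (CurlFree.beurlingL2_toLp (HasWeakWirtinger.curlFree (f := fun z => (φ z : ℂ))
    (hasWeakWirtinger_of_differentiableAt MeetsLinesCountably.empty
      (Complex.continuous_ofReal.comp hφ.continuous)
      (fun z _ => (Complex.ofRealCLM.contDiff.comp hφ).differentiable (by simp) z)
      (fun s _ => (memLp_dz_ofReal hφ hc).restrict s)
      (fun s _ => (memLp_dzbar_ofReal hφ hc).restrict s))) _ _)

end testFunctions

/-- If `g` is orthogonal to every `∂̄φ` with `φ` real, then `(0, g)` is a curl-free pair, so `S g =
0`, and `g = 0` because `S` is an isometry. -/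
lemma span_dzbar_dense : (Submodule.span ℂ {f : Lp ℂ 2 (volume : Measure ℂ) |
    ∃ (φ : ℂ → ℝ) (hφ : ContDiff ℝ ∞ φ) (hc : HasCompactSupport φ),
      f = (memLp_dzbar_ofReal hφ hc).toLp}).topologicalClosure = ⊤ := by
  rw [Submodule.topologicalClosure_eq_top_iff, Submodule.eq_bot_iff]
  intro g hg
  rw [Submodule.mem_orthogonal] at hg
  have hcf : CurlFree (0 : Lp ℂ 2 (volume : Measure ℂ)) g := by
    intro φ hφ hc
    have h0 : ∫ z, (fderiv ℝ φ z 1 + Complex.I * fderiv ℝ φ z Complex.I) *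
        (0 : Lp ℂ 2 (volume : Measure ℂ)) z = 0 := by
      apply integral_eq_zero_of_ae
      filter_upwards with z
      simp
    rw [h0]
    have := hg _ (Submodule.subset_span ⟨φ, hφ, hc, rfl⟩)
    rw [L2.inner_def] at this
    have h2 : ∫ z, (2 : ℂ)⁻¹ * ((fderiv ℝ φ z 1 - Complex.I * fderiv ℝ φ z Complex.I) * g z) = 0 := by
      rw [← this]
      apply integral_congr_ae
      filter_upwards [(memLp_dzbar_ofReal hφ hc).coeFn_toLp] with z hz
      rw [hz, RCLike.inner_apply, dzbar, fderiv_ofReal_comp hφ, fderiv_ofReal_comp hφ]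
      simp only [map_div₀, map_add, map_mul, Complex.conj_ofReal, Complex.conj_I, map_ofNat]
      ring
    rw [integral_const_mul] at h2
    simpa using h2
  have := hcf.beurlingL2_eq
  rw [← norm_eq_zero, ← beurlingL2.norm_map g, this, norm_zero]

/-! ### Almost everywhere existence of the principal value -/

lemma hasFDerivAt_of_hasDerivAt {g : ℂ → ℂ} {g' z : ℂ} (h : HasDerivAt g g' z) :
    HasFDerivAt g (wirtingerCLM g' 0) z := by
  refine (h.hasFDerivAt.restrictScalars ℝ).congr_fderiv ?_
  ext v; simp [mul_comm]

lemma hasFDerivAt_comp_conj {g : ℂ → ℂ} {g' z : ℂ} (h : HasDerivAt g g' ((starRingEnd ℂ) z)) :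
    HasFDerivAt (fun z => g ((starRingEnd ℂ) z)) (wirtingerCLM 0 g') z := by
  have h1 : HasFDerivAt (fun z : ℂ => (starRingEnd ℂ) z) (wirtingerCLM 0 1) z := by
    refine (Complex.conjCLE.toContinuousLinearMap.hasFDerivAt (x := z)).congr_fderiv ?_
    ext v; simp
  refine ((hasFDerivAt_of_hasDerivAt h).comp z h1).congr_fderiv ?_
  rw [wirtingerCLM_comp]
  simp

/-- The function equal to `w - z` for `|w - z| ≤ ε` and to `ε² / conj (w - z)` outside. -/
def discFun (z : ℂ) (ε : ℝ) (w : ℂ) : ℂ := (w - z) * ((ε ^ 2 / max ε ‖w - z‖ ^ 2 : ℝ) : ℂ)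

section discFun

variable (z : ℂ) {ε : ℝ} (hε : 0 < ε)

include hε

lemma continuous_discFun : Continuous (discFun z ε) := by
  have h : ∀ w : ℂ, max ε ‖w - z‖ ^ 2 ≠ 0 := fun w =>
    pow_ne_zero 2 (lt_of_lt_of_le hε (le_max_left _ _)).ne'
  unfold discFun
  fun_prop (disch := exact h _)

lemma hasFDerivAt_discFun_inside {w : ℂ} (hw : ‖w - z‖ < ε) :
    HasFDerivAt (discFun z ε) (wirtingerCLM 1 0) w := by
  refine (hasFDerivAt_of_hasDerivAt ((hasDerivAt_id w).sub_const z)).congr_of_eventuallyEq ?_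
  have : ∀ᶠ v in 𝓝 w, ‖v - z‖ < ε :=
    (isOpen_lt (by fun_prop) continuous_const).mem_nhds hw
  filter_upwards [this] with v hv
  rw [discFun, max_eq_left hv.le, div_self (pow_ne_zero 2 hε.ne')]
  simp

lemma hasFDerivAt_discFun_outside {w : ℂ} (hw : ε < ‖w - z‖) :
    HasFDerivAt (discFun z ε) (wirtingerCLM 0 (-ε ^ 2 / (starRingEnd ℂ) (w - z) ^ 2)) w := by
  have hne : (starRingEnd ℂ) w - (starRingEnd ℂ) z ≠ 0 := by
    rw [← map_sub, Ne, map_eq_zero]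
    exact norm_pos_iff.1 (hε.trans hw)
  have h1 : HasDerivAt (fun v : ℂ => (ε : ℂ) ^ 2 / (v - (starRingEnd ℂ) z))
      (-ε ^ 2 / (starRingEnd ℂ) (w - z) ^ 2) ((starRingEnd ℂ) w) := by
    refine ((hasDerivAt_const _ ((ε : ℂ) ^ 2)).div
      ((hasDerivAt_id _).sub_const ((starRingEnd ℂ) z)) hne).congr_deriv ?_
    simp [map_sub]
  refine (hasFDerivAt_comp_conj h1).congr_of_eventuallyEq ?_
  have : ∀ᶠ v in 𝓝 w, ε < ‖v - z‖ :=
    (isOpen_lt continuous_const (by fun_prop)).mem_nhds hw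
  filter_upwards [this] with v hv
  have hv0 : v - z ≠ 0 := norm_pos_iff.1 (hε.trans hv)
  have hv1 : (starRingEnd ℂ) (v - z) ≠ 0 := by rwa [Ne, map_eq_zero]
  rw [discFun, max_eq_right hv.le, ← Complex.normSq_eq_norm_sq, ← map_sub]
  push_cast
  rw [← Complex.mul_conj]
  field_simp

omit hε in
lemma meetsLinesCountably_sphere : MeetsLinesCountably {w : ℂ | ‖w - z‖ = ε} := by
  have key : ∀ a b c : ℝ, {x : ℝ | (x - a) ^ 2 + b = c}.Countable := by
    intro a b c
    refine Set.Countable.mono (s₂ := {a + √(c - b), a - √(c - b)}) ?_ (Set.toFinite _).countable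
    intro x hx
    have hx' : (x - a) ^ 2 = c - b := by
      have : (x - a) ^ 2 + b = c := hx
      linarith
    have : |x - a| = √(c - b) := by rw [← hx', Real.sqrt_sq_eq_abs]
    rcases abs_eq (Real.sqrt_nonneg _) |>.1 this with h | h
    · left; linarith
    · right; rw [Set.mem_singleton_iff]; linarith
  have hsq : ∀ x y : ℝ, ‖(x : ℂ) + y * Complex.I - z‖ = ε →
      (x - z.re) ^ 2 + (y - z.im) ^ 2 = ε ^ 2 := by
    intro x y h
    rw [← h, ← Complex.normSq_eq_norm_sq, Complex.normSq_apply]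
    simp
    ring
  constructor
  · refine ae_of_all _ fun y => (key z.re ((y - z.im) ^ 2) (ε ^ 2)).mono fun x hx => hsq x y hx
  · refine ae_of_all _ fun x => (key z.im ((x - z.re) ^ 2) (ε ^ 2)).mono fun y hy => ?_
    have := hsq x y hy
    change (y - z.im) ^ 2 + (x - z.re) ^ 2 = ε ^ 2
    linarith

lemma ae_norm_sub_ne : ∀ᵐ w : ℂ, ‖w - z‖ ≠ ε := by
  have : volume (Metric.sphere z ε) = 0 := Measure.addHaar_sphere_of_ne_zero _ _ hε.ne'
  filter_upwards [measure_eq_zero_iff_ae_notMem.1 this] with w hw h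
  exact hw (by simpa [dist_eq_norm] using h)

lemma dz_discFun_ae : dz (discFun z ε) =ᵐ[volume]
    (Metric.closedBall z ε).indicator fun _ => 1 := by
  filter_upwards [ae_norm_sub_ne z hε] with w hw
  rcases lt_or_gt_of_ne hw with h | h
  · rw [(hasFDerivAt_discFun_inside z hε h).dz_eq, Set.indicator_of_mem]
    simpa [dist_eq_norm] using h.le
  · rw [(hasFDerivAt_discFun_outside z hε h).dz_eq, Set.indicator_of_notMem]
    simpa [dist_eq_norm] using h

lemma dzbar_discFun_ae : dzbar (discFun z ε) =ᵐ[volume]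
    {w : ℂ | ε < ‖w - z‖}.indicator fun w => -ε ^ 2 / (starRingEnd ℂ) (w - z) ^ 2 := by
  filter_upwards [ae_norm_sub_ne z hε] with w hw
  rcases lt_or_gt_of_ne hw with h | h
  · rw [(hasFDerivAt_discFun_inside z hε h).dzbar_eq, Set.indicator_of_notMem]
    simpa using h.le
  · rw [(hasFDerivAt_discFun_outside z hε h).dzbar_eq, Set.indicator_of_mem]
    simpa using h

lemma memLp_dz_discFun : MemLp (dz (discFun z ε)) 2 := by
  rw [memLp_congr_ae (dz_discFun_ae z hε)]
  exact memLp_indicator_const 2 Metric.isClosed_closedBall.measurableSet 1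
    (Or.inr (measure_closedBall_lt_top).ne)

/-- The square has size `|w - z|^(-4)`, integrable at infinity in the plane. -/
lemma memLp_indicator_inv_sq : MemLp
    ({w : ℂ | ε < ‖w - z‖}.indicator fun w => ((w - z) ^ 2)⁻¹) 2 := by
  have hms : MeasurableSet {w : ℂ | ε < ‖w - z‖} :=
    measurableSet_lt measurable_const (by fun_prop)
  have hm : AEStronglyMeasurable
      ({w : ℂ | ε < ‖w - z‖}.indicator fun w => ((w - z) ^ 2)⁻¹) volume :=
    (Measurable.indicator (by fun_prop) hms).aestronglyMeasurable
  rw [memLp_two_iff_integrable_sq_norm hm]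
  have h1 : Integrable (fun w : ℂ => (1 + ‖w - z‖) ^ (-4 : ℝ)) :=
    (integrable_one_add_norm (E := ℂ) (by simp; norm_num)).comp_sub_right z
  refine (h1.const_mul ((1 / ε + 1) ^ 4)).mono' (hm.norm.pow 2) (ae_of_all _ fun w => ?_)
  rw [Real.norm_of_nonneg (by positivity)]
  by_cases hw : ε < ‖w - z‖
  · rw [Set.indicator_of_mem (by exact hw), norm_inv, norm_pow, inv_pow, ← pow_mul,
      Real.rpow_neg (by positivity), ← div_eq_mul_inv, show (4 : ℝ) = (4 : ℕ) by norm_num,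
      Real.rpow_natCast, ← div_pow, ← inv_pow]
    have hp : 0 < ‖w - z‖ := hε.trans hw
    gcongr
    rw [inv_eq_one_div, div_le_div_iff₀ hp (by positivity)]
    have : 1 ≤ 1 / ε * ‖w - z‖ := by
      rw [one_div, ← div_eq_inv_mul, one_le_div hε]; exact hw.le
    linarith
  · rw [Set.indicator_of_notMem (by exact hw)]
    simp
    positivity

lemma memLp_dzbar_discFun : MemLp (dzbar (discFun z ε)) 2 := by
  rw [memLp_congr_ae (dzbar_discFun_ae z hε)]
  refine ((memLp_indicator_inv_sq z hε).const_mul ((ε : ℂ) ^ 2)).of_le ?_ (ae_of_all _ fun w => ?_)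
  · refine (Measurable.indicator ?_
      (measurableSet_lt measurable_const (by fun_prop))).aestronglyMeasurable
    have : Measurable fun w : ℂ => (starRingEnd ℂ) (w - z) :=
      (Complex.continuous_conj.comp (continuous_id.sub continuous_const)).measurable
    fun_prop
  · by_cases hw : ε < ‖w - z‖
    · rw [Set.indicator_of_mem (by exact hw), Set.indicator_of_mem (by exact hw)]
      simp only [norm_div, norm_neg, norm_pow, norm_mul, norm_inv, RCLike.norm_conj]
      rw [div_eq_mul_inv]
    · rw [Set.indicator_of_notMem (by exact hw), Set.indicator_of_notMem (by exact hw)]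
      simp

lemma beurlingL2_dzbar_discFun :
    beurlingL2 (memLp_dzbar_discFun z hε).toLp = (memLp_dz_discFun z hε).toLp := by
  refine CurlFree.beurlingL2_toLp (HasWeakWirtinger.curlFree (f := discFun z ε)
    (hasWeakWirtinger_of_differentiableAt (meetsLinesCountably_sphere z (ε := ε))
      (continuous_discFun z hε) (fun w hw => ?_)
      (fun s _ => (memLp_dz_discFun z hε).restrict s)
      (fun s _ => (memLp_dzbar_discFun z hε).restrict s))) _ _
  rcases lt_or_gt_of_ne (show ‖w - z‖ ≠ ε from hw) with h | h
  · exact (hasFDerivAt_discFun_inside z hε h).differentiableAt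
  · exact (hasFDerivAt_discFun_outside z hε h).differentiableAt

/-- The truncations of the Beurling transform are the averages of the `L²` transform. -/
lemma average_beurlingL2 (f : Lp ℂ 2 (volume : Measure ℂ)) :
    ⨍ w in Metric.closedBall z ε, beurlingL2 f w = beurlingTrunc f ε z := by
  -- With `u = discFun z ε`, the isometry gives `⟨∂u, S f⟩ = ⟨∂̄u, f⟩`. The left side is the
  -- integral of `S f` over the disc, the right side is `-ε²` times the truncated integral; the area
  -- `π ε²` then produces the factor `-1/π`.
  have h1 := beurlingL2.inner_map_map (memLp_dzbar_discFun z hε).toLp f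
  rw [beurlingL2_dzbar_discFun z hε, L2.inner_def, L2.inner_def] at h1
  have e1 : ∫ w, inner ℂ ((memLp_dz_discFun z hε).toLp _ w) (beurlingL2 f w) =
      ∫ w in Metric.closedBall z ε, beurlingL2 f w := by
    rw [← integral_indicator Metric.isClosed_closedBall.measurableSet]
    apply integral_congr_ae
    filter_upwards [(memLp_dz_discFun z hε).coeFn_toLp, dz_discFun_ae z hε] with w h2 h3
    rw [h2, h3, RCLike.inner_apply]
    by_cases hw : w ∈ Metric.closedBall z ε <;> simp [hw]
  have e2 : ∫ w, inner ℂ ((memLp_dzbar_discFun z hε).toLp _ w) (f w) =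
      -ε ^ 2 * ∫ w in {w : ℂ | ε < ‖w - z‖}, f w / (w - z) ^ 2 := by
    rw [← integral_const_mul, ← integral_indicator
      (measurableSet_lt measurable_const (by fun_prop))]
    apply integral_congr_ae
    filter_upwards [(memLp_dzbar_discFun z hε).coeFn_toLp, dzbar_discFun_ae z hε] with w h2 h3
    rw [h2, h3, RCLike.inner_apply]
    by_cases hw : ε < ‖w - z‖
    · rw [Set.indicator_of_mem (by exact hw), Set.indicator_of_mem (by exact hw)]
      simp only [map_div₀, map_neg, map_pow, Complex.conj_ofReal, Complex.conj_conj]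
      ring
    · rw [Set.indicator_of_notMem (by exact hw), Set.indicator_of_notMem (by exact hw)]
      simp
  rw [e1, e2] at h1
  rw [setAverage_eq, h1, beurlingTrunc, measureReal_def, Complex.volume_closedBall]
  have hε' : (ε : ℂ) ≠ 0 := by exact_mod_cast hε.ne'
  have hpi : (Real.pi : ℂ) ≠ 0 := by exact_mod_cast Real.pi_ne_zero
  simp only [ENNReal.toReal_mul, ENNReal.toReal_pow, ENNReal.toReal_ofReal hε.le,
    ENNReal.coe_toReal, NNReal.coe_real_pi, Complex.real_smul, Complex.ofReal_inv,
    Complex.ofReal_mul, Complex.ofReal_pow]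
  field_simp

end discFun

/-- The truncations are averages of `S f` over discs centred at `z`, so this is the Lebesgue
differentiation theorem. -/
lemma tendsto_beurlingTrunc (f : Lp ℂ 2 (volume : Measure ℂ)) :
    ∀ᵐ z, Tendsto (fun ε => beurlingTrunc f ε z) (𝓝[>] 0) (𝓝 (beurlingL2 f z)) := by
  have hloc : LocallyIntegrable (beurlingL2 f) := (Lp.memLp _).locallyIntegrable (by norm_num)
  filter_upwards [IsUnifLocDoublingMeasure.ae_tendsto_average volume hloc 1] with z hz
  have h := hz (l := 𝓝[>] (0 : ℝ)) (fun _ => z) id tendsto_id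
    (by filter_upwards [self_mem_nhdsWithin] with ε hε
        exact Metric.mem_closedBall_self (by simpa using (le_of_lt hε)))
  refine h.congr' ?_
  filter_upwards [self_mem_nhdsWithin] with ε hε using average_beurlingL2 z hε f

lemma beurlingTrunc_congr {f g : ℂ → ℂ} (h : f =ᵐ[volume] g) (ε : ℝ) (z : ℂ) :
    beurlingTrunc f ε z = beurlingTrunc g ε z := by
  rw [beurlingTrunc, beurlingTrunc]
  congr 1
  apply integral_congr_ae
  filter_upwards [ae_restrict_of_ae h] with w hw
  rw [hw]

/-- For functions in `L²` the principal value exists almost everywhere. -/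
lemma isBeurlingTransform_beurlingL2 {f : ℂ → ℂ} (hf : MemLp f 2) :
    IsBeurlingTransform f (beurlingL2 hf.toLp) := by
  filter_upwards [tendsto_beurlingTrunc hf.toLp] with z hz
  simpa only [beurlingTrunc_congr hf.coeFn_toLp] using hz

lemma IsBeurlingTransform.ae_eq {f g : ℂ → ℂ} (h : IsBeurlingTransform f g) (hf : MemLp f 2) :
    g =ᵐ[volume] beurlingL2 hf.toLp := by
  filter_upwards [h, isBeurlingTransform_beurlingL2 hf] with z h1 h2
  exact tendsto_nhds_unique h1 h2

/-! ### The Beurling transform on `L²(|z|^{-a} dm)` -/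

/-- Mean value inequality on `[1/2, 2]`, where the derivative of `x^t` is at most `(1/2)^(-2) = 4`.
-/
lemma abs_rpow_sub_one_le {x t : ℝ} (hx : 1 / 2 ≤ x) (hx' : x ≤ 2) (ht : |t| < 1) :
    |x ^ t - 1| ≤ 4 * |x - 1| := by
  have h := (convex_Icc (1 / 2 : ℝ) 2).norm_image_sub_le_of_norm_hasDerivWithin_le
    (f := fun x => x ^ t) (f' := fun x => t * x ^ (t - 1)) (C := 4) (x := 1) (y := x)
    (fun y hy => (Real.hasDerivAt_rpow_const (Or.inl (by linarith [hy.1]))).hasDerivWithinAt)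
    (fun y hy => ?_) (by norm_num) ⟨hx, hx'⟩
  · simpa using h
  · have hy0 : 0 < y := by linarith [hy.1]
    obtain ⟨h1, h2⟩ := abs_lt.1 ht
    rw [norm_mul, Real.norm_eq_abs, Real.norm_of_nonneg (Real.rpow_nonneg hy0.le _)]
    have h3 : y ^ (t - 1) ≤ (1 / 2 : ℝ) ^ (t - 1) :=
      Real.rpow_le_rpow_of_nonpos (by norm_num) hy.1 (by linarith)
    have h4 : (1 / 2 : ℝ) ^ (t - 1) ≤ (1 / 2 : ℝ) ^ (-2 : ℝ) :=
      Real.rpow_le_rpow_of_exponent_ge (by norm_num) (by norm_num) (by linarith)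
    have h5 : (1 / 2 : ℝ) ^ (-2 : ℝ) = 4 := by
      rw [Real.rpow_neg (by norm_num), show (2 : ℝ) = (2 : ℕ) by norm_num, Real.rpow_natCast]
      norm_num
    calc |t| * y ^ (t - 1) ≤ 1 * 4 :=
          mul_le_mul ht.le (h3.trans (h4.trans h5.le)) (Real.rpow_nonneg hy0.le _) zero_le_one
      _ = 4 := one_mul _

lemma abs_rpow_sub_one_le_of_le_one {x t : ℝ} (h0 : 0 < x) (h1 : x ≤ 1) :
    |x ^ t - 1| ≤ x ^ (-|t|) := by
  rcases le_total 0 t with h | h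
  · have e1 : x ^ t ≤ 1 := Real.rpow_le_one h0.le h1 h
    have e2 : 1 ≤ x ^ (-|t|) := Real.one_le_rpow_of_pos_of_le_one_of_nonpos h0 h1 (by simp)
    have e3 := Real.rpow_nonneg h0.le t
    rw [abs_le]
    constructor <;> linarith
  · have e1 : 1 ≤ x ^ t := Real.one_le_rpow_of_pos_of_le_one_of_nonpos h0 h1 h
    rw [abs_of_nonpos h, neg_neg, abs_of_nonneg (by linarith)]
    linarith

lemma abs_rpow_sub_one_le_of_one_le {x t : ℝ} (h1 : 1 ≤ x) : |x ^ t - 1| ≤ x ^ |t| := by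
  have := abs_rpow_sub_one_le_of_le_one (x := x⁻¹) (t := -t) (by positivity) (inv_le_one_of_one_le₀ h1)
  rwa [Real.inv_rpow (by positivity), Real.inv_rpow (by positivity), ← Real.rpow_neg (by positivity),
    ← Real.rpow_neg (by positivity), abs_neg, neg_neg, neg_neg] at this

lemma integrableOn_ball_norm_rpow {q : ℝ} (hq : -2 < q) {r : ℝ} (hr : 0 < r) (c : ℂ) :
    Integrable ((Metric.ball c r).indicator fun w : ℂ => ‖w - c‖ ^ q) := by
  have h : IntegrableOn (fun w : ℂ => ‖w‖ ^ q) (Metric.ball (0 : ℂ) r) := by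
    rw [integrableOn_fun_norm_addHaar (volume : Measure ℂ) (f := fun y => y ^ q)]
    have : IntegrableOn (fun y : ℝ => y ^ (q + 1)) (Set.Ioo 0 r) :=
      (intervalIntegral.integrableOn_Ioo_rpow_iff hr).2 (by linarith)
    refine this.congr_fun (fun y hy => ?_) measurableSet_Ioo
    simp [Complex.finrank_real_complex, Real.rpow_add hy.1, mul_comm]
  rw [← integrable_indicator_iff measurableSet_ball] at h
  refine (h.comp_sub_right c).congr (ae_of_all _ fun w => ?_)
  simp [Set.indicator, dist_eq_norm]

/-! ### Schur's test for the commutator of `S` with a power of `|z|` -/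

/-- The integrand of the Schur test at the point `1`. -/
def schurKernel (t : ℝ) (w : ℂ) : ℝ := |‖w‖ ^ t - 1| / (‖w - 1‖ ^ 2 * ‖w‖)

/-- The three terms control `|w| < 1/2`, `|w| > 2` and the annulus between. Near `w = 1` the
numerator vanishes to first order, which leaves the integrable singularity `1/|w - 1|`. The exponent
`-|t| - 1` at the origin and the decay `|t| - 3` at infinity are both integrable in the plane
exactly when `|t| < 1`. -/
lemma schurKernel_le {t : ℝ} (ht : |t| < 1) {w : ℂ} (h0 : w ≠ 0) : schurKernel t w ≤
    4 * (Metric.ball (0 : ℂ) 1).indicator (fun w => ‖w - 0‖ ^ (-|t| - 1)) w +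
      32 * (1 + ‖w‖) ^ (-(3 - |t|)) +
      8 * (Metric.ball (1 : ℂ) 4).indicator (fun w => ‖w - 1‖ ^ (-1 : ℝ)) w := by
  have hpos : 0 < ‖w‖ := norm_pos_iff.2 h0
  have n1 : 0 ≤ (Metric.ball (0 : ℂ) 1).indicator (fun w => ‖w - 0‖ ^ (-|t| - 1)) w :=
    Set.indicator_nonneg (fun _ _ => by positivity) _
  have n2 : 0 ≤ (1 + ‖w‖) ^ (-(3 - |t|)) := by positivity
  have n3 : 0 ≤ (Metric.ball (1 : ℂ) 4).indicator (fun w => ‖w - 1‖ ^ (-1 : ℝ)) w :=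
    Set.indicator_nonneg (fun _ _ => by positivity) _
  have htri1 : 1 - ‖w‖ ≤ ‖w - 1‖ := by
    have := norm_sub_norm_le (1 : ℂ) w
    rwa [norm_one, norm_sub_rev] at this
  have htri2 : ‖w‖ - 1 ≤ ‖w - 1‖ := by
    have := norm_sub_norm_le w (1 : ℂ)
    rwa [norm_one] at this
  unfold schurKernel
  rcases lt_or_ge ‖w‖ (1 / 2) with h | h
  · have hd : 1 / 2 ≤ ‖w - 1‖ := by linarith
    have hm : w ∈ Metric.ball (0 : ℂ) 1 := by simp; linarith
    rw [Set.indicator_of_mem hm, sub_zero, sub_eq_add_neg (-|t|), Real.rpow_add hpos,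
      Real.rpow_neg_one] at *
    have e1 := abs_rpow_sub_one_le_of_le_one (t := t) hpos (by linarith)
    have : |‖w‖ ^ t - 1| / (‖w - 1‖ ^ 2 * ‖w‖) ≤ 4 * (‖w‖ ^ (-|t|) * ‖w‖⁻¹) := by
      calc _ ≤ ‖w‖ ^ (-|t|) / ((1 / 2) ^ 2 * ‖w‖) := by gcongr
        _ = _ := by field_simp; norm_num
    linarith
  rcases le_or_gt ‖w‖ 2 with h' | h'
  · rcases eq_or_ne w 1 with rfl | hw1
    · simp at n1 n2 n3 ⊢
      positivity
    have hd0 : 0 < ‖w - 1‖ := norm_pos_iff.2 (sub_ne_zero.2 hw1)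
    have hm : w ∈ Metric.ball (1 : ℂ) 4 := by
      rw [Metric.mem_ball, dist_eq_norm]
      calc ‖w - 1‖ ≤ ‖w‖ + ‖(1 : ℂ)‖ := norm_sub_le _ _
        _ < 4 := by rw [norm_one]; linarith
    rw [Set.indicator_of_mem hm, Real.rpow_neg_one]
    have e1 := abs_rpow_sub_one_le h h' ht
    have e2 : |‖w‖ - 1| ≤ ‖w - 1‖ := abs_le.2 ⟨by linarith, by linarith⟩
    have : |‖w‖ ^ t - 1| / (‖w - 1‖ ^ 2 * ‖w‖) ≤ 8 * ‖w - 1‖⁻¹ := by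
      calc _ ≤ (4 * ‖w - 1‖) / (‖w - 1‖ ^ 2 * (1 / 2)) := by
            gcongr
            exact e1.trans (by linarith)
        _ = _ := by field_simp; norm_num
    linarith
  · have hd : ‖w‖ / 2 ≤ ‖w - 1‖ := by linarith
    have e1 := abs_rpow_sub_one_le_of_one_le (t := t) (x := ‖w‖) (by linarith)
    have e2 : (2 * ‖w‖) ^ (-(3 - |t|)) ≤ (1 + ‖w‖) ^ (-(3 - |t|)) :=
      Real.rpow_le_rpow_of_nonpos (by positivity) (by linarith) (by linarith)
    -- Passing from `|w|` to `1 + |w| ≤ 2|w|` costs at most `2^3`; together with `4` from `|w - 1| ≥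
    -- |w|/2` this is the factor `32`.
    have e3 : (1 / 8 : ℝ) ≤ 2 ^ (-(3 - |t|)) := by
      have : (2 : ℝ) ^ (-3 : ℝ) ≤ 2 ^ (-(3 - |t|)) :=
        Real.rpow_le_rpow_of_exponent_le (by norm_num) (by linarith [abs_nonneg t])
      refine le_trans (le_of_eq ?_) this
      rw [Real.rpow_neg (by norm_num), show (3 : ℝ) = (3 : ℕ) by norm_num, Real.rpow_natCast]
      norm_num
    rw [Real.mul_rpow (by norm_num) hpos.le] at e2
    have e4 : ‖w‖ ^ (-(3 - |t|)) = ‖w‖ ^ |t| / ‖w‖ ^ 3 := by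
      rw [neg_sub, Real.rpow_sub hpos, show (3 : ℝ) = (3 : ℕ) by norm_num, Real.rpow_natCast]
    have : |‖w‖ ^ t - 1| / (‖w - 1‖ ^ 2 * ‖w‖) ≤ 32 * (1 + ‖w‖) ^ (-(3 - |t|)) := by
      calc _ ≤ ‖w‖ ^ |t| / ((‖w‖ / 2) ^ 2 * ‖w‖) := by gcongr
        _ = 4 * ‖w‖ ^ (-(3 - |t|)) := by rw [e4]; field_simp; norm_num
        _ = 32 * (1 / 8 * ‖w‖ ^ (-(3 - |t|))) := by ring
        _ ≤ 32 * (2 ^ (-(3 - |t|)) * ‖w‖ ^ (-(3 - |t|))) := by gcongr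
        _ ≤ _ := by gcongr
    linarith

lemma lintegral_schurKernel_lt_top {t : ℝ} (ht : |t| < 1) :
    ∫⁻ w, ENNReal.ofReal (schurKernel t w) < ⊤ := by
  have hi : Integrable (fun w : ℂ =>
    4 * (Metric.ball (0 : ℂ) 1).indicator (fun w => ‖w - 0‖ ^ (-|t| - 1)) w +
      32 * (1 + ‖w‖) ^ (-(3 - |t|)) +
      8 * (Metric.ball (1 : ℂ) 4).indicator (fun w => ‖w - 1‖ ^ (-1 : ℝ)) w) := by
    refine (((integrableOn_ball_norm_rpow (by linarith) one_pos 0).const_mul 4).add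
      (Integrable.const_mul ?_ 32)).add
      ((integrableOn_ball_norm_rpow (by norm_num) (by norm_num) 1).const_mul 8)
    exact integrable_one_add_norm (by simp only [Complex.finrank_real_complex]; push_cast; linarith)
  refine lt_of_le_of_lt (lintegral_mono_ae ?_) hi.lintegral_lt_top
  filter_upwards [Measure.ae_ne volume (0 : ℂ)] with w hw
  exact ENNReal.ofReal_le_ofReal (schurKernel_le ht hw)

lemma lintegral_comp_mul_left (F : ℂ → ℝ≥0∞) {z : ℂ} (hz : z ≠ 0) :
    ∫⁻ w, F w = ∫⁻ w, ENNReal.ofReal (‖z‖ ^ 2) * F (z * w) := by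
  have h := lintegral_image_eq_lintegral_abs_det_fderiv_mul (volume : Measure ℂ) MeasurableSet.univ
    (f := fun w => z * w) (f' := fun _ => wirtingerCLM z 0)
    (fun w _ => (hasFDerivAt_of_hasDerivAt
      (by simpa using (hasDerivAt_id w).const_mul z)).hasFDerivWithinAt)
    (mul_right_injective₀ hz).injOn F
  rw [Set.image_univ, (mul_left_surjective₀ hz).range_eq] at h
  simpa [det_wirtingerCLM] using h

/-- The kernel of the commutator of `S` with a power of `|z|`, up to a constant. -/
def commKernel (t : ℝ) (z w : ℂ) : ℝ := |‖w‖ ^ t * ‖z‖ ^ (-t) - 1| / ‖w - z‖ ^ 2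

/-- Substitute `w ↦ z w`: the kernel is homogeneous of degree `-2` and the Jacobian is `|z|²`, so
only the factor `1/|z|` of the test function survives and the base point becomes `1`. -/
lemma lintegral_commKernel_left (t : ℝ) {z : ℂ} (hz : z ≠ 0) :
    ∫⁻ w, ENNReal.ofReal (commKernel t z w) * ENNReal.ofReal ‖w‖⁻¹ =
      ENNReal.ofReal ‖z‖⁻¹ * ∫⁻ w, ENNReal.ofReal (schurKernel t w) := by
  rw [lintegral_comp_mul_left _ hz, ← lintegral_const_mul' _ _ ENNReal.ofReal_ne_top]
  congr 1; ext w
  have hz' : 0 < ‖z‖ := norm_pos_iff.2 hz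
  rw [← ENNReal.ofReal_mul (by unfold commKernel; positivity), ← ENNReal.ofReal_mul (by positivity),
    ← ENNReal.ofReal_mul (by positivity)]
  congr 1
  have h1 : z * w - z = z * (w - 1) := by ring
  rw [commKernel, schurKernel, h1, norm_mul, norm_mul, Real.mul_rpow (by positivity) (by positivity),
    Real.rpow_neg (by positivity)]
  have h2 : ‖z‖ ^ t * ‖w‖ ^ t * (‖z‖ ^ t)⁻¹ = ‖w‖ ^ t := by
    have := (Real.rpow_pos_of_pos hz' t).ne'
    field_simp
  rw [h2]
  rcases eq_or_ne w 0 with rfl | hw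
  · simp
  rcases eq_or_ne w 1 with rfl | hw1
  · simp
  have hw' : ‖w‖ ≠ 0 := norm_ne_zero_iff.2 hw
  have hw1' : ‖w - 1‖ ≠ 0 := norm_ne_zero_iff.2 (sub_ne_zero.2 hw1)
  field_simp

/-- The transposed kernel is the kernel for `-t`, so one computation supplies both Schur bounds. -/
lemma commKernel_swap (t : ℝ) (z w : ℂ) : commKernel t z w = commKernel (-t) w z := by
  rw [commKernel, commKernel, norm_sub_rev, neg_neg, mul_comm]

lemma lintegral_commKernel_right (t : ℝ) {w : ℂ} (hw : w ≠ 0) :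
    ∫⁻ z, ENNReal.ofReal (commKernel t z w) * ENNReal.ofReal ‖z‖⁻¹ =
      ENNReal.ofReal ‖w‖⁻¹ * ∫⁻ z, ENNReal.ofReal (schurKernel (-t) z) := by
  simp only [commKernel_swap t]
  exact lintegral_commKernel_left (-t) hw

/-- Schur's test. -/
lemma lintegral_sq_le_of_schur {α : Type*} [MeasurableSpace α] {ν : Measure α} [SFinite ν]
    {κ : α → α → ℝ≥0∞} (hκ : Measurable (Function.uncurry κ)) {p F : α → ℝ≥0∞} (hp : Measurable p)
    (hF : AEMeasurable F ν) (hp0 : ∀ᵐ x ∂ν, p x ≠ 0) (hptop : ∀ x, p x ≠ ⊤) {A B : ℝ≥0∞}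
    (hA : ∀ᵐ x ∂ν, ∫⁻ y, κ x y * p y ∂ν ≤ A * p x) (hB : ∀ᵐ y ∂ν, ∫⁻ x, κ x y * p x ∂ν ≤ B * p y) :
    ∫⁻ x, (∫⁻ y, κ x y * F y ∂ν) ^ 2 ∂ν ≤ A * B * ∫⁻ y, F y ^ 2 ∂ν := by
  wlog hFm : Measurable F generalizing F
  · have h1 : ∀ x, ∫⁻ y, κ x y * F y ∂ν = ∫⁻ y, κ x y * hF.mk F y ∂ν := fun x =>
      lintegral_congr_ae (by filter_upwards [hF.ae_eq_mk] with y hy; rw [hy])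
    have h2 : ∫⁻ y, F y ^ 2 ∂ν = ∫⁻ y, hF.mk F y ^ 2 ∂ν :=
      lintegral_congr_ae (by filter_upwards [hF.ae_eq_mk] with y hy; rw [hy])
    simp only [h1, h2]
    exact this hF.measurable_mk.aemeasurable hF.measurable_mk
  have hκx : ∀ x, Measurable (κ x) := fun x => hκ.comp measurable_prodMk_left
  have hκy : ∀ y, Measurable (fun x => κ x y) := fun y => hκ.comp measurable_prodMk_right
  -- Cauchy–Schwarz for the splitting `κ F = (κ p)^(1/2) (κ F² / p)^(1/2)`.
  have step : ∀ᵐ x ∂ν, (∫⁻ y, κ x y * F y ∂ν) ^ 2 ≤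
      A * (p x * ∫⁻ y, κ x y * (F y ^ 2 * (p y)⁻¹) ∂ν) := by
    filter_upwards [hA] with x hx
    have h1 : ∫⁻ y, κ x y * F y ∂ν ≤ ∫⁻ y, (κ x y * p y) ^ (1 / 2 : ℝ) *
        (κ x y * (F y ^ 2 * (p y)⁻¹)) ^ (1 / 2 : ℝ) ∂ν := by
      apply lintegral_mono_ae
      filter_upwards [hp0] with y hy
      rw [← ENNReal.mul_rpow_of_nonneg _ _ (by norm_num)]
      have : κ x y * p y * (κ x y * (F y ^ 2 * (p y)⁻¹)) = (κ x y * F y) ^ 2 := by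
        calc _ = κ x y ^ 2 * F y ^ 2 * (p y * (p y)⁻¹) := by ring
          _ = _ := by rw [ENNReal.mul_inv_cancel hy (hptop y)]; ring
      rw [this, ← ENNReal.rpow_natCast, ← ENNReal.rpow_mul]
      norm_num
    have h2 := ENNReal.lintegral_mul_norm_pow_le (μ := ν) (f := fun y => κ x y * p y)
      (g := fun y => κ x y * (F y ^ 2 * (p y)⁻¹))
      (((hκx x).mul hp).aemeasurable)
      (((hκx x).mul ((hFm.pow_const 2).mul hp.inv)).aemeasurable)
      (p := 1 / 2) (q := 1 / 2) (by norm_num) (by norm_num) (by norm_num)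
    calc (∫⁻ y, κ x y * F y ∂ν) ^ 2 ≤ ((∫⁻ y, κ x y * p y ∂ν) ^ (1 / 2 : ℝ) *
          (∫⁻ y, κ x y * (F y ^ 2 * (p y)⁻¹) ∂ν) ^ (1 / 2 : ℝ)) ^ 2 := by
          gcongr; exact h1.trans h2
      _ = (∫⁻ y, κ x y * p y ∂ν) * ∫⁻ y, κ x y * (F y ^ 2 * (p y)⁻¹) ∂ν := by
          rw [← ENNReal.mul_rpow_of_nonneg _ _ (by norm_num), ← ENNReal.rpow_natCast,
            ← ENNReal.rpow_mul]
          norm_num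
      _ ≤ (A * p x) * ∫⁻ y, κ x y * (F y ^ 2 * (p y)⁻¹) ∂ν := by gcongr
      _ = _ := by ring
  calc _ ≤ ∫⁻ x, A * (p x * ∫⁻ y, κ x y * (F y ^ 2 * (p y)⁻¹) ∂ν) ∂ν := lintegral_mono_ae step
    _ = A * ∫⁻ x, p x * ∫⁻ y, κ x y * (F y ^ 2 * (p y)⁻¹) ∂ν ∂ν := by
        apply lintegral_const_mul
        apply hp.mul
        apply Measurable.lintegral_prod_right'
          (f := fun q : α × α => κ q.1 q.2 * (F q.2 ^ 2 * (p q.2)⁻¹))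
        exact hκ.mul (((hFm.pow_const 2).mul hp.inv).comp measurable_snd)
    _ = A * ∫⁻ x, ∫⁻ y, p x * (κ x y * (F y ^ 2 * (p y)⁻¹)) ∂ν ∂ν := by
        congr 2; ext x
        rw [lintegral_const_mul _ (f := fun y => κ x y * (F y ^ 2 * (p y)⁻¹))
          ((hκx x).mul ((hFm.pow_const 2).mul hp.inv))]
    _ = A * ∫⁻ y, ∫⁻ x, p x * (κ x y * (F y ^ 2 * (p y)⁻¹)) ∂ν ∂ν := by
        rw [lintegral_lintegral_swap]
        exact ((hp.comp measurable_fst).mul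
          (hκ.mul (((hFm.pow_const 2).mul hp.inv).comp measurable_snd))).aemeasurable
    _ ≤ A * ∫⁻ y, B * F y ^ 2 ∂ν := by
        gcongr 1
        apply lintegral_mono_ae
        filter_upwards [hB, hp0] with y hy hy0
        calc _ = ∫⁻ x, (F y ^ 2 * (p y)⁻¹) * (κ x y * p x) ∂ν := by
              congr 1; ext x; ring
          _ = (F y ^ 2 * (p y)⁻¹) * ∫⁻ x, κ x y * p x ∂ν :=
              lintegral_const_mul _ ((hκy y).mul hp)
          _ ≤ (F y ^ 2 * (p y)⁻¹) * (B * p y) := by gcongr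
          _ = B * F y ^ 2 * (p y * (p y)⁻¹) := by ring
          _ = B * F y ^ 2 := by rw [ENNReal.mul_inv_cancel hy0 (hptop y), mul_one]
    _ = _ := by rw [lintegral_const_mul _ (hFm.pow_const 2), mul_assoc]

lemma add_sq_le_four_mul (x y : ℝ≥0∞) : (x + y) ^ 2 ≤ 4 * (x ^ 2 + y ^ 2) := by
  have h : ∀ a b : ℝ≥0∞, a ≤ b → (a + b) ^ 2 ≤ 4 * (a ^ 2 + b ^ 2) := fun a b hab =>
    calc (a + b) ^ 2 ≤ (b + b) ^ 2 := by gcongr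
      _ = 4 * b ^ 2 := by ring
      _ ≤ 4 * (a ^ 2 + b ^ 2) := by gcongr; exact le_add_self
  rcases le_total x y with hxy | hxy
  · exact h x y hxy
  · rw [add_comm x y, add_comm (x ^ 2)]; exact h y x hxy

lemma measurable_commKernel (t : ℝ) : Measurable (Function.uncurry (commKernel t)) := by
  unfold commKernel Function.uncurry
  have h1 : Measurable fun q : ℂ × ℂ => ‖q.2‖ ^ t * ‖q.1‖ ^ (-t) - 1 := by fun_prop
  exact h1.abs.div (by fun_prop)

lemma integrableOn_div_sq {f : ℂ → ℂ} (hf : MemLp f 2) (z : ℂ) {ε : ℝ} (hε : 0 < ε) :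
    IntegrableOn (fun w => f w / (w - z) ^ 2) {w : ℂ | ε < ‖w - z‖} := by
  have hms : MeasurableSet {w : ℂ | ε < ‖w - z‖} :=
    measurableSet_lt measurable_const (by fun_prop)
  rw [← integrable_indicator_iff hms]
  refine (integrable_mul_of_memLp hf (memLp_indicator_inv_sq z hε)).congr (ae_of_all _ fun w => ?_)
  by_cases hw : w ∈ {w : ℂ | ε < ‖w - z‖} <;> simp only [Set.indicator_of_mem, hw,
    Set.indicator_of_notMem, not_false_eq_true, div_eq_mul_inv, mul_zero]

/-- Comparison of the truncations of `S` with those of `S` conjugated by a power of `|z|`. -/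
lemma enorm_beurlingTrunc_le {g f : ℂ → ℂ} {t : ℝ} (hg : MemLp g 2) (hf : MemLp f 2)
    (hfg : ∀ w, f w = ((‖w‖ ^ (-t) : ℝ) : ℂ) * g w) (z : ℂ) {ε : ℝ} (hε : 0 < ε) :
    ‖((‖z‖ ^ (-t) : ℝ) : ℂ)‖ₑ * ‖beurlingTrunc g ε z‖ₑ ≤ ‖beurlingTrunc f ε z‖ₑ +
      ∫⁻ w, ENNReal.ofReal (commKernel t z w) * ‖f w‖ₑ := by
  set A : Set ℂ := {w : ℂ | ε < ‖w - z‖}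
  have hms : MeasurableSet A := measurableSet_lt measurable_const (by fun_prop)
  have h1 : ((‖z‖ ^ (-t) : ℝ) : ℂ) * beurlingTrunc g ε z - beurlingTrunc f ε z =
      -(1 / (Real.pi : ℂ)) * ∫ w in A, (((‖w‖ ^ t * ‖z‖ ^ (-t) - 1 : ℝ) : ℂ) / (w - z) ^ 2) * f w := by
    rw [beurlingTrunc, beurlingTrunc, mul_left_comm, ← mul_sub, ← integral_const_mul,
      ← integral_sub ((integrableOn_div_sq hg z hε).const_mul _) (integrableOn_div_sq hf z hε)]
    congr 1
    apply integral_congr_ae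
    filter_upwards [ae_restrict_of_ae (Measure.ae_ne volume (0 : ℂ))] with w hw
    have hw' : 0 < ‖w‖ := norm_pos_iff.2 hw
    have h2 : (((‖w‖ ^ t : ℝ) : ℂ)) * ((‖w‖ ^ (-t) : ℝ) : ℂ) = 1 := by
      rw [← Complex.ofReal_mul, ← Real.rpow_add hw']
      simp
    rw [hfg]
    push_cast at h2 ⊢
    linear_combination (-((‖z‖ ^ (-t) : ℝ) : ℂ) * g w / (w - z) ^ 2) * h2
  have h2 : ‖((‖z‖ ^ (-t) : ℝ) : ℂ) * beurlingTrunc g ε z - beurlingTrunc f ε z‖ₑ ≤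
      ∫⁻ w, ENNReal.ofReal (commKernel t z w) * ‖f w‖ₑ := by
    rw [h1, enorm_mul]
    have hpi : ‖-(1 / (Real.pi : ℂ))‖ₑ ≤ 1 := by
      rw [enorm_neg, ← ofReal_norm, norm_div, norm_one, Complex.norm_real,
        Real.norm_of_nonneg Real.pi_pos.le, ENNReal.ofReal_le_one]
      rw [div_le_one Real.pi_pos]
      linarith [Real.pi_gt_three]
    calc _ ≤ 1 * ∫⁻ w in A, ‖(((‖w‖ ^ t * ‖z‖ ^ (-t) - 1 : ℝ) : ℂ) / (w - z) ^ 2) * f w‖ₑ :=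
          mul_le_mul' hpi (enorm_integral_le_lintegral_enorm _)
      _ ≤ ∫⁻ w, ‖(((‖w‖ ^ t * ‖z‖ ^ (-t) - 1 : ℝ) : ℂ) / (w - z) ^ 2) * f w‖ₑ := by
          rw [one_mul]; exact setLIntegral_le_lintegral _ _
      _ = _ := by
          congr 1; ext w
          rw [enorm_mul, ← ofReal_norm, norm_div, Complex.norm_real, norm_pow,
            Real.norm_eq_abs]
          rfl
  rw [← enorm_mul]
  calc _ = ‖beurlingTrunc f ε z +
        (((‖z‖ ^ (-t) : ℝ) : ℂ) * beurlingTrunc g ε z - beurlingTrunc f ε z)‖ₑ := by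
        rw [add_sub_cancel]
    _ ≤ _ := (enorm_add_le _ _).trans (by gcongr)

/-- The Beurling transform is bounded on `L²(|z|^{-2t} dm)` for `|t| < 1`. -/
theorem exists_weighted_bound {t : ℝ} (ht : |t| < 1) : ∃ C : ℝ≥0, ∀ g g' : ℂ → ℂ, MemLp g 2 →
    IsBeurlingTransform g g' →
    ∫⁻ z, (‖((‖z‖ ^ (-t) : ℝ) : ℂ)‖ₑ * ‖g' z‖ₑ) ^ 2 ≤
      C * ∫⁻ z, (‖((‖z‖ ^ (-t) : ℝ) : ℂ)‖ₑ * ‖g z‖ₑ) ^ 2 := by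
  set A := ∫⁻ w, ENNReal.ofReal (schurKernel t w) with hA
  set B := ∫⁻ w, ENNReal.ofReal (schurKernel (-t) w) with hB
  have hAt : A ≠ ⊤ := (lintegral_schurKernel_lt_top ht).ne
  have hBt : B ≠ ⊤ := (lintegral_schurKernel_lt_top (t := -t) (by rwa [abs_neg])).ne
  refine ⟨(4 * (1 + A * B)).toNNReal, fun g g' hg hgg' => ?_⟩
  rw [ENNReal.coe_toNNReal (by finiteness)]
  set f : ℂ → ℂ := fun w => ((‖w‖ ^ (-t) : ℝ) : ℂ) * g w with hf
  have hfm : AEStronglyMeasurable f volume := by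
    refine AEStronglyMeasurable.mul ?_ hg.1
    exact (Complex.measurable_ofReal.comp (measurable_norm.pow_const _)).aestronglyMeasurable
  have hfe : ∀ z, ‖((‖z‖ ^ (-t) : ℝ) : ℂ)‖ₑ * ‖g z‖ₑ = ‖f z‖ₑ := fun z => (enorm_mul _ _).symm
  simp only [hfe]
  -- The weighted norm of `g` may be infinite. The summand `1` in the constant keeps it nonzero, so
  -- the bound is then trivial.
  rcases eq_or_ne (∫⁻ z, ‖f z‖ₑ ^ 2) ⊤ with htop | htop
  · rw [htop, ENNReal.mul_top]
    · exact le_top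
    · simp
  have hfL : MemLp f 2 := by
    refine ⟨hfm, ?_⟩
    rw [eLpNorm_lt_top_iff_lintegral_rpow_enorm_lt_top (by norm_num) (by norm_num)]
    simpa using lt_top_iff_ne_top.2 htop
  have hSf : ∫⁻ z, ‖beurlingL2 hfL.toLp z‖ₑ ^ 2 = ∫⁻ z, ‖f z‖ₑ ^ 2 := by
    have h1 : eLpNorm (beurlingL2 hfL.toLp) 2 volume = eLpNorm f 2 volume := by
      rw [← eLpNorm_congr_ae hfL.coeFn_toLp, ← Lp.enorm_def, ← Lp.enorm_def,
        beurlingL2.enorm_map]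
    rw [eLpNorm_eq_lintegral_rpow_enorm_toReal (by norm_num) (by norm_num),
      eLpNorm_eq_lintegral_rpow_enorm_toReal (by norm_num) (by norm_num)] at h1
    simpa using ENNReal.rpow_left_injective (x := 1 / 2) (by norm_num) (by simpa using h1)
  -- The comparison of truncations has an error independent of `ε`, so it passes to the principal
  -- values.
  have hpt : ∀ᵐ z, ‖((‖z‖ ^ (-t) : ℝ) : ℂ)‖ₑ * ‖g' z‖ₑ ≤ ‖beurlingL2 hfL.toLp z‖ₑ +
      ∫⁻ w, ENNReal.ofReal (commKernel t z w) * ‖f w‖ₑ := by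
    filter_upwards [hgg', isBeurlingTransform_beurlingL2 hfL] with z h1 h2
    refine le_of_tendsto_of_tendsto
      (ENNReal.Tendsto.const_mul h1.enorm (Or.inr (by finiteness)))
      (h2.enorm.add_const _) ?_
    filter_upwards [self_mem_nhdsWithin] with ε hε
    exact enorm_beurlingTrunc_le hg hfL (fun w => rfl) z hε
  have hT : ∫⁻ z, (∫⁻ w, ENNReal.ofReal (commKernel t z w) * ‖f w‖ₑ) ^ 2 ≤
      A * B * ∫⁻ z, ‖f z‖ₑ ^ 2 := by
    refine lintegral_sq_le_of_schur (measurable_commKernel t).ennreal_ofReal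
      (p := fun z => ENNReal.ofReal ‖z‖⁻¹) (by fun_prop) hfm.enorm ?_ (by simp) ?_ ?_
    · filter_upwards [Measure.ae_ne volume (0 : ℂ)] with z hz
      simpa using hz
    · filter_upwards [Measure.ae_ne volume (0 : ℂ)] with z hz
      rw [lintegral_commKernel_left t hz, mul_comm]
    · filter_upwards [Measure.ae_ne volume (0 : ℂ)] with z hz
      rw [lintegral_commKernel_right t hz, mul_comm]
  calc _ ≤ ∫⁻ z, 4 * (‖beurlingL2 hfL.toLp z‖ₑ ^ 2 +
        (∫⁻ w, ENNReal.ofReal (commKernel t z w) * ‖f w‖ₑ) ^ 2) := by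
        apply lintegral_mono_ae
        filter_upwards [hpt] with z hz
        exact (pow_le_pow_left' hz 2).trans (add_sq_le_four_mul _ _)
    _ = 4 * ((∫⁻ z, ‖beurlingL2 hfL.toLp z‖ₑ ^ 2) +
        ∫⁻ z, (∫⁻ w, ENNReal.ofReal (commKernel t z w) * ‖f w‖ₑ) ^ 2) := by
        rw [lintegral_const_mul' _ _ (by norm_num), lintegral_add_left']
        exact ((Lp.aestronglyMeasurable (beurlingL2 hfL.toLp)).enorm).pow_const 2
    _ ≤ 4 * ((∫⁻ z, ‖f z‖ₑ ^ 2) + A * B * ∫⁻ z, ‖f z‖ₑ ^ 2) := by rw [hSf]; gcongr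
    _ = _ := by ring

/-! ### The stretch map -/

/-- A linear function plus two clipped ramps: continuity, monotonicity and the symmetries become
visible without case distinctions. -/
lemma stretchAngle_eq (K θ : ℝ) : stretchAngle K θ = 1 / K * θ + (2 - 2 / K) *
    (max 0 (min (θ - Real.pi / 4) (Real.pi / 2)) - max 0 (min (-θ - Real.pi / 4) (Real.pi / 2))) := by
  have hpi := Real.pi_pos
  unfold stretchAngle
  rcases lt_trichotomy θ 0 with h | rfl | h
  · rw [abs_of_neg h, Real.sign_of_neg h, max_eq_left (a := 0) (b := min (θ - _) _)
      ((min_le_left _ _).trans (by linarith))]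
    split_ifs with h1 h2
    · rw [max_eq_left ((min_le_left _ _).trans (by linarith))]; ring
    · rw [min_eq_left (by linarith), max_eq_right (by linarith)]; ring
    · rw [min_eq_right (by linarith), max_eq_right (by linarith)]; ring
  · simp
  · rw [abs_of_pos h, Real.sign_of_pos h, max_eq_left (a := 0) (b := min (-θ - _) _)
      ((min_le_left _ _).trans (by linarith))]
    split_ifs with h1 h2
    · rw [max_eq_left ((min_le_left _ _).trans (by linarith))]; ring
    · rw [min_eq_left (by linarith), max_eq_right (by linarith)]; ring
    · rw [min_eq_right (by linarith), max_eq_right (by linarith)]; ring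

lemma continuous_stretchAngle (K : ℝ) : Continuous (stretchAngle K) := by
  simp only [funext (stretchAngle_eq K)]
  fun_prop

lemma strictMono_stretchAngle {K : ℝ} (hK : 1 < K) : StrictMono (stretchAngle K) := by
  intro a b hab
  rw [stretchAngle_eq, stretchAngle_eq]
  have h1 : 1 / K * a < 1 / K * b := by gcongr
  have h2 : 0 ≤ 2 - 2 / K := by
    have : 2 / K ≤ 2 := div_le_self (by norm_num) hK.le
    linarith
  have h3 : max 0 (min (a - Real.pi / 4) (Real.pi / 2)) ≤
    max 0 (min (b - Real.pi / 4) (Real.pi / 2)) := by gcongr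
  have h4 : max 0 (min (-b - Real.pi / 4) (Real.pi / 2)) ≤
    max 0 (min (-a - Real.pi / 4) (Real.pi / 2)) := by gcongr
  have h5 := mul_le_mul_of_nonneg_left (sub_le_sub h3 h4) h2
  linarith

lemma stretchAngle_pi (K : ℝ) : stretchAngle K Real.pi = Real.pi := by
  have hpi := Real.pi_pos
  rw [stretchAngle_eq, min_eq_right (by linarith), max_eq_right (by linarith),
    min_eq_left (by linarith), max_eq_left (by linarith)]
  ring

lemma stretchAngle_neg (K θ : ℝ) : stretchAngle K (-θ) = -stretchAngle K θ := by
  rw [stretchAngle_eq, stretchAngle_eq, neg_neg]; ring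

/-- The slopes are symmetric about `π/2`; this makes the planar map odd. -/
lemma stretchAngle_sub_pi {K θ : ℝ} (h0 : 0 ≤ θ) (h1 : θ ≤ Real.pi) :
    stretchAngle K (θ - Real.pi) = stretchAngle K θ - Real.pi := by
  have hpi := Real.pi_pos
  rw [stretchAngle_eq, stretchAngle_eq,
    max_eq_left (a := 0) (b := min (θ - Real.pi - _) _) ((min_le_left _ _).trans (by linarith)),
    max_eq_left (a := 0) (b := min (-θ - _) _) ((min_le_left _ _).trans (by linarith))]
  rcases le_total θ (Real.pi / 4) with h | h
  · rw [min_eq_right (by linarith), max_eq_right (by linarith), min_eq_left (by linarith),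
      max_eq_left (by linarith)]
    ring
  rcases le_total θ (3 * Real.pi / 4) with h' | h'
  · rw [min_eq_left (by linarith), max_eq_right (by linarith), min_eq_left (by linarith),
      max_eq_right (by linarith)]
    ring
  · rw [min_eq_left (by linarith), max_eq_left (by linarith), min_eq_right (by linarith),
      max_eq_right (by linarith)]
    ring

lemma stretchMap_polar (K : ℝ) {r θ : ℝ} (hr : 0 < r) (h1 : -Real.pi < θ) (h2 : θ ≤ Real.pi) :
    stretchMap K (r * Complex.exp (θ * Complex.I)) =
      ((r ^ (1 / K) : ℝ) : ℂ) * Complex.exp ((stretchAngle K θ : ℝ) * Complex.I) := by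
  have harg : (r * Complex.exp (θ * Complex.I) : ℂ).arg = θ := by
    rw [Complex.exp_mul_I]
    exact Complex.arg_mul_cos_add_sin_mul_I hr ⟨h1, h2⟩
  have hnorm : ‖(r * Complex.exp (θ * Complex.I) : ℂ)‖ = r := by
    rw [norm_mul, Complex.norm_exp_ofReal_mul_I, mul_one, Complex.norm_real,
      Real.norm_of_nonneg hr.le]
  rw [stretchMap, harg, hnorm]

section stretchMap

variable {K : ℝ} (hK : 1 < K)

lemma norm_stretchMap (K : ℝ) (z : ℂ) : ‖stretchMap K z‖ = ‖z‖ ^ (1 / K) := by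
  rw [stretchMap, norm_mul, Complex.norm_exp_ofReal_mul_I, mul_one, Complex.norm_real,
    Real.norm_of_nonneg (by positivity)]

include hK

lemma stretchMap_zero : stretchMap K 0 = 0 := by
  rw [← norm_eq_zero, norm_stretchMap, norm_zero, Real.zero_rpow (by positivity)]

lemma stretchMap_eq_zero_iff {z : ℂ} : stretchMap K z = 0 ↔ z = 0 := by
  rw [← norm_eq_zero, norm_stretchMap, Real.rpow_eq_zero (norm_nonneg _) (by positivity),
    norm_eq_zero]

/-- Oddness replaces every argument near the branch cut of `arg`, and in the left and lower sectors,
by one in the right or upper sector. -/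
lemma stretchMap_neg (z : ℂ) : stretchMap K (-z) = -stretchMap K z := by
  rcases eq_or_ne z 0 with rfl | hz
  · simp [stretchMap_zero hK]
  have hr : 0 < ‖z‖ := norm_pos_iff.2 hz
  have h1 := Complex.neg_pi_lt_arg z
  have h2 := Complex.arg_le_pi z
  have hexp : Complex.exp ((Real.pi : ℂ) * Complex.I) = -1 := Complex.exp_pi_mul_I
  have hz' := Complex.norm_mul_exp_arg_mul_I z
  rcases lt_or_ge 0 z.arg with h | h
  · have e1 : -z = (‖z‖ : ℂ) * Complex.exp (((z.arg - Real.pi : ℝ) : ℂ) * Complex.I) := by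
      rw [Complex.ofReal_sub, sub_mul, Complex.exp_sub, hexp]
      linear_combination hz'
    rw [e1, stretchMap_polar K hr (by linarith) (by linarith), stretchAngle_sub_pi h.le h2,
      Complex.ofReal_sub, sub_mul, Complex.exp_sub, hexp, stretchMap]
    ring
  · have e1 : -z = (‖z‖ : ℂ) * Complex.exp (((z.arg + Real.pi : ℝ) : ℂ) * Complex.I) := by
      rw [Complex.ofReal_add, add_mul, Complex.exp_add, hexp]
      linear_combination hz'
    have e2 := stretchAngle_sub_pi (K := K) (θ := z.arg + Real.pi) (by linarith) (by linarith)
    rw [add_sub_cancel_right] at e2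
    have e3 : stretchAngle K (z.arg + Real.pi) = stretchAngle K z.arg + Real.pi := by linarith
    rw [e1, stretchMap_polar K hr (by linarith) (by linarith), e3,
      Complex.ofReal_add, add_mul, Complex.exp_add, hexp, stretchMap]
    ring

lemma continuous_stretchMap : Continuous (stretchMap K) := by
  have hslit : ∀ z ∈ Complex.slitPlane, ContinuousAt (stretchMap K) z := by
    intro z hz
    have h1 : ContinuousAt (fun z : ℂ => ‖z‖ ^ (1 / K)) z :=
      continuousAt_id.norm.rpow_const (Or.inl (norm_ne_zero_iff.2 (Complex.slitPlane_ne_zero hz)))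
    have h2 : ContinuousAt (fun z : ℂ => stretchAngle K z.arg) z :=
      (continuous_stretchAngle K).continuousAt.comp (Complex.continuousAt_arg hz)
    unfold stretchMap
    exact (Complex.continuous_ofReal.continuousAt.comp h1).mul
      (((Complex.continuous_ofReal.continuousAt.comp h2).mul continuousAt_const).cexp)
  rw [continuous_iff_continuousAt]
  intro z
  by_cases hz : z ∈ Complex.slitPlane
  · exact hslit z hz
  rcases eq_or_ne z 0 with rfl | hz0
  · rw [ContinuousAt, stretchMap_zero hK, tendsto_zero_iff_norm_tendsto_zero]
    simp only [norm_stretchMap]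
    have : Continuous fun z : ℂ => ‖z‖ ^ (1 / K) :=
      continuous_norm.rpow_const fun _ => Or.inr (by positivity)
    have h := this.tendsto 0
    rwa [norm_zero, Real.zero_rpow (by positivity)] at h
  · have hz' : -z ∈ Complex.slitPlane := by
      rw [Complex.mem_slitPlane_iff] at hz ⊢
      push Not at hz
      left
      rw [Complex.neg_re]
      rcases hz.1.lt_or_eq with h | h
      · linarith
      · exact absurd (Complex.ext h hz.2) hz0
    have : stretchMap K = fun z => -stretchMap K (-z) := by
      ext z; rw [stretchMap_neg hK, neg_neg]
    rw [this]
    exact ((hslit _ hz').comp continuousAt_neg).neg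

lemma arg_stretchMap {z : ℂ} (hz : z ≠ 0) : (stretchMap K z).arg = stretchAngle K z.arg := by
  rw [stretchMap, Complex.exp_mul_I]
  refine Complex.arg_mul_cos_add_sin_mul_I
    (Real.rpow_pos_of_pos (norm_pos_iff.2 hz) _) ⟨?_, ?_⟩
  · have := strictMono_stretchAngle hK (Complex.neg_pi_lt_arg z)
    rwa [stretchAngle_neg, stretchAngle_pi] at this
  · have := (strictMono_stretchAngle hK).monotone (Complex.arg_le_pi z)
    rwa [stretchAngle_pi] at this

lemma injective_stretchMap : Function.Injective (stretchMap K) := by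
  intro z w h
  rcases eq_or_ne z 0 with rfl | hz
  · rw [stretchMap_zero hK] at h
    exact ((stretchMap_eq_zero_iff hK).1 h.symm).symm
  rcases eq_or_ne w 0 with rfl | hw
  · rw [stretchMap_zero hK] at h
    exact (stretchMap_eq_zero_iff hK).1 h
  refine Complex.ext_norm_arg ?_ ?_
  · have := congrArg norm h
    rw [norm_stretchMap, norm_stretchMap] at this
    exact (Real.rpow_left_inj (norm_nonneg _) (norm_nonneg _) (by positivity)).1 this
  · have := congrArg Complex.arg h
    rw [arg_stretchMap hK hz, arg_stretchMap hK hw] at this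
    exact (strictMono_stretchAngle hK).injective this

lemma surjective_stretchMap : Function.Surjective (stretchMap K) := by
  intro w
  rcases eq_or_ne w 0 with rfl | hw
  · exact ⟨0, stretchMap_zero hK⟩
  have hr : 0 < ‖w‖ := norm_pos_iff.2 hw
  have hpi := Real.pi_pos
  obtain ⟨θ, ⟨h1, h2⟩, hθ⟩ := intermediate_value_Icc (a := -Real.pi) (b := Real.pi) (by linarith)
    (continuous_stretchAngle K).continuousOn (show w.arg ∈ _ by
      rw [stretchAngle_neg, stretchAngle_pi]
      exact ⟨(Complex.neg_pi_lt_arg w).le, Complex.arg_le_pi w⟩)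
  -- The polar formula needs `θ > -π`; the endpoint is excluded because it is fixed and `arg` never
  -- equals `-π`.
  have h3 : -Real.pi < θ := by
    refine lt_of_le_of_ne h1 ?_
    rintro rfl
    rw [stretchAngle_neg, stretchAngle_pi] at hθ
    exact absurd hθ (Complex.neg_pi_lt_arg w).ne
  refine ⟨((‖w‖ ^ K : ℝ) : ℂ) * Complex.exp (θ * Complex.I), ?_⟩
  rw [stretchMap_polar K (by positivity) h3 h2, hθ, ← Real.rpow_mul hr.le,
    mul_one_div_cancel (by positivity), Real.rpow_one, Complex.norm_mul_exp_arg_mul_I]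

/-- A continuous bijection that is proper, as `|ρ(z)| = |z|^(1/K) → ∞`, is closed and hence a
homeomorphism. -/
lemma isHomeomorph_stretchMap : IsHomeomorph (stretchMap K) := by
  rw [isHomeomorph_iff_continuous_isClosedMap_bijective]
  refine ⟨continuous_stretchMap hK, ?_, injective_stretchMap hK, surjective_stretchMap hK⟩
  refine IsProperMap.isClosedMap (isProperMap_iff_tendsto_cocompact.2
    ⟨continuous_stretchMap hK, ?_⟩)
  rw [← Metric.cobounded_eq_cocompact, ← tendsto_norm_atTop_iff_cobounded]
  simp only [norm_stretchMap]
  exact (tendsto_rpow_atTop (by positivity)).comp tendsto_norm_cobounded_atTop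

/-! ### Explicit formulas and derivatives in the four sectors -/

omit hK in
lemma abs_arg_le_pi_div_four {z : ℂ} (hz : |z.im| < z.re) : |z.arg| ≤ Real.pi / 4 := by
  by_contra! h
  have h1 : Real.cos |z.arg| < Real.cos (Real.pi / 4) :=
    Real.cos_lt_cos_of_nonneg_of_le_pi (by positivity) (Complex.abs_arg_le_pi z) h
  rw [Real.cos_abs, Real.cos_pi_div_four] at h1
  have hre : 0 < z.re := (abs_nonneg _).trans_lt hz
  have hz0 : z ≠ 0 := by rintro rfl; simp at hre
  have h2 := Complex.norm_mul_cos_arg z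
  have hr : 0 < ‖z‖ := norm_pos_iff.2 hz0
  have h3 : z.re < ‖z‖ * (√2 / 2) := by rw [← h2]; gcongr
  have h4 : z.re ^ 2 < (‖z‖ * (√2 / 2)) ^ 2 := by gcongr
  have h5 : (‖z‖ * (√2 / 2)) ^ 2 = ‖z‖ ^ 2 / 2 := by
    rw [mul_pow, div_pow, Real.sq_sqrt (by norm_num)]; ring
  have h6 : ‖z‖ ^ 2 = z.re ^ 2 + z.im ^ 2 := by
    rw [← Complex.normSq_eq_norm_sq, Complex.normSq_apply]; ring
  have h7 : z.im ^ 2 < z.re ^ 2 := by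
    rw [← sq_abs z.im]; gcongr
  rw [h5, h6] at h4
  linarith

omit hK in
lemma stretchMap_right {z : ℂ} (hz : |z.im| < z.re) :
    stretchMap K z = z ^ ((1 / K : ℝ) : ℂ) := by
  have hre : 0 < z.re := (abs_nonneg _).trans_lt hz
  have hz0 : z ≠ 0 := by rintro rfl; simp at hre
  have hr : 0 < ‖z‖ := norm_pos_iff.2 hz0
  rw [stretchMap, stretchAngle, if_pos (abs_arg_le_pi_div_four hz), Complex.cpow_def_of_ne_zero hz0,
    Complex.log, Real.rpow_def_of_pos hr, Complex.ofReal_exp, ← Complex.exp_add]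
  congr 1
  push_cast
  ring

-- With `w = i z̄ = r e^{i(π/2 - θ)}`, the factor `w^(1/K - 1)` changes the angular slope from `1`
-- to `2 - 1/K` and the radial exponent from `1` to `1/K`. This shape makes the Wirtinger
-- derivatives immediate.
omit hK in
lemma stretchMap_upper {z : ℂ} (hz : |z.re| < z.im) :
    stretchMap K z = z * (Complex.I * (starRingEnd ℂ) z) ^ ((1 / K - 1 : ℝ) : ℂ) := by
  set w := Complex.I * (starRingEnd ℂ) z with hw
  have hwre : w.re = z.im := by simp [hw]
  have hwim : w.im = z.re := by simp [hw]
  have hnorm : ‖w‖ = ‖z‖ := by rw [hw, norm_mul, Complex.norm_I, one_mul, RCLike.norm_conj]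
  have him : 0 < z.im := (abs_nonneg _).trans_lt hz
  have hw0 : w ≠ 0 := by intro h; rw [h] at hwre; simp at hwre; linarith
  have hr : 0 < ‖w‖ := norm_pos_iff.2 hw0
  have harg := abs_arg_le_pi_div_four (z := w) (by rwa [hwre, hwim])
  obtain ⟨a1, a2⟩ := abs_le.1 harg
  have hpi := Real.pi_pos
  have hz1 : z = (‖w‖ : ℂ) * Complex.exp (((Real.pi / 2 - w.arg : ℝ) : ℂ) * Complex.I) := by
    have h1 : z = Complex.I * (starRingEnd ℂ) w := by
      rw [hw, map_mul, Complex.conj_I, Complex.conj_conj]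
      linear_combination z * Complex.I_mul_I
    have h2 : (starRingEnd ℂ) w = (‖w‖ : ℂ) * Complex.exp (-(w.arg * Complex.I)) := by
      conv_lhs => rw [← Complex.norm_mul_exp_arg_mul_I w]
      rw [map_mul, Complex.conj_ofReal, ← Complex.exp_conj, map_mul, Complex.conj_ofReal,
        Complex.conj_I, mul_neg]
    conv_lhs => rw [h1, h2]
    rw [Complex.ofReal_sub, sub_mul, sub_eq_add_neg, Complex.exp_add, Complex.ofReal_div,
      Complex.ofReal_ofNat, Complex.exp_pi_div_two_mul_I]
    ring
  conv_lhs => rw [hz1]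
  rw [stretchMap_polar K hr (by linarith) (by linarith), stretchAngle_eq,
    min_eq_left (by linarith), max_eq_right (by linarith),
    min_eq_left (by linarith), max_eq_left (by linarith)]
  conv_rhs => rw [hz1]
  have hlog : (‖w‖ : ℂ) = Complex.exp (Real.log ‖w‖ : ℝ) := by
    rw [← Complex.ofReal_exp, Real.exp_log hr]
  rw [Complex.cpow_def_of_ne_zero hw0, Complex.log, Real.rpow_def_of_pos hr, Complex.ofReal_exp,
    ← Complex.exp_add]
  conv_rhs => rw [hlog]
  rw [← Complex.exp_add, ← Complex.exp_add]
  congr 1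
  push_cast
  ring

omit hK in
lemma hasFDerivAt_stretchMap_right {z : ℂ} (hz : |z.im| < z.re) :
    HasFDerivAt (stretchMap K)
      (wirtingerCLM ((1 / K : ℝ) * z ^ (((1 / K - 1 : ℝ) : ℂ))) 0) z := by
  have hslit : z ∈ Complex.slitPlane := Or.inl ((abs_nonneg _).trans_lt hz)
  have h1 : HasDerivAt (fun z : ℂ => z ^ ((1 / K : ℝ) : ℂ))
      ((1 / K : ℝ) * z ^ (((1 / K - 1 : ℝ) : ℂ))) z := by
    refine ((hasDerivAt_id z).cpow_const hslit).congr_deriv ?_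
    push_cast
    simp
  refine (hasFDerivAt_of_hasDerivAt h1).congr_of_eventuallyEq ?_
  have : ∀ᶠ v : ℂ in 𝓝 z, |v.im| < v.re :=
    (isOpen_lt Complex.continuous_im.abs Complex.continuous_re).mem_nhds hz
  filter_upwards [this] with v hv using stretchMap_right hv

omit hK in
lemma hasFDerivAt_stretchMap_upper {z : ℂ} (hz : |z.re| < z.im) :
    HasFDerivAt (stretchMap K)
      (wirtingerCLM ((Complex.I * (starRingEnd ℂ) z) ^ ((1 / K - 1 : ℝ) : ℂ))
        (z * ((1 / K - 1 : ℝ) * (Complex.I * (starRingEnd ℂ) z) ^ ((1 / K - 1 - 1 : ℝ) : ℂ) *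
          Complex.I))) z := by
  have hslit : Complex.I * (starRingEnd ℂ) z ∈ Complex.slitPlane :=
    Or.inl (by simpa using (abs_nonneg _).trans_lt hz)
  have h1 : HasDerivAt (fun w : ℂ => (Complex.I * w) ^ ((1 / K - 1 : ℝ) : ℂ))
      ((1 / K - 1 : ℝ) * (Complex.I * (starRingEnd ℂ) z) ^ ((1 / K - 1 - 1 : ℝ) : ℂ) *
          Complex.I) ((starRingEnd ℂ) z) := by
    refine (((hasDerivAt_id _).const_mul Complex.I).cpow_const (by simpa using hslit)).congr_deriv ?_
    push_cast
    simp
  refine (((hasFDerivAt_id z).mul (hasFDerivAt_comp_conj h1)).congr_fderiv ?_).congr_of_eventuallyEq ?_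
  · ext v
    simp
    ring
  have : ∀ᶠ v : ℂ in 𝓝 z, |v.re| < v.im :=
    (isOpen_lt Complex.continuous_re.abs Complex.continuous_im).mem_nhds hz
  filter_upwards [this] with v hv using stretchMap_upper hv

lemma hasFDerivAt_stretchMap_of_neg {z a b : ℂ}
    (h : HasFDerivAt (stretchMap K) (wirtingerCLM a b) (-z)) :
    HasFDerivAt (stretchMap K) (wirtingerCLM a b) z := by
  have : stretchMap K = fun z => -stretchMap K (-z) := by
    ext z; rw [stretchMap_neg hK, neg_neg]
  rw [this]
  refine (h.comp z (hasFDerivAt_id z).fun_neg).fun_neg.congr_fderiv ?_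
  ext v
  simp

/-- Collects all the differential information used later. In the vertical sectors the bound is an
equality, the ratio being `|1/K - 1|` because the exponent of `i z̄` is `1/K - 1`. -/
lemma exists_hasFDerivAt_stretchMap {z : ℂ} (hz : |z.re| ≠ |z.im|) :
    ∃ a b : ℂ, HasFDerivAt (stretchMap K) (wirtingerCLM a b) z ∧ a ≠ 0 ∧
      ‖b‖ ≤ (1 - 1 / K) * ‖a‖ ∧ (|z.im| < |z.re| → b = 0) := by
  have hc1 : 1 / K ≤ 1 := by rw [div_le_one (by positivity)]; exact hK.le
  have hc0 : 0 < 1 / K := by positivity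
  wlog hpos : |z.im| < z.re ∨ |z.re| < z.im generalizing z
  · obtain ⟨a, b, h⟩ := this (z := -z) (by simpa using hz) (by
      simp only [Complex.neg_re, Complex.neg_im, abs_neg]
      push Not at hpos
      rcases lt_or_gt_of_ne hz with h | h
      · right
        rcases abs_cases z.im with h' | h' <;> linarith
      · left
        rcases abs_cases z.re with h' | h' <;> linarith)
    simp only [Complex.neg_re, Complex.neg_im, abs_neg] at h
    exact ⟨a, b, hasFDerivAt_stretchMap_of_neg hK h.1, h.2⟩
  rcases hpos with h | h
  · have hz0 : z ≠ 0 := by rintro rfl; simp at h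
    refine ⟨_, _, hasFDerivAt_stretchMap_right h, ?_, ?_, fun _ => rfl⟩
    · exact mul_ne_zero (by exact_mod_cast hc0.ne') (by simp [Complex.cpow_eq_zero_iff, hz0])
    · rw [norm_zero]
      exact mul_nonneg (by linarith) (norm_nonneg _)
  · have hz0 : z ≠ 0 := by rintro rfl; simp at h
    have hw0 : Complex.I * (starRingEnd ℂ) z ≠ 0 := by simp [hz0]
    have hr : 0 < ‖z‖ := norm_pos_iff.2 hz0
    refine ⟨_, _, hasFDerivAt_stretchMap_upper h, ?_, ?_, fun h' => ?_⟩
    · simp [Complex.cpow_eq_zero_iff, hz0]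
    · simp only [norm_mul, Complex.norm_cpow_real, Complex.norm_I, one_mul, mul_one,
        RCLike.norm_conj, Complex.norm_real]
      rw [Real.rpow_sub_one hr.ne', Real.norm_of_nonpos (by linarith)]
      apply le_of_eq
      field_simp
      ring
    · exact absurd (h'.trans (h.trans_le (le_abs_self _))) (lt_irrefl _)

end stretchMap

/-! ### The diagonals -/

/-- The complement of the two diagonals `|x| = |y|`. -/
def offDiagonal : Set ℂ := {z | |z.re| ≠ |z.im|}

lemma isOpen_offDiagonal : IsOpen offDiagonal :=
  isOpen_ne_fun Complex.continuous_re.abs Complex.continuous_im.abs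

lemma meetsLinesCountably_compl_offDiagonal : MeetsLinesCountably offDiagonalᶜ := by
  have key : ∀ a : ℝ, {x : ℝ | |x| = |a|}.Countable := fun a => by
    refine Set.Countable.mono (s₂ := {a, -a}) (fun x hx => ?_) (Set.toFinite _).countable
    exact abs_eq_abs.1 hx
  constructor
  · refine ae_of_all _ fun y => (key y).mono fun x hx => ?_
    simpa [offDiagonal] using hx
  · refine ae_of_all _ fun x => (key x).mono fun y hy => ?_
    simpa [offDiagonal, eq_comm] using hy

lemma ae_mem_offDiagonal : ∀ᵐ z : ℂ, z ∈ offDiagonal := by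
  have key : ∀ c : ℝ, ∀ᵐ z : ℂ, z.re + c * z.im ≠ 0 := by
    intro c
    have h := Measure.addHaar_submodule (volume : Measure ℂ)
      (LinearMap.ker (Complex.reLm + c • Complex.imLm)) (by
        intro h
        have : (1 : ℂ) ∈ LinearMap.ker (Complex.reLm + c • Complex.imLm) := by
          rw [h]; trivial
        simp at this)
    filter_upwards [measure_eq_zero_iff_ae_notMem.1 h] with z hz h'
    exact hz (by simpa using h')
  filter_upwards [key 1, key (-1)] with z h1 h2 h
  rcases abs_eq_abs.1 h with h | h
  · exact h2 (by rw [h]; ring)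
  · exact h1 (by rw [h]; ring)

/-! ### Norms in `L²` -/

lemma eLpNorm_two_sq {α : Type*} [MeasurableSpace α] {ν : Measure α} (f : α → ℂ) :
    eLpNorm f 2 ν ^ 2 = ∫⁻ x, ‖f x‖ₑ ^ 2 ∂ν := by
  rw [eLpNorm_eq_lintegral_rpow_enorm_toReal (by norm_num) (by norm_num), ← ENNReal.rpow_natCast,
    ← ENNReal.rpow_mul]
  simp

lemma eLpNorm_two_le {α : Type*} [MeasurableSpace α] {ν : Measure α} {f g : α → ℂ} {C : ℝ≥0}
    (h : ∫⁻ x, ‖f x‖ₑ ^ 2 ∂ν ≤ C ^ 2 * ∫⁻ x, ‖g x‖ₑ ^ 2 ∂ν) :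
    eLpNorm f 2 ν ≤ C * eLpNorm g 2 ν := by
  rw [← eLpNorm_two_sq, ← eLpNorm_two_sq, ← mul_pow] at h
  exact (ENNReal.pow_le_pow_left_iff two_ne_zero).1 h

lemma memLp_two_iff {α : Type*} [MeasurableSpace α] {ν : Measure α} {f : α → ℂ}
    (hf : AEStronglyMeasurable f ν) : MemLp f 2 ν ↔ ∫⁻ x, ‖f x‖ₑ ^ 2 ∂ν < ⊤ := by
  rw [← eLpNorm_two_sq]
  refine ⟨fun h => ENNReal.pow_lt_top h.2, fun h => ⟨hf, ?_⟩⟩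
  by_contra h'
  rw [not_lt, top_le_iff] at h'
  simp [h'] at h

/-! ### Change of variables by the stretch map -/

section stretchMap

variable {K : ℝ} (hK : 1 < K)

include hK

lemma differentiableAt_stretchMap {z : ℂ} (hz : z ∈ offDiagonal) :
    DifferentiableAt ℝ (stretchMap K) z :=
  let ⟨_, _, h, _⟩ := exists_hasFDerivAt_stretchMap hK hz
  h.differentiableAt

lemma dz_stretchMap_ne_zero {z : ℂ} (hz : z ∈ offDiagonal) : dz (stretchMap K) z ≠ 0 := by
  obtain ⟨a, b, h, h1, h2⟩ := exists_hasFDerivAt_stretchMap hK hz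
  rwa [h.dz_eq]

lemma norm_dzbar_stretchMap_le {z : ℂ} (hz : z ∈ offDiagonal) :
    ‖dzbar (stretchMap K) z‖ ≤ (1 - 1 / K) * ‖dz (stretchMap K) z‖ := by
  obtain ⟨a, b, h, h1, h2, h3⟩ := exists_hasFDerivAt_stretchMap hK hz
  rwa [h.dz_eq, h.dzbar_eq]

lemma dzbar_stretchMap_eq_zero {z : ℂ} (hz : |z.im| < |z.re|) : dzbar (stretchMap K) z = 0 := by
  obtain ⟨a, b, h, h1, h2, h3⟩ := exists_hasFDerivAt_stretchMap hK hz.ne'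
  rw [h.dzbar_eq, h3 hz]

lemma dilatation_bound_nonneg : 0 ≤ 1 - 1 / K := by
  rw [sub_nonneg, div_le_one (by positivity)]; exact hK.le

omit hK in
lemma dilatation_bound_lt_one (hK : 1 < K) : 1 - 1 / K < 1 := by
  have : 0 < 1 / K := by positivity
  linarith

lemma one_sub_dilatation_bound_sq_pos : 0 < 1 - (1 - 1 / K) ^ 2 := by
  have h0 := dilatation_bound_nonneg hK
  have h1 := dilatation_bound_lt_one hK
  nlinarith

lemma lintegral_image_stretchMap (F : ℂ → ℝ≥0∞) :
    ∫⁻ w in stretchMap K '' offDiagonal, F w = ∫⁻ z,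
      ENNReal.ofReal (‖dz (stretchMap K) z‖ ^ 2 - ‖dzbar (stretchMap K) z‖ ^ 2) *
        F (stretchMap K z) := by
  rw [lintegral_image_eq_lintegral_abs_det_fderiv_mul volume isOpen_offDiagonal.measurableSet
    (fun z hz => (hasFDerivAt_wirtinger (differentiableAt_stretchMap hK hz)).hasFDerivWithinAt)
    (injective_stretchMap hK).injOn]
  have hr : (volume : Measure ℂ).restrict offDiagonal = volume :=
    Measure.restrict_eq_self_of_ae_mem ae_mem_offDiagonal
  rw [hr]
  apply lintegral_congr_ae
  filter_upwards [ae_mem_offDiagonal] with z hz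
  rw [det_wirtingerCLM, abs_of_nonneg]
  rw [sub_nonneg]
  have h := norm_dzbar_stretchMap_le hK hz
  have h1 := dilatation_bound_lt_one hK
  gcongr
  exact h.trans (mul_le_of_le_one_left (norm_nonneg _) h1.le)

/-- The Jacobian `|∂ρ|² - |∂̄ρ|²` is at least `(1 - k²) |∂ρ|²` with `k = 1 - 1/K`. -/
lemma lintegral_comp_stretchMap_le (F : ℂ → ℝ≥0∞) :
    ∫⁻ z, ‖dz (stretchMap K) z‖ₑ ^ 2 * F (stretchMap K z) ≤
      ENNReal.ofReal (1 - (1 - 1 / K) ^ 2)⁻¹ * ∫⁻ w, F w := by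
  have hpos := one_sub_dilatation_bound_sq_pos hK
  calc _ ≤ ∫⁻ z, ENNReal.ofReal (1 - (1 - 1 / K) ^ 2)⁻¹ *
      (ENNReal.ofReal (‖dz (stretchMap K) z‖ ^ 2 - ‖dzbar (stretchMap K) z‖ ^ 2) *
        F (stretchMap K z)) := by
        apply lintegral_mono_ae
        filter_upwards [ae_mem_offDiagonal] with z hz
        rw [← mul_assoc, ← ENNReal.ofReal_mul (by positivity), ← ofReal_norm,
          ← ENNReal.ofReal_pow (norm_nonneg _)]
        gcongr
        rw [inv_mul_eq_div, le_div_iff₀ hpos]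
        have h := norm_dzbar_stretchMap_le hK hz
        have : ‖dzbar (stretchMap K) z‖ ^ 2 ≤ ((1 - 1 / K) * ‖dz (stretchMap K) z‖) ^ 2 := by
          gcongr
        linarith
    _ = ENNReal.ofReal (1 - (1 - 1 / K) ^ 2)⁻¹ * ∫⁻ w in stretchMap K '' offDiagonal, F w := by
        rw [lintegral_const_mul' _ _ ENNReal.ofReal_ne_top, lintegral_image_stretchMap hK]
    _ ≤ _ := by gcongr; exact Measure.restrict_le_self

/-- The reverse estimate uses only that the Jacobian is at most `|∂ρ|²`. The vanishing hypothesis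
avoids having to know that the diagonals have null image. -/
lemma lintegral_le_comp_stretchMap {F : ℂ → ℝ≥0∞}
    (hF : ∀ z, z ∉ offDiagonal → F (stretchMap K z) = 0) :
    ∫⁻ w, F w ≤ ∫⁻ z, ‖dz (stretchMap K) z‖ₑ ^ 2 * F (stretchMap K z) := by
  have h : ∫⁻ w, F w = ∫⁻ w in stretchMap K '' offDiagonal, F w := by
    rw [setLIntegral_eq_of_support_subset]
    intro w hw
    obtain ⟨z, rfl⟩ := surjective_stretchMap hK w
    by_contra hz
    exact hw (hF z fun h => hz ⟨z, h, rfl⟩)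
  rw [h, lintegral_image_stretchMap hK]
  gcongr with z
  rw [← ofReal_norm, ← ENNReal.ofReal_pow (norm_nonneg _)]
  gcongr
  linarith [sq_nonneg ‖dzbar (stretchMap K) z‖]

/-- For a null set `E`, the integral of `|∂ρ|²` over its preimage is zero, while `∂ρ` vanishes
nowhere off the diagonals. -/
lemma quasiMeasurePreserving_stretchMap : Measure.QuasiMeasurePreserving (stretchMap K) := by
  refine ⟨(continuous_stretchMap hK).measurable, Measure.AbsolutelyContinuous.mk fun E hE h0 => ?_⟩
  rw [Measure.map_apply (continuous_stretchMap hK).measurable hE]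
  have h := lintegral_comp_stretchMap_le hK (E.indicator 1)
  rw [lintegral_indicator_one hE, h0, mul_zero, nonpos_iff_eq_zero, lintegral_eq_zero_iff
    (f := fun z => ‖dz (stretchMap K) z‖ₑ ^ 2 * E.indicator 1 (stretchMap K z))
    (((measurable_dz _).enorm.pow_const 2).mul
      ((measurable_one.indicator hE).comp (continuous_stretchMap hK).measurable))] at h
  rw [measure_eq_zero_iff_ae_notMem]
  filter_upwards [h, ae_mem_offDiagonal] with z hz hs hzE
  have h1 : stretchMap K z ∈ E := hzE
  have h2 := dz_stretchMap_ne_zero hK hs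
  simp [h1, h2] at hz

/-! ### Quasiconformality -/

/-- The integral of `|∂ρ|²` over `s` is at most a constant times the area of the compact set `ρ(s)`.
-/
lemma memLp_dz_stretchMap {s : Set ℂ} (hs : IsCompact s) :
    MemLp (dz (stretchMap K)) 2 (volume.restrict s) := by
  rw [memLp_two_iff (measurable_dz _).aestronglyMeasurable]
  have hs' : IsCompact (stretchMap K '' s) := hs.image (continuous_stretchMap hK)
  have h := lintegral_comp_stretchMap_le hK ((stretchMap K '' s).indicator 1)
  rw [lintegral_indicator_one hs'.measurableSet] at h
  refine lt_of_le_of_lt ?_ (h.trans_lt (ENNReal.mul_lt_top ENNReal.ofReal_lt_top hs'.measure_lt_top))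
  rw [← lintegral_indicator hs.measurableSet]
  gcongr with z
  by_cases hz : z ∈ s
  · rw [Set.indicator_of_mem hz, Set.indicator_of_mem (Set.mem_image_of_mem _ hz)]
    simp
  · simp [hz]

lemma memLp_dzbar_stretchMap {s : Set ℂ} (hs : IsCompact s) :
    MemLp (dzbar (stretchMap K)) 2 (volume.restrict s) := by
  refine (memLp_dz_stretchMap hK hs).of_le (measurable_dzbar _).aestronglyMeasurable
    (ae_restrict_of_ae ?_)
  filter_upwards [ae_mem_offDiagonal] with z hz
  exact (norm_dzbar_stretchMap_le hK hz).trans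
    (mul_le_of_le_one_left (norm_nonneg _) (dilatation_bound_lt_one hK).le)

lemma hasWeakWirtinger_stretchMap :
    HasWeakWirtinger (stretchMap K) (dz (stretchMap K)) (dzbar (stretchMap K)) :=
  hasWeakWirtinger_of_differentiableAt meetsLinesCountably_compl_offDiagonal
    (continuous_stretchMap hK)
    (fun _ hz => differentiableAt_stretchMap hK (Set.notMem_compl_iff.1 hz))
    (fun _ hs => memLp_dz_stretchMap hK hs) (fun _ hs => memLp_dzbar_stretchMap hK hs)

theorem isQuasiconformal_stretchMap : IsQuasiconformal (stretchMap K) :=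
  ⟨isHomeomorph_stretchMap hK, _, _, hasWeakWirtinger_stretchMap hK, 1 - 1 / K,
    dilatation_bound_nonneg hK, dilatation_bound_lt_one hK,
    ae_mem_offDiagonal.mono fun _ hz => norm_dzbar_stretchMap_le hK hz⟩

/-- Along the positive axis `|ρ(x)|/x = x^(1/K - 1)` is unbounded as `x → 0`. -/
theorem not_isBilipschitz_stretchMap : ¬ IsBilipschitz (stretchMap K) := by
  rintro ⟨C, hC, h⟩
  have hc : 1 / K - 1 < 0 := by
    rw [sub_neg, div_lt_one (by positivity)]; exact hK
  have hlim : Tendsto (fun x : ℝ => x ^ (1 / K - 1)) (𝓝[>] 0) atTop :=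
    tendsto_rpow_neg_nhdsGT_zero hc
  obtain ⟨x, hx1, hx0⟩ := ((hlim.eventually_gt_atTop C).and self_mem_nhdsWithin).exists
  have hx0' : (0 : ℝ) < x := hx0
  have h1 := (h x 0).2
  rw [stretchMap_zero hK, sub_zero, sub_zero, norm_stretchMap, Complex.norm_real,
    Real.norm_of_nonneg hx0'.le] at h1
  rw [Real.rpow_sub_one hx0'.ne', lt_div_iff₀ hx0'] at hx1
  linarith

theorem stretchMap_ofReal (x : ℝ) :
    stretchMap K x = ((Real.sign x * |x| ^ (1 / K) : ℝ) : ℂ) := by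
  have hpos : ∀ x : ℝ, 0 < x → stretchMap K x = ((|x| ^ (1 / K) : ℝ) : ℂ) := by
    intro x hx
    rw [stretchMap, Complex.arg_ofReal_of_nonneg hx.le, Complex.norm_real, Real.norm_eq_abs,
      stretchAngle_eq]
    have := Real.pi_pos
    simp
  rcases lt_trichotomy x 0 with h | rfl | h
  · have h1 := hpos (-x) (by linarith)
    rw [Complex.ofReal_neg, stretchMap_neg hK, abs_neg] at h1
    rw [Real.sign_of_neg h, neg_one_mul, Complex.ofReal_neg, ← h1, neg_neg]
  · simp [stretchMap_zero hK]
  · rw [Real.sign_of_pos h, one_mul, hpos x h]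

end stretchMap

/-! ### Conjugation of the Beurling transform by the stretch map -/

/-- The operator `f ↦ (f ∘ ρ) d`. -/
def compMul (ρ d : ℂ → ℂ) : (ℂ → ℂ) →ₗ[ℂ] (ℂ → ℂ) where
  toFun f z := f (ρ z) * d z
  map_add' f g := by ext; simp [add_mul]
  map_smul' c f := by ext; simp [mul_assoc]

section stretchMap

variable {K : ℝ} (hK : 1 < K)

/-- The square root of `(1 - k²)⁻¹`, with `k = 1 - 1 / K`. -/
def distortionConst (K : ℝ) : ℝ≥0 := Real.toNNReal √(1 - (1 - 1 / K) ^ 2)⁻¹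

include hK

lemma distortionConst_sq :
    (distortionConst K : ℝ≥0∞) ^ 2 = ENNReal.ofReal (1 - (1 - 1 / K) ^ 2)⁻¹ := by
  have := one_sub_dilatation_bound_sq_pos hK
  change ENNReal.ofReal √(1 - (1 - 1 / K) ^ 2)⁻¹ ^ 2 = _
  rw [← ENNReal.ofReal_pow (Real.sqrt_nonneg _), Real.sq_sqrt (by positivity)]

lemma lintegral_compMul_le {d : ℂ → ℂ}
    (hd : ∀ z ∈ offDiagonal, ‖d z‖ ≤ ‖dz (stretchMap K) z‖) (f : ℂ → ℂ) :
    ∫⁻ z, ‖compMul (stretchMap K) d f z‖ₑ ^ 2 ≤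
      (distortionConst K : ℝ≥0∞) ^ 2 * ∫⁻ w, ‖f w‖ₑ ^ 2 := by
  rw [distortionConst_sq hK]
  refine le_trans ?_ (lintegral_comp_stretchMap_le hK fun w => ‖f w‖ₑ ^ 2)
  apply lintegral_mono_ae
  filter_upwards [ae_mem_offDiagonal] with z hz
  change ‖f (stretchMap K z) * d z‖ₑ ^ 2 ≤ _
  rw [enorm_mul, mul_pow, mul_comm]
  gcongr
  exact enorm_le_iff_norm_le.2 (hd z hz)

lemma memLp_compMul {d : ℂ → ℂ} (hdm : Measurable d)
    (hd : ∀ z ∈ offDiagonal, ‖d z‖ ≤ ‖dz (stretchMap K) z‖) (f : ℂ → ℂ) (hf : MemLp f 2) :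
    MemLp (compMul (stretchMap K) d f) 2 := by
  have hm : AEStronglyMeasurable (compMul (stretchMap K) d f) volume :=
    (hf.1.comp_quasiMeasurePreserving (quasiMeasurePreserving_stretchMap hK)).mul
      hdm.aestronglyMeasurable
  rw [memLp_two_iff hm]
  refine (lintegral_compMul_le hK hd f).trans_lt (ENNReal.mul_lt_top (by finiteness) ?_)
  exact (memLp_two_iff hf.1).1 hf

/-- The operator `f ↦ (f ∘ ρ) d` on `L²`, for the stretch map `ρ` and `|d| ≤ |∂ρ|`. -/
def compMulL2 {d : ℂ → ℂ} (hdm : Measurable d)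
    (hd : ∀ z ∈ offDiagonal, ‖d z‖ ≤ ‖dz (stretchMap K) z‖) :
    Lp ℂ 2 (volume : Measure ℂ) →L[ℂ] Lp ℂ 2 (volume : Measure ℂ) :=
  lpOp (compMul (stretchMap K) d) (distortionConst K)
    (fun f g h => by
      filter_upwards [(quasiMeasurePreserving_stretchMap hK).ae h] with z hz
      simp [compMul, hz])
    (memLp_compMul hK hdm hd)
    (fun f _ => eLpNorm_two_le (lintegral_compMul_le hK hd f))

lemma coeFn_compMulL2 {d : ℂ → ℂ} (hdm : Measurable d)
    (hd : ∀ z ∈ offDiagonal, ‖d z‖ ≤ ‖dz (stretchMap K) z‖) (f : Lp ℂ 2 (volume : Measure ℂ)) :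
    compMulL2 hK hdm hd f =ᵐ[volume] fun z => f (stretchMap K z) * d z :=
  lpOp_coeFn _ _ _ _ _ f

lemma norm_dzbar_stretchMap_le_dz : ∀ z ∈ offDiagonal,
    ‖dzbar (stretchMap K) z‖ ≤ ‖dz (stretchMap K) z‖ := fun _ hz =>
  (norm_dzbar_stretchMap_le hK hz).trans
    (mul_le_of_le_one_left (norm_nonneg _) (dilatation_bound_lt_one hK).le)

omit hK in
lemma measurable_conj_comp {d : ℂ → ℂ} (h : Measurable d) :
    Measurable fun z => (starRingEnd ℂ) (d z) := Complex.continuous_conj.measurable.comp h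

/-- The operator sending `Ψ = ∂̄v` to `∂̄(v ∘ ρ)`. -/
def pullDzbar : Lp ℂ 2 (volume : Measure ℂ) →L[ℂ] Lp ℂ 2 (volume : Measure ℂ) :=
  (compMulL2 hK (measurable_dzbar _) (norm_dzbar_stretchMap_le_dz hK)).comp
      beurlingL2.toContinuousLinearMap +
    compMulL2 hK (measurable_conj_comp (measurable_dz _)) (fun z _ => by rw [RCLike.norm_conj])

/-- The operator sending `Ψ = ∂̄v` to `∂(v ∘ ρ)`. -/
def pullDz : Lp ℂ 2 (volume : Measure ℂ) →L[ℂ] Lp ℂ 2 (volume : Measure ℂ) :=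
  (compMulL2 hK (measurable_dz _) (fun _ _ => le_rfl)).comp beurlingL2.toContinuousLinearMap +
    compMulL2 hK (measurable_conj_comp (measurable_dzbar _))
      (fun z hz => by rw [RCLike.norm_conj]; exact norm_dzbar_stretchMap_le_dz hK z hz)

lemma coeFn_pullDzbar (f : Lp ℂ 2 (volume : Measure ℂ)) :
    pullDzbar hK f =ᵐ[volume] fun z => beurlingL2 f (stretchMap K z) * dzbar (stretchMap K) z +
      f (stretchMap K z) * (starRingEnd ℂ) (dz (stretchMap K) z) := by
  refine (Lp.coeFn_add _ _).trans ?_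
  exact (coeFn_compMulL2 hK (measurable_dzbar _) (norm_dzbar_stretchMap_le_dz hK)
    (beurlingL2 f)).add (coeFn_compMulL2 hK _ _ f)

lemma coeFn_pullDz (f : Lp ℂ 2 (volume : Measure ℂ)) :
    pullDz hK f =ᵐ[volume] fun z => beurlingL2 f (stretchMap K z) * dz (stretchMap K) z +
      f (stretchMap K z) * (starRingEnd ℂ) (dzbar (stretchMap K) z) := by
  refine (Lp.coeFn_add _ _).trans ?_
  exact (coeFn_compMulL2 hK (measurable_dz _) (fun _ _ => le_rfl)
    (beurlingL2 f)).add (coeFn_compMulL2 hK _ _ f)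

/-- For `Ψ = ∂̄φ` the chain rule identifies the two sides with the Wirtinger derivatives of `φ ∘ ρ`,
a curl-free pair in `L²`. -/
lemma beurlingL2_pullDzbar_of_testFunction {φ : ℂ → ℝ} (hφ : ContDiff ℝ ∞ φ)
    (hc : HasCompactSupport φ) :
    beurlingL2 (pullDzbar hK (memLp_dzbar_ofReal hφ hc).toLp) =
      pullDz hK (memLp_dzbar_ofReal hφ hc).toLp := by
  set f := (memLp_dzbar_ofReal hφ hc).toLp
  set u : ℂ → ℂ := fun z => (φ (stretchMap K z) : ℂ) with hu
  have hder : ∀ z ∈ offDiagonal, HasFDerivAt u ((wirtingerCLM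
      (dz (fun z => (φ z : ℂ)) (stretchMap K z)) (dzbar (fun z => (φ z : ℂ)) (stretchMap K z))).comp
      (wirtingerCLM (dz (stretchMap K) z) (dzbar (stretchMap K) z))) z := fun z hz =>
    (hasFDerivAt_wirtinger ((Complex.ofRealCLM.contDiff.comp hφ).differentiable
      (by simp) _)).comp z (hasFDerivAt_wirtinger (differentiableAt_stretchMap hK hz))
  have h1 : ∀ᵐ z, beurlingL2 f (stretchMap K z) = dz (fun z => (φ z : ℂ)) (stretchMap K z) := by
    refine (quasiMeasurePreserving_stretchMap hK).ae
      (p := fun w => beurlingL2 f w = dz (fun z => (φ z : ℂ)) w) ?_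
    rw [beurlingL2_dzbar_ofReal hφ hc]
    exact (memLp_dz_ofReal hφ hc).coeFn_toLp
  have h2 : ∀ᵐ z, f (stretchMap K z) = dzbar (fun z => (φ z : ℂ)) (stretchMap K z) :=
    (quasiMeasurePreserving_stretchMap hK).ae (memLp_dzbar_ofReal hφ hc).coeFn_toLp
  have e1 : pullDzbar hK f =ᵐ[volume] dzbar u := by
    filter_upwards [coeFn_pullDzbar hK f, h1, h2, ae_mem_offDiagonal] with z k k1 k2 hz
    have := hder z hz
    rw [wirtingerCLM_comp] at this
    rw [k, k1, k2, this.dzbar_eq]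
  have e2 : pullDz hK f =ᵐ[volume] dz u := by
    filter_upwards [coeFn_pullDz hK f, h1, h2, ae_mem_offDiagonal] with z k k1 k2 hz
    have := hder z hz
    rw [wirtingerCLM_comp] at this
    rw [k, k1, k2, this.dz_eq]
  have m1 : MemLp (dzbar u) 2 := (memLp_congr_ae e1).1 (Lp.memLp _)
  have m2 : MemLp (dz u) 2 := (memLp_congr_ae e2).1 (Lp.memLp _)
  have hw : HasWeakWirtinger u (dz u) (dzbar u) :=
    hasWeakWirtinger_of_differentiableAt meetsLinesCountably_compl_offDiagonal
      (Complex.continuous_ofReal.comp (hφ.continuous.comp (continuous_stretchMap hK)))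
      (fun z hz => (hder z (Set.notMem_compl_iff.1 hz)).differentiableAt)
      (fun s _ => m2.restrict s) (fun s _ => m1.restrict s)
  exact (hw.curlFree.congr e2.symm e1.symm).beurlingL2_eq

/-- Both sides are bounded operators that agree on the dense span of the functions `∂̄φ`. No
potential `v` of a general `f` is ever needed. -/
theorem beurlingL2_pullDzbar (f : Lp ℂ 2 (volume : Measure ℂ)) :
    beurlingL2 (pullDzbar hK f) = pullDz hK f := by
  have h : beurlingL2.toContinuousLinearMap.comp (pullDzbar hK) = pullDz hK := by
    refine ContinuousLinearMap.ext_on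
      (Submodule.dense_iff_topologicalClosure_eq_top.2 span_dzbar_dense) ?_
    rintro _ ⟨φ, hφ, hc, rfl⟩
    exact beurlingL2_pullDzbar_of_testFunction hK hφ hc
  exact congrArg (fun L => L f) h

end stretchMap

/-! ### The weight `1 / |y|` -/

lemma measurable_weight : Measurable fun z : ℂ => (ENNReal.ofReal |z.im|)⁻¹ :=
  (Complex.measurable_im.abs.ennreal_ofReal).inv

/-- The density vanishes nowhere, being infinite on the real line. -/
lemma volume_absolutelyContinuous_weightMeasure : (volume : Measure ℂ) ≪ weightMeasure :=
  withDensity_absolutelyContinuous' measurable_weight.aemeasurable (by simp)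

lemma weightMeasure_absolutelyContinuous_volume : weightMeasure ≪ (volume : Measure ℂ) :=
  withDensity_absolutelyContinuous _ _

lemma lintegral_weightMeasure {F : ℂ → ℝ≥0∞} (hF : AEMeasurable F) :
    ∫⁻ z, F z ∂weightMeasure = ∫⁻ z, (ENNReal.ofReal |z.im|)⁻¹ * F z :=
  lintegral_withDensity_eq_lintegral_mul₀ measurable_weight.aemeasurable hF

/-- On a support contained in the disc of radius `R` one has `1 ≤ R/|y|`. -/
lemma memLp_volume_of_weightMeasure {f : ℂ → ℂ} (hf : MemLp f 2 weightMeasure)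
    (hc : HasCompactSupport f) : MemLp f 2 := by
  have hm : AEStronglyMeasurable f volume := hf.1.mono_ac volume_absolutelyContinuous_weightMeasure
  rw [memLp_two_iff hm]
  have h := (memLp_two_iff hf.1).1 hf
  rw [lintegral_weightMeasure (hm.enorm.pow_const 2)] at h
  obtain ⟨R, hR0, hR⟩ := hc.isCompact.isBounded.subset_closedBall_lt 0 0
  refine lt_of_le_of_lt ?_ (ENNReal.mul_lt_top (a := ENNReal.ofReal R) ENNReal.ofReal_lt_top h)
  rw [← lintegral_const_mul' _ _ ENNReal.ofReal_ne_top]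
  apply lintegral_mono
  intro z
  by_cases hz : f z = 0
  · simp [hz]
  have hzR : ‖z‖ ≤ R := by simpa using hR (subset_tsupport f hz)
  have h1 : |z.im| ≤ R := (Complex.abs_im_le_norm z).trans hzR
  have h2 : 1 ≤ ENNReal.ofReal R * (ENNReal.ofReal |z.im|)⁻¹ := by
    rw [← div_eq_mul_inv, ENNReal.le_div_iff_mul_le (Or.inr (by simpa using hR0)) (Or.inl (by simp)),
      one_mul]
    exact ENNReal.ofReal_le_ofReal h1
  calc ‖f z‖ₑ ^ 2 = 1 * ‖f z‖ₑ ^ 2 := (one_mul _).symm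
    _ ≤ ENNReal.ofReal R * (ENNReal.ofReal |z.im|)⁻¹ * ‖f z‖ₑ ^ 2 := by gcongr
    _ = _ := mul_assoc _ _ _

/-- The radial weight `1 / |z|` is at most `1 / |y|`. -/
lemma radial_weight_le (z : ℂ) : ‖((‖z‖ ^ (-(1 / 2) : ℝ) : ℝ) : ℂ)‖ₑ ^ 2 ≤ (ENNReal.ofReal |z.im|)⁻¹ := by
  rcases eq_or_ne z.im 0 with h0 | h0
  · simp [h0]
  have hpos : 0 < |z.im| := abs_pos.2 h0
  have hz : 0 < ‖z‖ := hpos.trans_le (Complex.abs_im_le_norm z)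
  rw [← ofReal_norm, ← ENNReal.ofReal_pow (norm_nonneg _), Complex.norm_real,
    Real.norm_of_nonneg (by positivity), ← Real.rpow_natCast, ← Real.rpow_mul hz.le,
    ← ENNReal.ofReal_inv_of_pos hpos]
  apply ENNReal.ofReal_le_ofReal
  norm_num
  rw [Real.rpow_neg_one]
  exact inv_anti₀ hpos (Complex.abs_im_le_norm z)

/-- Off the sectors `|y| ≤ |x|` the weight `1 / |y|` is comparable to `1 / |z|`. -/
lemma weight_le_radial {z : ℂ} (hz : |z.re| < |z.im|) :
    (ENNReal.ofReal |z.im|)⁻¹ ≤ 2 * ‖((‖z‖ ^ (-(1 / 2) : ℝ) : ℝ) : ℂ)‖ₑ ^ 2 := by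
  have hpos : 0 < |z.im| := (abs_nonneg _).trans_lt hz
  have hz' : 0 < ‖z‖ := hpos.trans_le (Complex.abs_im_le_norm z)
  rw [← ofReal_norm, ← ENNReal.ofReal_pow (norm_nonneg _), Complex.norm_real,
    Real.norm_of_nonneg (by positivity), ← Real.rpow_natCast, ← Real.rpow_mul hz'.le,
    ← ENNReal.ofReal_inv_of_pos hpos, ← ENNReal.ofReal_ofNat, ← ENNReal.ofReal_mul (by norm_num)]
  apply ENNReal.ofReal_le_ofReal
  norm_num
  rw [Real.rpow_neg_one, ← div_eq_mul_inv, inv_eq_one_div, div_le_div_iff₀ hpos hz']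
  linarith [Complex.norm_le_abs_re_add_abs_im z]

/-! ### The dilatation of the stretch map -/

/-- The complex dilatation of the stretch map. -/
def stretchDilatation (K : ℝ) (z : ℂ) : ℂ := dzbar (stretchMap K) z / dz (stretchMap K) z

lemma measurable_stretchDilatation (K : ℝ) : Measurable (stretchDilatation K) :=
  (measurable_dzbar _).div (measurable_dz _)

lemma lintegral_complex_eq {F : ℂ → ℝ≥0∞} (hF : Measurable F) :
    ∫⁻ z, F z = ∫⁻ y : ℝ, ∫⁻ x : ℝ, F (x + y * Complex.I) := by
  rw [← (Complex.volume_preserving_equiv_real_prod.symm).lintegral_comp_emb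
    Complex.measurableEquivRealProd.symm.measurableEmbedding, Measure.volume_eq_prod,
    lintegral_prod_symm' (fun p => F (Complex.measurableEquivRealProd.symm p))
      (hF.comp Complex.measurableEquivRealProd.symm.measurable)]
  congr 1; ext y; congr 1; ext x; congr 1
  apply Complex.ext <;> simp

section stretchMap

variable {K : ℝ} (hK : 1 < K)

include hK

lemma dzbar_stretchMap_eq {z : ℂ} (hz : z ∈ offDiagonal) :
    dzbar (stretchMap K) z = stretchDilatation K z * dz (stretchMap K) z :=
  (div_mul_cancel₀ _ (dz_stretchMap_ne_zero hK hz)).symm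

lemma norm_stretchDilatation_le {z : ℂ} (hz : z ∈ offDiagonal) :
    ‖stretchDilatation K z‖ ≤ 1 - 1 / K := by
  rw [stretchDilatation, norm_div, div_le_iff₀ (norm_pos_iff.2 (dz_stretchMap_ne_zero hK hz))]
  exact norm_dzbar_stretchMap_le hK hz

lemma enorm_stretchDilatation_le_one {z : ℂ} (hz : z ∈ offDiagonal) :
    ‖stretchDilatation K z‖ₑ ≤ 1 := by
  rw [← ofReal_norm, ENNReal.ofReal_le_one]
  exact (norm_stretchDilatation_le hK hz).trans (dilatation_bound_lt_one hK).le

lemma abs_re_lt_abs_im_of_dilatation_ne_zero {z : ℂ} (hz : z ∈ offDiagonal)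
    (h : stretchDilatation K z ≠ 0) : |z.re| < |z.im| := by
  refine lt_of_le_of_ne (not_lt.1 fun h' => h ?_) hz
  rw [stretchDilatation, dzbar_stretchMap_eq_zero hK h', zero_div]

lemma isComplexDilatation_stretchMap : IsComplexDilatation (stretchMap K) (stretchDilatation K) :=
  ⟨_, _, hasWeakWirtinger_stretchMap hK, ae_of_all _ fun _ => rfl⟩

/-- The measure is dominated by `dm/|y|` on the truncated double sector `|x| < |y| ≤ R`. -/
theorem isCarleson_dilatationMeasure : IsCarleson (dilatationMeasure (stretchDilatation K)) := by
  refine ⟨4, fun x R hR => ?_⟩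
  have hms : MeasurableSet (Metric.closedBall (x : ℂ) R) := Metric.isClosed_closedBall.measurableSet
  have hμ : Measurable fun z => ‖stretchDilatation K z‖ₑ ^ 2 :=
    (measurable_stretchDilatation K).enorm.pow_const 2
  set T : Set ℂ := {z | |z.re| < |z.im| ∧ |z.im| ≤ R} with hT
  have hTm : MeasurableSet T :=
    (measurableSet_lt Complex.measurable_re.abs Complex.measurable_im.abs).inter
      (measurableSet_le Complex.measurable_im.abs measurable_const)
  rw [dilatationMeasure, withDensity_apply _ hms, ← lintegral_indicator hms,
    lintegral_weightMeasure (hμ.indicator hms).aemeasurable]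
  calc _ ≤ ∫⁻ z, T.indicator (fun z : ℂ => (ENNReal.ofReal |z.im|)⁻¹) z := by
        apply lintegral_mono_ae
        filter_upwards [ae_mem_offDiagonal] with z hz
        by_cases h : z ∈ Metric.closedBall (x : ℂ) R
        swap
        · simp [h]
        by_cases h0 : stretchDilatation K z = 0
        · simp [h0, Set.indicator]
        have hzT : z ∈ T := by
          refine ⟨abs_re_lt_abs_im_of_dilatation_ne_zero hK hz h0, ?_⟩
          rw [Metric.mem_closedBall, dist_eq_norm] at h
          simpa using (Complex.abs_im_le_norm (z - x)).trans h
        rw [Set.indicator_of_mem h, Set.indicator_of_mem hzT]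
        exact mul_le_of_le_one_right' (pow_le_one' (enorm_stretchDilatation_le_one hK hz) 2)
    _ = ∫⁻ y : ℝ, ∫⁻ x : ℝ, T.indicator (fun z : ℂ => (ENNReal.ofReal |z.im|)⁻¹)
          (x + y * Complex.I) := lintegral_complex_eq (measurable_weight.indicator hTm)
    -- The slice at height `y` has length `2|y|` and density `1/|y|`, hence mass `2`; heights range
    -- over an interval of length `2R`, which gives `4R`.
    _ ≤ ∫⁻ y : ℝ, (Set.Icc (-R) R).indicator (fun _ => 2) y := by
        gcongr with y
        by_cases hy : |y| ≤ R ∧ y ≠ 0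
        · have hy0 : 0 < |y| := abs_pos.2 hy.2
          have h1 : ∀ x : ℝ, T.indicator (fun z : ℂ => (ENNReal.ofReal |z.im|)⁻¹)
              (x + y * Complex.I) = (Set.Ioo (-|y|) |y|).indicator
                (fun _ => (ENNReal.ofReal |y|)⁻¹) x := by
            intro x
            have : ((x : ℂ) + y * Complex.I ∈ T) ↔ x ∈ Set.Ioo (-|y|) |y| := by
              simp [hT, hy.1, abs_lt]
            by_cases hx : x ∈ Set.Ioo (-|y|) |y|
            · rw [Set.indicator_of_mem hx, Set.indicator_of_mem (this.2 hx)]; simp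
            · rw [Set.indicator_of_notMem hx, Set.indicator_of_notMem fun h => hx (this.1 h)]
          simp only [h1]
          rw [lintegral_indicator_const measurableSet_Ioo, Real.volume_Ioo,
            Set.indicator_of_mem (show y ∈ Set.Icc (-R) R from abs_le.1 hy.1), ← ENNReal.ofReal_inv_of_pos hy0,
            ← ENNReal.ofReal_mul (by positivity)]
          apply le_of_eq
          rw [show |y|⁻¹ * (|y| - -|y|) = 2 by field_simp; norm_num]
          simp
        · have h1 : ∀ x : ℝ, (x : ℂ) + y * Complex.I ∉ T := by
            intro x hx
            have h2 : |x| < |y| := by simpa using hx.1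
            have h3 : |y| ≤ R := by simpa using hx.2
            exact hy ⟨h3, abs_pos.1 ((abs_nonneg _).trans_lt h2)⟩
          simp [h1]
    _ = _ := by
        rw [lintegral_indicator_const measurableSet_Icc, Real.volume_Icc, sub_neg_eq_add,
          ← two_mul, ENNReal.ofReal_mul (by norm_num), ← mul_assoc]
        norm_num

/-! ### Boundedness on the weighted space -/

/-- The factor `μ` localises to the vertical sectors, where the singular weight `1/|y|` is at most
`2/|z|`. This is how estimates for the radial weight suffice. -/
lemma weight_mul_dilatation_le {z : ℂ} (hz : z ∈ offDiagonal) (c : ℝ≥0∞) :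
    (ENNReal.ofReal |z.im|)⁻¹ * (‖stretchDilatation K z‖ₑ * c) ^ 2 ≤
      2 * (‖((‖z‖ ^ (-(1 / 2) : ℝ) : ℝ) : ℂ)‖ₑ * c) ^ 2 := by
  by_cases h0 : stretchDilatation K z = 0
  · simp [h0]
  have h1 := weight_le_radial (abs_re_lt_abs_im_of_dilatation_ne_zero hK hz h0)
  have h2 := enorm_stretchDilatation_le_one hK hz
  calc _ ≤ (2 * ‖((‖z‖ ^ (-(1 / 2) : ℝ) : ℝ) : ℂ)‖ₑ ^ 2) * (1 * c) ^ 2 := by gcongr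
    _ = _ := by ring

omit hK in
lemma lintegral_radial_le (f : ℂ → ℂ) :
    ∫⁻ z, (‖((‖z‖ ^ (-(1 / 2) : ℝ) : ℝ) : ℂ)‖ₑ * ‖f z‖ₑ) ^ 2 ≤
      ∫⁻ z, (ENNReal.ofReal |z.im|)⁻¹ * ‖f z‖ₑ ^ 2 := by
  gcongr with z
  rw [mul_pow]
  gcongr
  exact radial_weight_le z

theorem boundedOnWeighted_stretchDilatation : BoundedOnWeighted (stretchDilatation K) := by
  obtain ⟨C, hC⟩ := exists_weighted_bound (t := 1 / 2) (by rw [abs_lt]; norm_num)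
  refine ⟨4 * (1 + 2 * C), fun f hf hc => ?_⟩
  have hf2 := memLp_volume_of_weightMeasure hf hc
  have hg := isBeurlingTransform_beurlingL2 hf2
  set g : ℂ → ℂ := ⇑(beurlingL2 hf2.toLp) with hgdef
  have hgm : AEStronglyMeasurable g volume := Lp.aestronglyMeasurable _
  have hΦm : AEStronglyMeasurable (fun z => f z - stretchDilatation K z * g z) volume :=
    hf2.1.sub ((measurable_stretchDilatation K).aestronglyMeasurable.mul hgm)
  refine ⟨fun z => f z - stretchDilatation K z * g z, ⟨g, hg, ae_of_all _ fun z => rfl⟩,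
    hΦm.mono_ac weightMeasure_absolutelyContinuous_volume, eLpNorm_two_le ?_⟩
  rw [lintegral_weightMeasure (hΦm.enorm.pow_const 2),
    lintegral_weightMeasure (hf2.1.enorm.pow_const 2)]
  have hfm : AEMeasurable (fun z : ℂ => (ENNReal.ofReal |z.im|)⁻¹ * ‖f z‖ₑ ^ 2) :=
    measurable_weight.aemeasurable.mul (hf2.1.enorm.pow_const 2)
  set N := ∫⁻ z, (ENNReal.ofReal |z.im|)⁻¹ * ‖f z‖ₑ ^ 2 with hN
  calc _ ≤ ∫⁻ z, 4 * ((ENNReal.ofReal |z.im|)⁻¹ * ‖f z‖ₑ ^ 2 +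
        2 * (‖((‖z‖ ^ (-(1 / 2) : ℝ) : ℝ) : ℂ)‖ₑ * ‖g z‖ₑ) ^ 2) := by
        apply lintegral_mono_ae
        filter_upwards [ae_mem_offDiagonal] with z hz
        calc _ ≤ (ENNReal.ofReal |z.im|)⁻¹ *
              (4 * (‖f z‖ₑ ^ 2 + (‖stretchDilatation K z‖ₑ * ‖g z‖ₑ) ^ 2)) := by
              gcongr
              refine le_trans ?_ (add_sq_le_four_mul _ _)
              gcongr
              rw [← enorm_mul]
              exact enorm_sub_le
          _ = 4 * ((ENNReal.ofReal |z.im|)⁻¹ * ‖f z‖ₑ ^ 2 + (ENNReal.ofReal |z.im|)⁻¹ *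
              (‖stretchDilatation K z‖ₑ * ‖g z‖ₑ) ^ 2) := by ring
          _ ≤ _ := by gcongr 4 * (_ + ?_); exact weight_mul_dilatation_le hK hz _
    _ = 4 * (N + 2 * ∫⁻ z, (‖((‖z‖ ^ (-(1 / 2) : ℝ) : ℝ) : ℂ)‖ₑ * ‖g z‖ₑ) ^ 2) := by
        rw [lintegral_const_mul' _ _ (by norm_num), lintegral_add_left' hfm,
          lintegral_const_mul' _ _ (by norm_num)]
    _ ≤ 4 * (N + 2 * (C * N)) := by
        gcongr
        exact (hC f g hf2 hg).trans (by gcongr; exact lintegral_radial_le f)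
    _ = (4 * (1 + 2 * C)) * 1 * N := by ring
    -- `eLpNorm_two_le` asks for the square of the constant, which is harmless since the constant is
    -- at least `1`.
    _ ≤ (4 * (1 + 2 * C)) * (4 * (1 + 2 * C)) * N := by
        gcongr
        calc (1 : ℝ≥0∞) ≤ 4 * 1 := by norm_num
          _ ≤ 4 * (1 + 2 * C) := by gcongr; exact le_self_add
    _ = _ := by push_cast; ring

/-! ### Inversion of `I - μ S` -/

/-- The difference satisfies `d = μ S d`, so `‖d‖ ≤ k ‖S d‖ = k ‖d‖` with `k = 1 - 1/K < 1`. -/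
lemma ae_eq_of_beurlingEq {h h' Φ : ℂ → ℂ} (hh : MemLp h 2) (hh' : MemLp h' 2)
    (e : BeurlingEq (stretchDilatation K) h Φ) (e' : BeurlingEq (stretchDilatation K) h' Φ) :
    h' =ᵐ[volume] h := by
  obtain ⟨g, hg, hgΦ⟩ := e
  obtain ⟨g', hg', hgΦ'⟩ := e'
  have hk1 := dilatation_bound_lt_one hK
  have hk0 := dilatation_bound_nonneg hK
  set d := hh'.toLp - hh.toLp with hd
  have hdco : d =ᵐ[volume] fun z => h' z - h z := by
    filter_upwards [Lp.coeFn_sub hh'.toLp hh.toLp, hh.coeFn_toLp, hh'.coeFn_toLp] with z h1 h2 h3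
    rw [h1, Pi.sub_apply, h2, h3]
  have hSd : beurlingL2 d =ᵐ[volume] fun z => g' z - g z := by
    rw [hd, map_sub]
    filter_upwards [Lp.coeFn_sub (beurlingL2 hh'.toLp) (beurlingL2 hh.toLp), hg.ae_eq hh,
      hg'.ae_eq hh'] with z h1 h2 h3
    rw [h1, Pi.sub_apply, h2, h3]
  have hle : ‖d‖ ≤ (1 - 1 / K) * ‖beurlingL2 d‖ := by
    refine Lp.norm_le_mul_norm_of_ae_le_mul ?_
    filter_upwards [hdco, hSd, hgΦ, hgΦ', ae_mem_offDiagonal] with z h1 h2 h3 h4 hz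
    rw [h1, h2]
    have : h' z - h z = stretchDilatation K z * (g' z - g z) := by linear_combination h4 - h3
    rw [this, norm_mul]
    gcongr
    exact norm_stretchDilatation_le hK hz
  rw [beurlingL2.norm_map] at hle
  have hd0 : d = 0 := by
    rw [← norm_eq_zero]
    nlinarith [norm_nonneg d]
  have := sub_eq_zero.1 (hd ▸ hd0)
  exact (MemLp.toLp_eq_toLp_iff hh' hh).1 this

/-- The solution of `h - μ S h = Φ` in `L²`, by change of variables. -/
lemma exists_beurlingEq {Φ : ℂ → ℂ} (hΦ : MemLp Φ 2) : ∃ Ψ : Lp ℂ 2 (volume : Measure ℂ),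
    BeurlingEq (stretchDilatation K) (pullDzbar hK Ψ) Φ ∧
    (∀ᵐ z, ‖Ψ (stretchMap K z)‖ * ‖dz (stretchMap K) z‖ ≤ (1 - (1 - 1 / K) ^ 2)⁻¹ * ‖Φ z‖) ∧
    ∀ G : ℂ → ℝ≥0∞, ∫⁻ w, (G w * ‖Ψ w‖ₑ) ^ 2 ≤ ENNReal.ofReal (1 - (1 - 1 / K) ^ 2)⁻¹ ^ 2 *
      ∫⁻ z, (G (stretchMap K z) * ‖Φ z‖ₑ) ^ 2 := by
  have hpos := one_sub_dilatation_bound_sq_pos hK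
  set Φ' := hΦ.1.mk Φ with hΦ'
  have hΦ'm : Measurable Φ' := hΦ.1.stronglyMeasurable_mk.measurable
  have hΦΦ' : Φ =ᵐ[volume] Φ' := hΦ.1.ae_eq_mk
  -- The value of `Ψ ∘ ρ` forced by `h - μ S h = Φ`. It is set to zero on the diagonals so that the
  -- hypothesis of `lintegral_le_comp_stretchMap` holds.
  set F : ℂ → ℂ := offDiagonal.indicator fun z =>
    Φ' z / ((starRingEnd ℂ) (dz (stretchMap K) z) * (1 - ‖stretchDilatation K z‖ ^ 2 : ℝ)) with hF
  have hFm : Measurable F := by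
    refine Measurable.indicator ?_ isOpen_offDiagonal.measurableSet
    refine hΦ'm.div ((measurable_conj_comp (measurable_dz _)).mul ?_)
    exact Complex.measurable_ofReal.comp
      (measurable_const.sub ((measurable_stretchDilatation K).norm.pow_const 2))
  let e := (isHomeomorph_stretchMap hK).homeomorph
  have he : ∀ z, e.symm (stretchMap K z) = z := fun z => e.symm_apply_apply z
  set ψ : ℂ → ℂ := fun w => F (e.symm w) with hψ
  have hψm : Measurable ψ := hFm.comp e.symm.continuous.measurable
  have hψρ : ∀ z, ψ (stretchMap K z) = F z := fun z => by rw [hψ]; simp only [he]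
  have hμ : ∀ z ∈ offDiagonal, 1 - (1 - 1 / K) ^ 2 ≤ 1 - ‖stretchDilatation K z‖ ^ 2 := by
    intro z hz
    have := norm_stretchDilatation_le hK hz
    gcongr
  have hFbd : ∀ z ∈ offDiagonal,
      ‖F z‖ * ‖dz (stretchMap K) z‖ ≤ (1 - (1 - 1 / K) ^ 2)⁻¹ * ‖Φ' z‖ := by
    intro z hz
    have h1 := hμ z hz
    have h2 : 0 < 1 - ‖stretchDilatation K z‖ ^ 2 := hpos.trans_le h1
    have h3 : 0 < ‖dz (stretchMap K) z‖ := norm_pos_iff.2 (dz_stretchMap_ne_zero hK hz)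
    rw [hF, Set.indicator_of_mem hz, norm_div, norm_mul, RCLike.norm_conj, Complex.norm_real,
      Real.norm_of_nonneg h2.le]
    calc _ = (1 - ‖stretchDilatation K z‖ ^ 2)⁻¹ * ‖Φ' z‖ := by field_simp
      _ ≤ _ := by gcongr
  -- The weight `G` is left arbitrary: the constant one puts `ψ` in `L²`, and a power of `|w|` is
  -- inserted for the weighted estimate.
  have hint : ∀ G : ℂ → ℝ≥0∞, ∫⁻ w, (G w * ‖ψ w‖ₑ) ^ 2 ≤
      ENNReal.ofReal (1 - (1 - 1 / K) ^ 2)⁻¹ ^ 2 *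
        ∫⁻ z, (G (stretchMap K z) * ‖Φ z‖ₑ) ^ 2 := by
    intro G
    rw [← lintegral_const_mul' _ _ (by finiteness)]
    refine (lintegral_le_comp_stretchMap hK (F := fun w => (G w * ‖ψ w‖ₑ) ^ 2) ?_).trans ?_
    · intro z hz
      simp only [hψρ, hF, Set.indicator_of_notMem hz]
      simp
    · apply lintegral_mono_ae
      filter_upwards [ae_mem_offDiagonal, hΦΦ'] with z hz h
      rw [hψρ, h]
      have h1 : ‖F z‖ₑ * ‖dz (stretchMap K) z‖ₑ ≤
          ENNReal.ofReal (1 - (1 - 1 / K) ^ 2)⁻¹ * ‖Φ' z‖ₑ := by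
        rw [← ofReal_norm, ← ofReal_norm, ← ofReal_norm, ← ENNReal.ofReal_mul (norm_nonneg _),
          ← ENNReal.ofReal_mul (by positivity)]
        exact ENNReal.ofReal_le_ofReal (hFbd z hz)
      calc _ = (G (stretchMap K z) * (‖F z‖ₑ * ‖dz (stretchMap K) z‖ₑ)) ^ 2 := by ring
        _ ≤ (G (stretchMap K z) * (ENNReal.ofReal (1 - (1 - 1 / K) ^ 2)⁻¹ * ‖Φ' z‖ₑ)) ^ 2 := by
          gcongr
        _ = _ := by ring
  have hψL : MemLp ψ 2 := by
    rw [memLp_two_iff hψm.aestronglyMeasurable]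
    have h1 := hint 1
    simp only [Pi.one_apply, one_mul] at h1
    exact h1.trans_lt (ENNReal.mul_lt_top (by finiteness) ((memLp_two_iff hΦ.1).1 hΦ))
  have hψae : ∀ᵐ z, hψL.toLp ψ (stretchMap K z) = F z := by
    filter_upwards [(quasiMeasurePreserving_stretchMap hK).ae hψL.coeFn_toLp] with z hz
    rw [hz, hψρ]
  refine ⟨hψL.toLp, ⟨pullDz hK hψL.toLp, ?_, ?_⟩, ?_, fun G => ?_⟩
  · have h1 := isBeurlingTransform_beurlingL2 (Lp.memLp (pullDzbar hK hψL.toLp))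
    rw [Lp.toLp_coeFn, beurlingL2_pullDzbar] at h1
    exact h1
  -- Since `∂̄ρ = μ ∂ρ`, the terms with `SΨ ∘ ρ` cancel and there remains `(Ψ ∘ ρ) conj(∂ρ) (1 -
  -- |μ|²) = Φ`.
  · filter_upwards [coeFn_pullDzbar hK hψL.toLp, coeFn_pullDz hK hψL.toLp, hψae,
      ae_mem_offDiagonal, hΦΦ'] with z h1 h2 h3 hz h4
    have h5 : ((1 - ‖stretchDilatation K z‖ ^ 2 : ℝ) : ℂ) ≠ 0 := by
      exact_mod_cast (hpos.trans_le (hμ z hz)).ne'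
    have h6 : (starRingEnd ℂ) (dz (stretchMap K) z) ≠ 0 := by
      rw [Ne, map_eq_zero]; exact dz_stretchMap_ne_zero hK hz
    have h7 : F z * ((starRingEnd ℂ) (dz (stretchMap K) z) *
        (1 - ‖stretchDilatation K z‖ ^ 2 : ℝ)) = Φ' z := by
      rw [hF, Set.indicator_of_mem hz]
      exact div_mul_cancel₀ _ (mul_ne_zero h6 h5)
    have h8 : ((1 - ‖stretchDilatation K z‖ ^ 2 : ℝ) : ℂ) =
        1 - stretchDilatation K z * (starRingEnd ℂ) (stretchDilatation K z) := by
      rw [Complex.mul_conj, Complex.normSq_eq_norm_sq]; push_cast; ring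
    rw [h1, h2, h3, h4, ← h7, h8, dzbar_stretchMap_eq hK hz, map_mul]
    ring
  · filter_upwards [hψae, ae_mem_offDiagonal, hΦΦ'] with z h1 hz h2
    rw [h1, h2]
    exact hFbd z hz
  · refine le_trans (le_of_eq ?_) (hint G)
    apply lintegral_congr_ae
    filter_upwards [hψL.coeFn_toLp] with w hw
    rw [hw]

-- Squared, this says `|ρ(z)|^(-K) = 1/|z|`: the radial weight on the source is the power weight
-- with exponent `K` on the target.
omit hK in
lemma norm_stretchMap_rpow (hK : 1 < K) (z : ℂ) :
    ‖stretchMap K z‖ ^ (-(K / 2)) = ‖z‖ ^ (-(1 / 2) : ℝ) := by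
  rw [norm_stretchMap, ← Real.rpow_mul (norm_nonneg _)]
  congr 1
  field_simp

/-- Of the two terms of `h`, the one with `Ψ ∘ ρ` is bounded pointwise by `|Φ|`. The one with `SΨ ∘
ρ` contains `μ`, so it is estimated with the radial weight, moved to the target, bounded there by
the weighted inequality for `S`, and `Ψ` is moved back to `Φ`. -/
theorem inverseBoundedOnWeighted_stretchDilatation (hK₂ : K < 2) :
    InverseBoundedOnWeighted (stretchDilatation K) := by
  -- The only use of `K < 2`: the weight `|w|^(-K)` must lie in the admissible range.
  obtain ⟨C, hC⟩ := exists_weighted_bound (t := K / 2) (by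
    rw [abs_of_pos (by positivity)]; linarith)
  have hpos := one_sub_dilatation_bound_sq_pos hK
  set q : ℝ := (1 - (1 - 1 / K) ^ 2)⁻¹ with hq
  have hq0 : 0 ≤ q := by positivity
  set M : ℝ≥0 := 4 * (2 * (q.toNNReal * (C * q.toNNReal ^ 2)) + q.toNNReal ^ 2) with hM
  refine ⟨1 + M, fun Φ hΦ hc => ?_⟩
  have hΦ2 := memLp_volume_of_weightMeasure hΦ hc
  obtain ⟨Ψ, hEq, hpt, hint⟩ := exists_beurlingEq hK hΦ2
  have hhm : AEStronglyMeasurable (pullDzbar hK Ψ) volume := Lp.aestronglyMeasurable _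
  refine ⟨pullDzbar hK Ψ, Lp.memLp _, hEq,
    fun h' hh' he' => ae_eq_of_beurlingEq hK (Lp.memLp _) hh' hEq he', eLpNorm_two_le ?_⟩
  rw [lintegral_weightMeasure (hhm.enorm.pow_const 2),
    lintegral_weightMeasure (hΦ2.1.enorm.pow_const 2)]
  have hΦm : AEMeasurable (fun z : ℂ => (ENNReal.ofReal |z.im|)⁻¹ * ‖Φ z‖ₑ ^ 2) :=
    measurable_weight.aemeasurable.mul (hΦ2.1.enorm.pow_const 2)
  set N := ∫⁻ z, (ENNReal.ofReal |z.im|)⁻¹ * ‖Φ z‖ₑ ^ 2 with hN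
  have hS : ∫⁻ w, (‖((‖w‖ ^ (-(K / 2)) : ℝ) : ℂ)‖ₑ * ‖beurlingL2 Ψ w‖ₑ) ^ 2 ≤
      C * (ENNReal.ofReal q ^ 2 * N) := by
    have h1 := isBeurlingTransform_beurlingL2 (Lp.memLp Ψ)
    rw [Lp.toLp_coeFn] at h1
    refine (hC Ψ (beurlingL2 Ψ) (Lp.memLp Ψ) h1).trans ?_
    gcongr
    refine (hint fun w => ‖((‖w‖ ^ (-(K / 2)) : ℝ) : ℂ)‖ₑ).trans ?_
    gcongr
    simp only [norm_stretchMap_rpow hK]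
    exact lintegral_radial_le Φ
  calc _ ≤ ∫⁻ z, 4 * (2 * (‖dz (stretchMap K) z‖ₑ ^ 2 *
        (‖((‖stretchMap K z‖ ^ (-(K / 2)) : ℝ) : ℂ)‖ₑ * ‖beurlingL2 Ψ (stretchMap K z)‖ₑ) ^ 2) +
        ENNReal.ofReal q ^ 2 * ((ENNReal.ofReal |z.im|)⁻¹ * ‖Φ z‖ₑ ^ 2)) := by
        apply lintegral_mono_ae
        filter_upwards [coeFn_pullDzbar hK Ψ, hpt, ae_mem_offDiagonal] with z h1 h2 hz
        rw [h1, norm_stretchMap_rpow hK]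
        have h3 : ‖Ψ (stretchMap K z) * (starRingEnd ℂ) (dz (stretchMap K) z)‖ₑ ≤
            ENNReal.ofReal q * ‖Φ z‖ₑ := by
          rw [← ofReal_norm, ← ofReal_norm, ← ENNReal.ofReal_mul hq0, norm_mul, RCLike.norm_conj]
          exact ENNReal.ofReal_le_ofReal h2
        calc _ ≤ (ENNReal.ofReal |z.im|)⁻¹ * (4 * (‖beurlingL2 Ψ (stretchMap K z) *
              dzbar (stretchMap K) z‖ₑ ^ 2 + (ENNReal.ofReal q * ‖Φ z‖ₑ) ^ 2)) := by
              gcongr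
              refine le_trans ?_ (add_sq_le_four_mul _ _)
              gcongr
              exact (enorm_add_le _ _).trans (by gcongr)
          _ = 4 * ((ENNReal.ofReal |z.im|)⁻¹ * (‖stretchDilatation K z‖ₑ *
              (‖dz (stretchMap K) z‖ₑ * ‖beurlingL2 Ψ (stretchMap K z)‖ₑ)) ^ 2 +
              ENNReal.ofReal q ^ 2 * ((ENNReal.ofReal |z.im|)⁻¹ * ‖Φ z‖ₑ ^ 2)) := by
              rw [dzbar_stretchMap_eq hK hz, enorm_mul, enorm_mul]; ring
          _ ≤ 4 * (2 * (‖((‖z‖ ^ (-(1 / 2) : ℝ) : ℝ) : ℂ)‖ₑ *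
              (‖dz (stretchMap K) z‖ₑ * ‖beurlingL2 Ψ (stretchMap K z)‖ₑ)) ^ 2 +
              ENNReal.ofReal q ^ 2 * ((ENNReal.ofReal |z.im|)⁻¹ * ‖Φ z‖ₑ ^ 2)) := by
              gcongr 4 * (?_ + _)
              exact weight_mul_dilatation_le hK hz _
          _ = _ := by ring
    _ = 4 * (2 * (∫⁻ z, ‖dz (stretchMap K) z‖ₑ ^ 2 *
        (‖((‖stretchMap K z‖ ^ (-(K / 2)) : ℝ) : ℂ)‖ₑ * ‖beurlingL2 Ψ (stretchMap K z)‖ₑ) ^ 2) +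
        ENNReal.ofReal q ^ 2 * N) := by
        rw [lintegral_const_mul' _ _ (by norm_num), lintegral_add_right' _ (hΦm.const_mul _),
          lintegral_const_mul' _ _ (by norm_num), lintegral_const_mul' _ _ (by finiteness)]
    _ ≤ 4 * (2 * (ENNReal.ofReal q * (C * (ENNReal.ofReal q ^ 2 * N))) +
        ENNReal.ofReal q ^ 2 * N) := by
        gcongr
        refine (lintegral_comp_stretchMap_le hK fun w =>
          (‖((‖w‖ ^ (-(K / 2)) : ℝ) : ℂ)‖ₑ * ‖beurlingL2 Ψ w‖ₑ) ^ 2).trans ?_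
        gcongr
    _ = (1 * (M : ℝ≥0∞)) * N := by
        rw [hM]
        simp only [ENNReal.ofReal]
        push_cast
        ring
    _ ≤ ((1 + M) * (1 + M)) * N := by
        gcongr
        · exact le_self_add
        · exact le_add_self
    _ = _ := by push_cast; ring

end stretchMap

end

end QCBeurling

/-! ### The main theorem -/

theorem proposition2 (K : ℝ) (hK₁ : 1 < K) (hK₂ : K < 2) :
    ∃ ρ μ : ℂ → ℂ,
      QCBeurling.IsQuasiconformal ρ ∧
      QCBeurling.IsComplexDilatation ρ μ ∧
      ¬ QCBeurling.IsBilipschitz ρ ∧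
      QCBeurling.IsCarleson (QCBeurling.dilatationMeasure μ) ∧
      QCBeurling.InvertibleOnWeighted μ ∧
      (∀ x : ℝ, ρ (x : ℂ) = ((Real.sign x * |x| ^ (1 / K) : ℝ) : ℂ)) ∧
      (∀ z : ℂ, ρ z = QCBeurling.stretchMap K z) :=
  ⟨QCBeurling.stretchMap K, QCBeurling.stretchDilatation K,
    QCBeurling.isQuasiconformal_stretchMap hK₁, QCBeurling.isComplexDilatation_stretchMap hK₁,
    QCBeurling.not_isBilipschitz_stretchMap hK₁, QCBeurling.isCarleson_dilatationMeasure hK₁,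
    ⟨QCBeurling.boundedOnWeighted_stretchDilatation hK₁,
      QCBeurling.inverseBoundedOnWeighted_stretchDilatation hK₁ hK₂⟩,
    QCBeurling.stretchMap_ofReal hK₁, fun _ => rfl⟩
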